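/- Let $\gamma,\sigma,\mathcal L>0$ and let $(W(\ell))_{\ell\ge 0}$ be a complex Wiener process with $\mathsf E|W(\ell)|^2=\ell\sigma^2$ (independent real and imaginary parts, each $\sigma/\sqrt2$ times a standard real Brownian motion). The per-sample zero-dispersion channel maps an input $X\in\mathbb C$, independent of $W$, to $$Y=[X+W(\mathcal L)]\,e^{j\gamma\int_0^{\mathcal L}|X+W(\ell)|^2\,d\ell}.$$ Let $(R_0,\Phi_0)$ and $(R,\Phi)$ be the polar coordinates of $X$ and $Y$. Let $\mathcal F$ be one of the following sets of laws of $R_0$: (a) $\{R_0\le\rho \text{ a.s.}\}$ with $0<\rho<\infty$; (b) $\{\mathsf E\,\mathcal C(R_0)\le A\}$ with $0<A<\infty$ and a cost function $\mathcal C:[0,\infty)\to[0,\infty)$ that is lower semicontinuous and non-decreasing, has $\mathcal C(0)=0$ and $\mathcal C(r)\to\infty$ as $r\to\infty$, extends analytically to a strip $\{z\in\mathbb C:|\Im z|<\delta\}$ for some $\delta>0$, and satisfies $\mathcal C(r)=\omega(r^2)$; (c) the intersection of a set as in (a) with a set as in (b) in which $\mathcal C(r)=\omega(r^2)$ is replaced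 by $\mathcal C(r)=\omega(\ln r)$. Let $C=\sup I(X;Y)$, the supremum over all laws of $X$ for which the law of $R_0$ lies in $\mathcal F$. Then: 1. The output amplitude $R$ does not depend on the input phase $\Phi_0$: for every $r_0\ge 0$ the conditional law of $R$ given $(R_0,\Phi_0)=(r_0,\phi_0)$ is the same for all $\phi_0$. 2. A capacity-achieving input, i.e. an $X^*$ whose amplitude law lies in $\mathcal F$ and for which $I(X^*;Y)=C$, has uniform phase $\Phi_0^*\sim\mathcal U(0,2\pi)$ independent of its amplitude $R_0^*$: $X^*$ has the law of $R_0^*e^{j\Phi_0^*}$ with $$dF_{(R_0^*,\Phi_0^*)}(r_0,\phi_0)=\frac1{2\pi}\,d\phi_0\,dF_{R_0^*}(r_0).$$ (The law of $X^*$ is a law on $\mathbb C$; the point $0$ has no phase of its own.) -/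

import Mathlib

open MeasureTheory ProbabilityTheory Filter Asymptotics
open scoped ENNReal NNReal

noncomputable section

namespace PZD

/-- `W` is a complex (circularly symmetric) Wiener process with `E |W ℓ|² = ℓ σ²`: its real and
imaginary parts are independent and each is `σ / √2` times a standard real Brownian motion. -/
structure IsComplexWiener {Ω : Type*} [MeasurableSpace Ω] (σ : ℝ) (W : ℝ≥0 → Ω → ℂ)
    (P : Measure Ω) : Prop where
  re : IsBrownianReal (fun t ω => (σ / √2)⁻¹ * (W t ω).re) P
  im : IsBrownianReal (fun t ω => (σ / √2)⁻¹ * (W t ω).im) P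
  indep : IndepFun (fun ω t => (W t ω).re) (fun ω t => (W t ω).im) P

/-- The output of the per-sample zero-dispersion channel for the input value `x` and the noise
path `w`: `Y = [x + w(L)] exp (j γ ∫₀ᴸ |x + w(ℓ)|² dℓ)`. -/
def output (γ L : ℝ) (w : ℝ≥0 → ℂ) (x : ℂ) : ℂ :=
  (x + w L.toNNReal) *
    Complex.exp (Complex.I * (γ * ∫ ℓ in (0 : ℝ)..L, ‖x + w ℓ.toNNReal‖ ^ 2 : ℝ))

/-- The complex number with polar coordinates `(r, φ)`. -/
def polar (r : ℝ≥0) (φ : ℝ) : ℂ := (r : ℝ) * Complex.exp (Complex.I * φ)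

section Channel

variable {Ω : Type*} [MeasurableSpace Ω]

/-- The law of the output amplitude `R = |Y|` given the input value `x`. -/
def outputAmplitudeLaw (γ L : ℝ) (W : ℝ≥0 → Ω → ℂ) (P : Measure Ω) (x : ℂ) : Measure ℝ :=
  P.map fun ω => ‖output γ L (fun t => W t ω) x‖

/-- The joint law of `(X, Y)` when the input `X` has law `μ` and is independent of the noise. -/
def jointLaw (γ L : ℝ) (W : ℝ≥0 → Ω → ℂ) (P : Measure Ω) (μ : Measure ℂ) : Measure (ℂ × ℂ) :=
  (μ.prod P).map fun p => (p.1, output γ L (fun t => W t p.2) p.1)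

/-- The mutual information `I(X; Y)` (in nats): the Kullback–Leibler divergence of the joint law
of `(X, Y)` from the product of its marginals. -/
def mutualInfo (γ L : ℝ) (W : ℝ≥0 → Ω → ℂ) (P : Measure Ω) (μ : Measure ℂ) : ℝ≥0∞ :=
  InformationTheory.klDiv (jointLaw γ L W P μ)
    ((jointLaw γ L W P μ).fst.prod (jointLaw γ L W P μ).snd)

end Channel

/-- The law of the input amplitude `R₀ = |X|` when `X` has law `μ`. -/
def amplitudeLaw (μ : Measure ℂ) : Measure ℝ≥0 := μ.map fun x => ‖x‖₊

/-- Amplitude laws that satisfy the peak amplitude constraint `R₀ ≤ ρ`. -/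
def peakSet (ρ : ℝ≥0) : Set (Measure ℝ≥0) := {ν | ν (Set.Icc 0 ρ) = 1}

/-- Amplitude laws that satisfy the average cost constraint `E C(R₀) ≤ A`. -/
def costSet (C : ℝ≥0 → ℝ≥0) (A : ℝ≥0) : Set (Measure ℝ≥0) :=
  {ν | ∫⁻ r, (C r : ℝ≥0∞) ∂ν ≤ A}

/-- A cost function: lower semicontinuous, non-decreasing, zero at zero, tending to infinity,
with an analytic extension to a horizontal strip, and growing faster than `g`. -/
structure IsCost (g : ℝ≥0 → ℝ) (C : ℝ≥0 → ℝ≥0) : Prop where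
  lsc : LowerSemicontinuous C
  mono : Monotone C
  zero : C 0 = 0
  tendsto : Tendsto C atTop atTop
  analytic : ∃ δ : ℝ, 0 < δ ∧ ∃ f : ℂ → ℂ, AnalyticOnNhd ℂ f {z : ℂ | |z.im| < δ} ∧
    ∀ r : ℝ≥0, f ((r : ℝ) : ℂ) = ((C r : ℝ) : ℂ)
  growth : g =o[atTop] fun r => (C r : ℝ)

/-- The input constraints under consideration, as sets of admissible amplitude laws: a peak
amplitude constraint, an average cost constraint with a cost growing faster than `r²`, or both a
peak amplitude constraint and an average cost constraint with a cost growing faster than `ln r`. -/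
inductive IsInputConstraint : Set (Measure ℝ≥0) → Prop
  | peak (ρ : ℝ≥0) (hρ : 0 < ρ) : IsInputConstraint (peakSet ρ)
  | cost (C : ℝ≥0 → ℝ≥0) (A : ℝ≥0) (hA : 0 < A) (hC : IsCost (fun r => (r : ℝ) ^ 2) C) :
      IsInputConstraint (costSet C A)
  | joint (ρ : ℝ≥0) (C : ℝ≥0 → ℝ≥0) (A : ℝ≥0) (hρ : 0 < ρ) (hA : 0 < A)
      (hC : IsCost (fun r => Real.log r) C) : IsInputConstraint (peakSet ρ ∩ costSet C A)

section Capacity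

variable {Ω : Type*} [MeasurableSpace Ω]

/-- The capacity: the supremum of `I(X; Y)` over all laws of `X` whose amplitude law is in `F`. -/
def capacity (γ L : ℝ) (W : ℝ≥0 → Ω → ℂ) (P : Measure Ω) (F : Set (Measure ℝ≥0)) : ℝ≥0∞ :=
  ⨆ (μ : Measure ℂ) (_ : IsProbabilityMeasure μ) (_ : amplitudeLaw μ ∈ F), mutualInfo γ L W P μ

/-- `μ` is a capacity-achieving input law under the constraint `F`. -/
structure IsCapacityAchieving (γ L : ℝ) (W : ℝ≥0 → Ω → ℂ) (P : Measure Ω)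
    (F : Set (Measure ℝ≥0)) (μ : Measure ℂ) : Prop where
  prob : IsProbabilityMeasure μ
  mem : amplitudeLaw μ ∈ F
  eq : mutualInfo γ L W P μ = capacity γ L W P F

end Capacity

/-- The uniform distribution on `[0, 2π)`. -/
def uniformPhase : Measure ℝ := (volume : Measure ℝ)[|Set.Ico 0 (2 * Real.pi)]

end PZD

end

/-! The law of the Wiener process and the energy of a path are rotation invariant, so the channel
kernel `K` commutes with rotations of the plane. The first claim follows at once, because rotating
the output does not change its modulus.

For the second claim let `μ` be optimal, and let `μ'` be its average over an independent uniform
rotation. `μ'` has the same amplitude law, so it is admissible, and its output law `ν'` is rotation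
invariant. Undoing the rotation is a channel that sends `μ' ⊗ₘ K` to `μ ⊗ₘ K` and `μ'.prod ν'` to
`μ.prod ν'`. Data processing and the compensation identity `klDiv_fst_prod_eq_add` therefore give
D(K ∘ₘ μ ‖ ν') + I(μ) ≤ I(μ') ≤ I(μ). Once I(μ) is known to be finite it cancels, so `K ∘ₘ μ = ν'`
is rotation invariant.

It remains to pull invariance back from the output to the input (`map_rot_eq_of_map_rot_comp_eq`).
For m ≠ 0 the output moments of y^m exp(-p|y|²) vanish. A rotation by the nonlinear phase multiplies
y^m by exp(imγ∫|x+W|²), so the conditional mean of the test function given x is an exponential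
quadratic functional of Brownian motion. Solving it by a discrete Riccati recursion gives a nonzero
multiple of x^m exp(-q|x|²), where q is a Möbius image of p with determinant one. Hence the input
moments of mode m vanish along a nonconstant curve in the right half-plane, then on the whole
half-plane by the identity theorem, and so do their derivatives in q. These Gaussian-damped moments
determine `μ`, which is therefore invariant.

Finiteness of I(μ) (`IsRegularWiener.mutualInfo_ne_top`) uses the second moment, which every
constraint supplies, and a density bound for end point and nonlinear phase that is uniform in the
input. The bound comes from splitting an independent Gaussian off the path without moving its end
point; the phase is a quadratic in that Gaussian. -/

namespace InformationTheory

/-! ### Divergence: the compensation identity and a finiteness criterion -/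

variable {α β : Type*} [MeasurableSpace α] [MeasurableSpace β]

lemma klDiv_map_measurableEquiv (μ ν : Measure α) [IsFiniteMeasure μ] [IsFiniteMeasure ν]
    (e : α ≃ᵐ β) : klDiv (μ.map e) (ν.map e) = klDiv μ ν := by
  refine le_antisymm (klDiv_map_le μ ν e.measurable) ?_
  have := klDiv_map_le (μ.map e) (ν.map e) e.symm.measurable
  rwa [MeasurableEquiv.map_symm_map, MeasurableEquiv.map_symm_map] at this

/-- Compensation identity: replacing the output marginal by another measure costs the divergence
of the output marginal from that measure. -/
lemma klDiv_fst_prod_eq_add [StandardBorelSpace α] [Nonempty α] (J : Measure (α × β))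
    [IsProbabilityMeasure J] (ν : Measure β) [IsFiniteMeasure ν] :
    klDiv J (J.fst.prod ν) = klDiv J.snd ν + klDiv J (J.fst.prod J.snd) := by
  -- Disintegrating over the second coordinate writes `J` and each product as a composition over
  -- `β`, and the claim becomes the chain rule for the divergence.
  set κ := (J.map Prod.swap).condKernel
  have : IsProbabilityMeasure (J.map Prod.swap) :=
    Measure.isProbabilityMeasure_map measurable_swap.aemeasurable
  have hJ : J.map Prod.swap = J.snd ⊗ₘ κ := by
    rw [← Measure.fst_map_swap]; exact ((J.map Prod.swap).disintegrate κ).symm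
  have hprod (ν' : Measure β) [IsFiniteMeasure ν'] :
      klDiv J (J.fst.prod ν') = klDiv (J.snd ⊗ₘ κ) (ν' ⊗ₘ Kernel.const β J.fst) := by
    rw [← klDiv_map_measurableEquiv _ _ MeasurableEquiv.prodComm, Measure.compProd_const, ← hJ,
      ← Measure.prod_swap (μ := J.fst)]
    rfl
  rw [hprod ν, hprod J.snd, klDiv_compProd_eq_add]

/-- A finiteness criterion for the Kullback–Leibler divergence: it suffices to dominate the
density by the exponential of a function which is integrable for the first measure. -/
lemma klDiv_ne_top_of_le_withDensity {μ ν : Measure α} [IsFiniteMeasure μ] [IsFiniteMeasure ν]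
    {h : α → ℝ} (hm : Measurable h) (h0 : ∀ x, 0 ≤ h x)
    (hle : μ ≤ ν.withDensity fun x => ENNReal.ofReal (Real.exp (h x)))
    (hint : ∫⁻ x, ENNReal.ofReal (h x) ∂μ ≠ ∞) : klDiv μ ν ≠ ∞ := by
  have hac : μ ≪ ν :=
    (Measure.absolutelyContinuous_of_le hle).trans (withDensity_absolutelyContinuous _ _)
  have hdens : ∀ᵐ x ∂ν, μ.rnDeriv ν x ≤ ENNReal.ofReal (Real.exp (h x)) := by
    refine ae_le_of_forall_setLIntegral_le_of_sigmaFinite (Measure.measurable_rnDeriv _ _) ?_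
    intro s hs _
    rw [Measure.setLIntegral_rnDeriv hac, ← withDensity_apply _ hs]
    exact hle s
  rw [klDiv_eq_lintegral_klFun_of_ac hac]
  -- Here klFun f = f log f + 1 - f ≤ f h + 1, because log f ≤ h; the ν-integral of f h is the
  -- μ-integral of h.
  have hbound : ∫⁻ x, ENNReal.ofReal (klFun (μ.rnDeriv ν x).toReal) ∂ν ≤
      ∫⁻ x, (μ.rnDeriv ν x * ENNReal.ofReal (h x) + 1) ∂ν := by
    refine lintegral_mono_ae ?_
    filter_upwards [hdens, Measure.rnDeriv_lt_top μ ν] with x hx hx'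
    set f := (μ.rnDeriv ν x).toReal with hf
    have hf' : μ.rnDeriv ν x = ENNReal.ofReal f := (ENNReal.ofReal_toReal hx'.ne).symm
    have hfn : 0 ≤ f := ENNReal.toReal_nonneg
    have hfe : f ≤ Real.exp (h x) := ENNReal.toReal_le_of_le_ofReal (Real.exp_pos _).le hx
    rw [hf', ← ENNReal.ofReal_mul hfn, ← ENNReal.ofReal_one, ← ENNReal.ofReal_add
      (mul_nonneg hfn (h0 x)) zero_le_one]
    apply ENNReal.ofReal_le_ofReal
    rw [klFun_apply]
    rcases hfn.eq_or_lt with h1 | h1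
    · rw [← h1]; simp
    · have : Real.log f ≤ h x := (Real.log_le_iff_le_exp h1).2 hfe
      nlinarith [mul_le_mul_of_nonneg_left this hfn]
  refine ne_top_of_le_ne_top ?_ hbound
  rw [lintegral_add_right _ measurable_const,
    lintegral_rnDeriv_mul hac (by fun_prop)]
  simp [hint]

end InformationTheory

/-! ### Averaging the input of a rotation-equivariant channel -/

namespace PZD

open InformationTheory

/-- The rotation of the complex plane by the angle `θ`. -/
noncomputable def rot (θ : ℝ) (x : ℂ) : ℂ := Complex.exp (Complex.I * θ) * x

lemma continuous_rot : Continuous fun p : ℝ × ℂ => rot p.1 p.2 := by unfold rot; fun_prop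

@[fun_prop]
lemma measurable_rot' : Measurable fun p : ℝ × ℂ => rot p.1 p.2 := continuous_rot.measurable

@[fun_prop]
lemma measurable_rot (θ : ℝ) : Measurable (rot θ) := by unfold rot; fun_prop

lemma rot_neg_rot (θ : ℝ) (x : ℂ) : rot (-θ) (rot θ x) = x := by
  simp only [rot, ← mul_assoc, ← Complex.exp_add]
  simp

lemma norm_rot (θ : ℝ) (x : ℂ) : ‖rot θ x‖ = ‖x‖ := by
  rw [rot, norm_mul, mul_comm Complex.I, Complex.norm_exp_ofReal_mul_I, one_mul]

lemma rot_rot (θ φ : ℝ) (x : ℂ) : rot θ (rot φ x) = rot (θ + φ) x := by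
  simp only [rot, ← mul_assoc, ← Complex.exp_add]
  push_cast; ring_nf

/-- A kernel on the plane which commutes with rotations. -/
def IsRotEquivariant (K : Kernel ℂ ℂ) : Prop :=
  ∀ θ x, K (rot θ x) = (K x).map (rot θ)

/-- The law of `e^{iθ} X` with independent `θ ~ U` and `X ~ μ`. -/
noncomputable def rotAverage (U : Measure ℝ) (μ : Measure ℂ) : Measure ℂ :=
  (U.prod μ).map fun q => rot q.1 q.2

instance (U : Measure ℝ) (μ : Measure ℂ) [IsProbabilityMeasure U] [IsProbabilityMeasure μ] :
    IsProbabilityMeasure (rotAverage U μ) :=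
  Measure.isProbabilityMeasure_map (by fun_prop)

section Averaging

variable (U : Measure ℝ) (μ : Measure ℂ)

/-- The joint law of `(e^{iθ} X, (θ, X))` with independent `θ ~ U` and `X ~ μ`. -/
noncomputable def rotJoint : Measure (ℂ × ℝ × ℂ) := (U.prod μ).map fun q => (rot q.1 q.2, q)

lemma fst_rotJoint : (rotJoint U μ).fst = rotAverage U μ := by
  rw [rotJoint, Measure.fst_map_prodMk (by fun_prop)]; rfl

variable [IsProbabilityMeasure U] [IsProbabilityMeasure μ]

instance : IsProbabilityMeasure (rotJoint U μ) :=
  Measure.isProbabilityMeasure_map (by fun_prop)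

/-- The channel which, given `(e^{iθ} X, Y)`, resamples `(θ, X)` and returns `(X, e^{-iθ} Y)`. -/
noncomputable def unrotate : Kernel (ℂ × ℂ) (ℂ × ℂ) :=
  (((rotJoint U μ).condKernel.comap Prod.fst measurable_fst) ×ₖ
    Kernel.deterministic Prod.snd measurable_snd).map
    fun q : (ℝ × ℂ) × ℂ => (q.1.2, rot (-q.1.1) q.2)

instance : IsMarkovKernel (unrotate U μ) := Kernel.IsMarkovKernel.map _ (by fun_prop)

/-- Resampling (θ, X) from its conditional law given e^{iθ}X restores the joint law of (θ, X,
e^{iθ}X), with the output Y drawn from K(e^{iθ}X). By equivariance e^{-iθ}Y then has law K(X) given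
(θ, X). -/
lemma unrotate_comp_compProd {K : Kernel ℂ ℂ} [IsMarkovKernel K] (hK : IsRotEquivariant K) :
    unrotate U μ ∘ₘ (rotAverage U μ ⊗ₘ K) = μ ⊗ₘ K := by
  refine Measure.ext_of_lintegral _ fun f hf => ?_
  have hF : Measurable fun q : (ℝ × ℂ) × ℂ => f (q.1.2, rot (-q.1.1) q.2) := by fun_prop
  have h1 : ∀ p : ℂ × ℂ, ∫⁻ z, f z ∂(unrotate U μ p) =
      ∫⁻ q, f (q.2, rot (-q.1) p.2) ∂((rotJoint U μ).condKernel p.1) := by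
    intro p
    rw [unrotate, Kernel.map_apply _ (by fun_prop), lintegral_map hf (by fun_prop),
      Kernel.prod_apply, lintegral_prod _ hF.aemeasurable]
    simp only [Kernel.comap_apply, Kernel.deterministic_apply]
    refine lintegral_congr fun q => ?_
    rw [lintegral_dirac' _ (by fun_prop)]
  rw [Measure.lintegral_bind (Kernel.aemeasurable _) hf.aemeasurable]
  simp only [h1]
  have hG : Measurable fun r : ℂ × ℝ × ℂ => ∫⁻ y, f (r.2.2, rot (-r.2.1) y) ∂(K r.1) := by
    have : Measurable (Function.uncurry fun (r : ℂ × ℝ × ℂ) y => f (r.2.2, rot (-r.2.1) y)) := by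
      unfold Function.uncurry; fun_prop
    exact this.lintegral_kernel_prod_right (κ := K.comap Prod.fst measurable_fst)
  calc ∫⁻ p, ∫⁻ q, f (q.2, rot (-q.1) p.2) ∂((rotJoint U μ).condKernel p.1)
        ∂(rotAverage U μ ⊗ₘ K)
      = ∫⁻ x, ∫⁻ y, ∫⁻ q, f (q.2, rot (-q.1) y) ∂((rotJoint U μ).condKernel x) ∂(K x)
        ∂(rotAverage U μ) := by
        rw [Measure.lintegral_compProd]
        have : Measurable (Function.uncurry fun (p : ℂ × ℂ) (q : ℝ × ℂ) =>
          f (q.2, rot (-q.1) p.2)) := by unfold Function.uncurry; fun_prop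
        exact this.lintegral_kernel_prod_right
          (κ := (rotJoint U μ).condKernel.comap Prod.fst measurable_fst)
    _ = ∫⁻ x, ∫⁻ q, ∫⁻ y, f (q.2, rot (-q.1) y) ∂(K x) ∂((rotJoint U μ).condKernel x)
        ∂(rotAverage U μ) := by
        refine lintegral_congr fun x => ?_
        refine lintegral_lintegral_swap ?_
        unfold Function.uncurry; fun_prop
    _ = ∫⁻ r, ∫⁻ y, f (r.2.2, rot (-r.2.1) y) ∂(K r.1) ∂(rotJoint U μ) := by
        conv_rhs => rw [← (rotJoint U μ).disintegrate (rotJoint U μ).condKernel]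
        rw [Measure.lintegral_compProd hG, fst_rotJoint]
    _ = ∫⁻ q, ∫⁻ y, f (q.2, y) ∂(K q.2) ∂(U.prod μ) := by
        rw [rotJoint, lintegral_map hG (by fun_prop)]
        refine lintegral_congr fun q => ?_
        dsimp only
        rw [hK, lintegral_map (by fun_prop) (by fun_prop)]
        simp only [rot_neg_rot]
    _ = ∫⁻ z, f z ∂(μ ⊗ₘ K) := by
        rw [Measure.lintegral_compProd hf, lintegral_prod_symm]
        · simp
        · have : Measurable (Function.uncurry fun (q : ℝ × ℂ) (y : ℂ) => f (q.2, y)) := by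
            unfold Function.uncurry; fun_prop
          exact (this.lintegral_kernel_prod_right
            (κ := K.comap Prod.snd measurable_snd)).aemeasurable

/-- Data processing for `unrotate`. The reference product is covered by the same computation, since
an invariant `ν` is an equivariant constant kernel. -/
lemma klDiv_prod_le_rotAverage {K : Kernel ℂ ℂ} [IsMarkovKernel K] (hK : IsRotEquivariant K)
    {ν : Measure ℂ} [IsProbabilityMeasure ν] (hν : ∀ θ, ν.map (rot θ) = ν) :
    klDiv (μ ⊗ₘ K) (μ.prod ν) ≤ klDiv (rotAverage U μ ⊗ₘ K) ((rotAverage U μ).prod ν) := by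
  have h := klDiv_comp_right_le (rotAverage U μ ⊗ₘ K) (rotAverage U μ ⊗ₘ Kernel.const ℂ ν)
    (unrotate U μ)
  rwa [unrotate_comp_compProd U μ hK, unrotate_comp_compProd U μ (fun θ x => (hν θ).symm),
    Measure.compProd_const, Measure.compProd_const] at h

/-- If averaging the input over rotations does not increase the (finite) mutual information of a
rotation equivariant channel, then the output law is already invariant under rotations. -/
lemma map_rot_comp_of_klDiv_rotAverage_le {K : Kernel ℂ ℂ} [IsMarkovKernel K]
    (hK : IsRotEquivariant K) (hU : ∀ θ, (rotAverage U μ).map (rot θ) = rotAverage U μ)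
    (hfin : klDiv (μ ⊗ₘ K) (μ.prod (K ∘ₘ μ)) ≠ ∞)
    (hle : klDiv (rotAverage U μ ⊗ₘ K) ((rotAverage U μ).prod (K ∘ₘ rotAverage U μ)) ≤
      klDiv (μ ⊗ₘ K) (μ.prod (K ∘ₘ μ))) (θ : ℝ) :
    (K ∘ₘ μ).map (rot θ) = K ∘ₘ μ := by
  have hinv : ∀ θ, (K ∘ₘ rotAverage U μ).map (rot θ) = K ∘ₘ rotAverage U μ := by
    intro θ
    refine Measure.ext_of_lintegral _ fun f hf => ?_
    rw [lintegral_map hf (by fun_prop), Measure.lintegral_bind (Kernel.aemeasurable _)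
      (by fun_prop), Measure.lintegral_bind (Kernel.aemeasurable _) hf.aemeasurable]
    conv_rhs => rw [← hU θ]
    rw [lintegral_map (hf.lintegral_kernel) (by fun_prop)]
    refine lintegral_congr fun x => ?_
    rw [hK, lintegral_map hf (by fun_prop)]
  have h1 := klDiv_fst_prod_eq_add (μ ⊗ₘ K) (K ∘ₘ rotAverage U μ)
  rw [Measure.fst_compProd, Measure.snd_compProd] at h1
  have h2 := klDiv_prod_le_rotAverage U μ hK hinv
  -- By the compensation identity the excess over the mutual information of `μ` is exactly the
  -- divergence between the two output laws; finiteness allows the cancellation.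
  have h3 : klDiv (K ∘ₘ μ) (K ∘ₘ rotAverage U μ) + klDiv (μ ⊗ₘ K) (μ.prod (K ∘ₘ μ)) ≤
      0 + klDiv (μ ⊗ₘ K) (μ.prod (K ∘ₘ μ)) := by
    rw [← h1, zero_add]; exact h2.trans hle
  have h4 : klDiv (K ∘ₘ μ) (K ∘ₘ rotAverage U μ) = 0 :=
    le_antisymm ((ENNReal.add_le_add_iff_right hfin).1 h3) zero_le
  rw [klDiv_eq_zero_iff.1 h4, hinv]

end Averaging

end PZD

/-! ### Riemann sums -/

open Topology in
/-- Left Riemann sums of a continuous function converge to the integral. -/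
lemma tendsto_leftRiemannSum {f : ℝ → ℝ} (hf : Continuous f) {L : ℝ} (hL : 0 < L) :
    Tendsto (fun n : ℕ => L / n * ∑ k ∈ Finset.range n, f (k * (L / n))) atTop
      (𝓝 (∫ t in (0 : ℝ)..L, f t)) := by
  rw [Metric.tendsto_atTop]
  intro ε hε
  have huc := isCompact_Icc.uniformContinuousOn_of_continuous (hf.continuousOn (s := Set.Icc 0 L))
  rw [Metric.uniformContinuousOn_iff] at huc
  -- The oscillation ε/(2L) on each of the n cells of length L/n adds up to ε/2.
  obtain ⟨δ, hδ, huc⟩ := huc (ε / (2 * L)) (by positivity)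
  obtain ⟨N, hN⟩ := exists_nat_gt (L / δ)
  refine ⟨N + 1, fun n hn => ?_⟩
  have hn0 : (0 : ℝ) < n := by exact_mod_cast (by omega : 0 < n)
  set h := L / n with hh
  have hh0 : 0 < h := by positivity
  have hnh : n * h = L := by rw [hh]; field_simp
  have hhδ : h < δ := by
    rw [hh, div_lt_iff₀ hn0]
    have : (N : ℝ) ≤ n := by exact_mod_cast (by omega : N ≤ n)
    rw [div_lt_iff₀ hδ] at hN
    nlinarith
  have hint : ∫ t in (0 : ℝ)..L, f t =
      ∑ k ∈ Finset.range n, ∫ t in (k * h : ℝ)..((k + 1 : ℕ) * h : ℝ), f t := by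
    rw [intervalIntegral.sum_integral_adjacent_intervals (a := fun k : ℕ => (k * h : ℝ))
      (fun k _ => hf.intervalIntegrable _ _)]
    simp [hnh]
  rw [Real.dist_eq, hint, Finset.mul_sum, ← Finset.sum_sub_distrib]
  calc |∑ k ∈ Finset.range n, (h * f (k * h) - ∫ t in (k * h : ℝ)..((k + 1 : ℕ) * h : ℝ), f t)|
      ≤ ∑ k ∈ Finset.range n, |h * f (k * h) - ∫ t in (k * h : ℝ)..((k + 1 : ℕ) * h : ℝ), f t| :=
        Finset.abs_sum_le_sum_abs _ _
    _ ≤ ∑ k ∈ Finset.range n, ε / (2 * L) * h := by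
        refine Finset.sum_le_sum fun k hk => ?_
        have hlen : ((k + 1 : ℕ) * h : ℝ) - k * h = h := by push_cast; ring
        have hc : h * f (k * h) = ∫ _ in (k * h : ℝ)..((k + 1 : ℕ) * h : ℝ), f (k * h) := by
          rw [intervalIntegral.integral_const, hlen, smul_eq_mul]
        rw [hc, ← intervalIntegral.integral_sub (by simp) (hf.intervalIntegrable _ _),
          ← Real.norm_eq_abs]
        refine (intervalIntegral.norm_integral_le_of_norm_le_const (C := ε / (2 * L)) ?_).trans ?_
        · intro t ht
          rw [Set.uIoc_of_le (by linarith)] at ht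
          have hk' : ((k + 1 : ℕ) : ℝ) ≤ n := by
            exact_mod_cast Nat.succ_le_of_lt (Finset.mem_range.1 hk)
          have hkL : ((k + 1 : ℕ) * h : ℝ) ≤ L := by
            rw [← hnh]; exact mul_le_mul_of_nonneg_right hk' hh0.le
          have hk0 : (0 : ℝ) ≤ k * h := by positivity
          have := huc (k * h) ⟨hk0, by linarith⟩ t ⟨hk0.trans ht.1.le, ht.2.trans hkL⟩ (by
            rw [Real.dist_eq, abs_sub_comm, abs_of_pos (by linarith [ht.1])]
            linarith [ht.2])
          rw [Real.dist_eq] at this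
          exact this.le
        · rw [hlen, abs_of_pos hh0]
    _ = ε / 2 := by
        rw [Finset.sum_const, Finset.card_range, nsmul_eq_mul]
        rw [show (n : ℝ) * (ε / (2 * L) * h) = ε / (2 * L) * (n * h) by ring, hnh]
        field_simp
    _ < ε := by linarith

/-! ### Rotating a pair of independent Brownian motions -/

namespace ProbabilityTheory

variable {Ω S T : Type*} [MeasurableSpace Ω] {P : Measure Ω}

/-- Two independent Gaussian processes are jointly Gaussian. -/
lemma IsGaussianProcess.sumElim {A : S → Ω → ℝ} {B : T → Ω → ℝ} (hA : IsGaussianProcess A P)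
    (hB : IsGaussianProcess B P) (h : IndepFun (fun ω s => A s ω) (fun ω t => B t ω) P) :
    IsGaussianProcess (Sum.elim A B) P where
  hasGaussianLaw I := by
    have h1 : IndepFun (fun ω => I.toLeft.restrict (A · ω)) (fun ω => I.toRight.restrict (B · ω))
        P :=
      h.comp (φ := I.toLeft.restrict) (ψ := I.toRight.restrict) (by fun_prop) (by fun_prop)
    have h2 := IndepFun.hasGaussianLaw (hA.hasGaussianLaw _) (hB.hasGaussianLaw _) h1
    let K : ((I.toLeft → ℝ) × (I.toRight → ℝ)) →L[ℝ] (I → ℝ) :=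
      ContinuousLinearMap.pi fun i => match i with
        | ⟨.inl s, hs⟩ => (ContinuousLinearMap.proj (R := ℝ) (φ := fun _ : I.toLeft => ℝ)
            ⟨s, Finset.mem_toLeft.2 hs⟩).comp (ContinuousLinearMap.fst ℝ _ _)
        | ⟨.inr t, ht⟩ => (ContinuousLinearMap.proj (R := ℝ) (φ := fun _ : I.toRight => ℝ)
            ⟨t, Finset.mem_toRight.2 ht⟩).comp (ContinuousLinearMap.snd ℝ _ _)
    have : (fun ω => I.restrict (Sum.elim A B · ω)) =
        K ∘ fun ω => (I.toLeft.restrict (A · ω), I.toRight.restrict (B · ω)) := by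
      funext ω i
      obtain ⟨i | i, hi⟩ := i <;> simp [K, Finset.restrict]
    rw [this]
    exact h2.map K

/-- Rotating a pair of independent Brownian motions gives a pair of independent Brownian
motions. -/
lemma IsBrownianReal.rotate {A B : ℝ≥0 → Ω → ℝ} (hA : IsBrownianReal A P)
    (hB : IsBrownianReal B P) (h : IndepFun (fun ω s => A s ω) (fun ω t => B t ω) P)
    {a b : ℝ} (hab : a ^ 2 + b ^ 2 = 1) :
    IsBrownianReal (fun t ω => a * A t ω - b * B t ω) P ∧
      IsBrownianReal (fun t ω => b * A t ω + a * B t ω) P ∧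
      IndepFun (fun ω t => a * A t ω - b * B t ω) (fun ω t => b * A t ω + a * B t ω) P := by
  have hG := hA.isGaussianProcess.sumElim hB.isGaussianProcess h
  have hP := hA.isGaussianProcess.isProbabilityMeasure
  have hG' : IsGaussianProcess (Sum.elim (fun t ω => a * A t ω - b * B t ω)
      (fun t ω => b * A t ω + a * B t ω)) P := by
    classical
    refine hG.of_isGaussianProcess ?_
    rintro (t | t)
    · exact ⟨{.inl t, .inr t},
        { toFun x := a * x ⟨.inl t, by simp⟩ - b * x ⟨.inr t, by simp⟩
          map_add' x y := by simp; ring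
          map_smul' c x := by simp; ring }, by simp⟩
    · exact ⟨{.inl t, .inr t},
        { toFun x := b * x ⟨.inl t, by simp⟩ + a * x ⟨.inr t, by simp⟩
          map_add' x y := by simp; ring
          map_smul' c x := by simp; ring }, by simp⟩
  have mA t : MemLp (A t) 2 P := (hA.isGaussianProcess.hasGaussianLaw_eval t).memLp_two
  have mB t : MemLp (B t) 2 P := (hB.isGaussianProcess.hasGaussianLaw_eval t).memLp_two
  have maA (c : ℝ) t : MemLp (fun ω => c * A t ω) 2 P := (mA t).const_mul c
  have maB (c : ℝ) t : MemLp (fun ω => c * B t ω) 2 P := (mB t).const_mul c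
  have cAB s t : cov[A s, B t; P] = 0 :=
    (h.comp (measurable_pi_apply s) (measurable_pi_apply t)).covariance_eq_zero (mA s) (mB t)
  have cBA s t : cov[B s, A t; P] = 0 := by rw [covariance_comm, cAB]
  have iA t := hA.integrable_eval t
  have iB t := hB.integrable_eval t
  have cA s t : cov[fun ω => A s ω, fun ω => A t ω; P] = min s t := hA.covariance_fun_eval s t
  have cB s t : cov[fun ω => B s ω, fun ω => B t ω; P] = min s t := hB.covariance_fun_eval s t
  refine ⟨⟨?_, ?_⟩, ⟨?_, ?_⟩, ?_⟩
  · refine (hG'.comp_right Sum.inl).isPreBrownianReal_of_covariance (fun t => ?_) fun s t hst => ?_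
    · change ∫ ω, a * A t ω - b * B t ω ∂P = 0
      rw [integral_sub ((iA t).const_mul a) ((iB t).const_mul b), integral_const_mul,
        integral_const_mul, hA.integral_eval, hB.integral_eval]; simp
    · change cov[fun ω => a * A s ω - b * B s ω, fun ω => a * A t ω - b * B t ω; P] = s
      rw [covariance_fun_sub_fun_sub (maA _ _) (maB _ _) (maA _ _) (maB _ _)]
      simp only [covariance_const_mul_left, covariance_const_mul_right, cA, cB]
      have h1 : cov[fun ω => A s ω, fun ω => B t ω; P] = 0 := cAB s t
      have h2 : cov[fun ω => B s ω, fun ω => A t ω; P] = 0 := cBA s t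
      rw [h1, h2, min_eq_left hst]
      linear_combination (s : ℝ) * hab
  · filter_upwards [hA.cont, hB.cont] with ω h1 h2
    fun_prop
  · refine (hG'.comp_right Sum.inr).isPreBrownianReal_of_covariance (fun t => ?_) fun s t hst => ?_
    · change ∫ ω, b * A t ω + a * B t ω ∂P = 0
      rw [integral_add ((iA t).const_mul b) ((iB t).const_mul a), integral_const_mul,
        integral_const_mul, hA.integral_eval, hB.integral_eval]; simp
    · change cov[fun ω => b * A s ω + a * B s ω, fun ω => b * A t ω + a * B t ω; P] = s
      have e (t : ℝ≥0) : (fun ω => b * A t ω + a * B t ω) =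
          fun ω => b * A t ω - -a * B t ω := by ext; ring
      rw [e s, e t, covariance_fun_sub_fun_sub (maA _ _) (maB _ _) (maA _ _) (maB _ _)]
      simp only [covariance_const_mul_left, covariance_const_mul_right, cA, cB]
      have h1 : cov[fun ω => A s ω, fun ω => B t ω; P] = 0 := cAB s t
      have h2 : cov[fun ω => B s ω, fun ω => A t ω; P] = 0 := cBA s t
      rw [h1, h2, min_eq_left hst]
      linear_combination (s : ℝ) * hab
  · filter_upwards [hA.cont, hB.cont] with ω h1 h2
    fun_prop
  -- For jointly Gaussian processes independence is zero covariance; the two contributions ab·min(s,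
  -- t) cancel.
  · refine hG'.indepFun_of_covariance_eq_zero (fun t => ?_) (fun t => ?_) fun s t => ?_
    · exact (hG'.comp_right Sum.inl).aemeasurable t
    · exact (hG'.comp_right Sum.inr).aemeasurable t
    · have e : (fun ω => b * A t ω + a * B t ω) = fun ω => b * A t ω - -a * B t ω := by ext; ring
      rw [e, covariance_fun_sub_fun_sub (maA _ _) (maB _ _) (maA _ _) (maB _ _)]
      simp only [covariance_const_mul_left, covariance_const_mul_right, cA, cB]
      have h1 : cov[fun ω => A s ω, fun ω => B t ω; P] = 0 := cAB s t
      have h2 : cov[fun ω => B s ω, fun ω => A t ω; P] = 0 := cBA s t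
      rw [h1, h2]
      ring

end ProbabilityTheory

/-! ### The channel as a rotation-equivariant kernel -/

namespace PZD

open InformationTheory Topology

variable {Ω : Type*} [MeasurableSpace Ω] {P : Measure Ω} {σ γ L : ℝ} {W W' : ℝ≥0 → Ω → ℂ}

lemma rot_re (θ : ℝ) (x : ℂ) : (rot θ x).re = Real.cos θ * x.re - Real.sin θ * x.im := by
  rw [rot, mul_comm Complex.I, Complex.exp_mul_I]
  simp [Complex.cos_ofReal_re, Complex.sin_ofReal_re, Complex.cos_ofReal_im, Complex.sin_ofReal_im]

lemma rot_im (θ : ℝ) (x : ℂ) : (rot θ x).im = Real.sin θ * x.re + Real.cos θ * x.im := by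
  rw [rot, mul_comm Complex.I, Complex.exp_mul_I]
  simp [Complex.cos_ofReal_re, Complex.sin_ofReal_re, Complex.cos_ofReal_im, Complex.sin_ofReal_im]
  ring

lemma IsComplexWiener.indep_scaled (hW : IsComplexWiener σ W P) :
    IndepFun (fun ω t => (σ / √2)⁻¹ * (W t ω).re) (fun ω t => (σ / √2)⁻¹ * (W t ω).im) P :=
  hW.indep.comp (φ := fun f t => (σ / √2)⁻¹ * f t) (ψ := fun f t => (σ / √2)⁻¹ * f t)
    (by fun_prop) (by fun_prop)

lemma IsComplexWiener.rot (hσ : 0 < σ) (hW : IsComplexWiener σ W P) (θ : ℝ) :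
    IsComplexWiener σ (fun t ω => rot θ (W t ω)) P := by
  have hs : σ / √2 ≠ 0 := by positivity
  obtain ⟨h1, h2, h3⟩ := hW.re.rotate hW.im hW.indep_scaled
    (a := Real.cos θ) (b := Real.sin θ) (by rw [add_comm]; exact Real.sin_sq_add_cos_sq θ)
  refine ⟨?_, ?_, ?_⟩
  · convert h1 using 3; rw [rot_re]; ring
  · convert h2 using 3; rw [rot_im]; ring
  · convert h3.comp (φ := fun f t => σ / √2 * f t) (ψ := fun f t => σ / √2 * f t)
      (by fun_prop) (by fun_prop) using 1
    · funext ω t; simp only [rot_re, Function.comp]; field_simp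
    · funext ω t; simp only [rot_im, Function.comp]; field_simp

/-- A complex Wiener process all of whose paths are continuous and which is measurable at every
time. -/
structure IsRegularWiener (σ : ℝ) (W : ℝ≥0 → Ω → ℂ) (P : Measure Ω) : Prop
    extends IsComplexWiener σ W P where
  meas : ∀ t, Measurable (W t)
  continuous : ∀ ω, Continuous fun t => W t ω

lemma IsRegularWiener.rot (hσ : 0 < σ) (hW : IsRegularWiener σ W P) (θ : ℝ) :
    IsRegularWiener σ (fun t ω => rot θ (W t ω)) P where
  toIsComplexWiener := hW.toIsComplexWiener.rot hσ θ
  meas t := (measurable_rot θ).comp (hW.meas t)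
  continuous ω := by
    have := hW.continuous ω
    unfold PZD.rot
    fun_prop

lemma IsComplexWiener.congr (hW : IsComplexWiener σ W P) (h : ∀ᵐ ω ∂P, ∀ t, W t ω = W' t ω) :
    IsComplexWiener σ W' P where
  re :=
    { toIsPreBrownianReal := hW.re.toIsPreBrownianReal.congr fun t => by
        filter_upwards [h] with ω hω; rw [hω]
      cont := by
        filter_upwards [h, hW.re.cont] with ω hω hc
        simpa only [hω] using hc }
  im :=
    { toIsPreBrownianReal := hW.im.toIsPreBrownianReal.congr fun t => by
        filter_upwards [h] with ω hω; rw [hω]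
      cont := by
        filter_upwards [h, hW.im.cont] with ω hω hc
        simpa only [hω] using hc }
  indep := hW.indep.congr (by filter_upwards [h] with ω hω; simp only [hω])
    (by filter_upwards [h] with ω hω; simp only [hω])

/-- A complex Wiener process is indistinguishable from a regular one. -/
lemma IsComplexWiener.exists_isRegularWiener (hσ : 0 < σ) (hW : IsComplexWiener σ W P) :
    ∃ W' : ℝ≥0 → Ω → ℂ, IsRegularWiener σ W' P ∧ ∀ᵐ ω ∂P, ∀ t, W t ω = W' t ω := by
  have hs : σ / √2 ≠ 0 := by positivity
  have hWe : ∀ t ω, W t ω = ((σ / √2 * ((σ / √2)⁻¹ * (W t ω).re) : ℝ) : ℂ) +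
      ((σ / √2 * ((σ / √2)⁻¹ * (W t ω).im) : ℝ) : ℂ) * Complex.I := by
    intro t ω
    rw [mul_inv_cancel_left₀ hs, mul_inv_cancel_left₀ hs, Complex.re_add_im]
  have hae : ∀ t, AEMeasurable (W t) P := by
    intro t
    rw [show W t = _ from funext (hWe t)]
    have h1 := (hW.re.aemeasurable t).const_mul (σ / √2)
    have h2 := (hW.im.aemeasurable t).const_mul (σ / √2)
    exact (Complex.measurable_ofReal.comp_aemeasurable h1).add
      ((Complex.measurable_ofReal.comp_aemeasurable h2).mul_const _)
  have hcont : ∀ᵐ ω ∂P, Continuous fun t => W t ω := by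
    filter_upwards [hW.re.cont, hW.im.cont] with ω h1 h2
    rw [funext fun t => hWe t ω]
    fun_prop
  have hdense : ∀ᵐ ω ∂P, ∀ n, W (TopologicalSpace.denseSeq ℝ≥0 n) ω =
      (hae (TopologicalSpace.denseSeq ℝ≥0 n)).mk _ ω :=
    ae_all_iff.2 fun n => (hae _).ae_eq_mk
  -- `S` is a measurable set of full measure on which the path is continuous and agrees with
  -- measurable versions at a dense sequence of times. Setting the path to zero off `S` gives
  -- continuity everywhere and measurability at the dense times; limits give the other times.
  obtain ⟨S, hSmem, hSm, hS⟩ := (hcont.and hdense).exists_measurable_mem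
  classical
  let W' : ℝ≥0 → Ω → ℂ := fun t ω => S.indicator (W t) ω
  have hc' : ∀ ω, Continuous fun t => W' t ω := by
    intro ω
    by_cases hω : ω ∈ S
    · simpa [W', hω] using (hS ω hω).1
    · simpa [W', hω] using continuous_const
  have heq : ∀ᵐ ω ∂P, ∀ t, W t ω = W' t ω := by
    filter_upwards [hSmem] with ω hω t
    simp [W', hω]
  have hmD : ∀ n, Measurable (W' (TopologicalSpace.denseSeq ℝ≥0 n)) := by
    intro n
    have : W' (TopologicalSpace.denseSeq ℝ≥0 n) =
        S.indicator ((hae (TopologicalSpace.denseSeq ℝ≥0 n)).mk _) := by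
      funext ω
      by_cases hω : ω ∈ S
      · simpa [W', hω] using (hS ω hω).2 n
      · simp [W', hω]
    rw [this]
    exact (hae _).measurable_mk.indicator hSm
  refine ⟨W', ⟨hW.congr heq, fun t => ?_, hc'⟩, heq⟩
  obtain ⟨u, hu, hut⟩ := mem_closure_iff_seq_limit.1
    ((TopologicalSpace.denseRange_denseSeq ℝ≥0).closure_range ▸ Set.mem_univ t :
      t ∈ closure (Set.range (TopologicalSpace.denseSeq ℝ≥0)))
  refine measurable_of_tendsto_metrizable (f := fun n => W' (u n)) (fun n => ?_) ?_
  · obtain ⟨k, hk⟩ := hu n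
    rw [← hk]; exact hmD k
  · rw [tendsto_pi_nhds]
    intro ω
    exact ((hc' ω).tendsto t).comp hut

/-- The law of a complex Wiener process on path space is determined by its variance. -/
lemma IsRegularWiener.map_eq [IsProbabilityMeasure P] (hσ : 0 < σ) (hW : IsRegularWiener σ W P)
    (hW' : IsRegularWiener σ W' P) :
    P.map (fun ω t => W t ω) = P.map (fun ω t => W' t ω) := by
  have hs : σ / √2 ≠ 0 := by positivity
  have hm {V : ℝ≥0 → Ω → ℂ} (hV : IsRegularWiener σ V P) : AEMeasurable (fun ω t => V t ω) P :=
    (measurable_pi_lambda _ hV.meas).aemeasurable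
  rw [map_eq_iff_forall_finset_map_restrict_eq (hm hW) (hm hW')]
  intro I
  let g : (I → ℝ) × (I → ℝ) → I → ℂ := fun q i =>
    ((σ / √2 * q.1 i : ℝ) : ℂ) + ((σ / √2 * q.2 i : ℝ) : ℂ) * Complex.I
  have key {V : ℝ≥0 → Ω → ℂ} (hV : IsRegularWiener σ V P) :
      P.map (fun ω => I.restrict (V · ω)) = ((BrownianReal.projectiveFamily I).prod
        (BrownianReal.projectiveFamily I)).map g := by
    have h1 : IndepFun (fun ω => I.restrict (fun t => (σ / √2)⁻¹ * (V t ω).re))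
        (fun ω => I.restrict (fun t => (σ / √2)⁻¹ * (V t ω).im)) P :=
      hV.indep_scaled.comp (φ := I.restrict) (ψ := I.restrict) (by fun_prop) (by fun_prop)
    have hr := hV.re.hasLaw I
    have hi := hV.im.hasLaw I
    rw [indepFun_iff_map_prod_eq_prod_map_map hr.aemeasurable hi.aemeasurable, hr.map_eq,
      hi.map_eq] at h1
    have hg : Measurable g := by unfold g; fun_prop
    rw [← h1, AEMeasurable.map_map_of_aemeasurable hg.aemeasurable
      (hr.aemeasurable.prodMk hi.aemeasurable)]
    congr 1
    funext ω i
    simp only [Finset.restrict, Function.comp, g, mul_inv_cancel_left₀ hs, Complex.re_add_im]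
  rw [key hW, key hW']

/-- The nonlinear phase accumulated along the noise path `w` started at `x`. -/
noncomputable def nonlinearPhase (γ L : ℝ) (w : ℝ≥0 → ℂ) (x : ℂ) : ℝ :=
  γ * ∫ ℓ in (0 : ℝ)..L, ‖x + w ℓ.toNNReal‖ ^ 2

lemma output_eq (γ L : ℝ) (w : ℝ≥0 → ℂ) (x : ℂ) :
    output γ L w x = rot (nonlinearPhase γ L w x) (x + w L.toNNReal) := by
  rw [output, rot, nonlinearPhase, mul_comm]

/-- The nonlinear phase with the integral replaced by a left Riemann sum. -/
noncomputable def riemannPhase (γ L : ℝ) (n : ℕ) (w : ℝ≥0 → ℂ) (x : ℂ) : ℝ :=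
  γ * (L / n * ∑ k ∈ Finset.range n, ‖x + w (k * (L / n)).toNNReal‖ ^ 2)

lemma tendsto_riemannPhase (hL : 0 < L) {w : ℝ≥0 → ℂ} (hw : Continuous w) (x : ℂ) :
    Tendsto (fun n => riemannPhase γ L n w x) atTop (𝓝 (nonlinearPhase γ L w x)) := by
  have hc : Continuous fun t : ℝ => ‖x + w t.toNNReal‖ ^ 2 := by fun_prop
  exact (tendsto_leftRiemannSum hc hL).const_mul γ

lemma IsRegularWiener.measurable_uncurry (hW : IsRegularWiener σ W P) :
    Measurable fun q : ℝ≥0 × Ω => W q.1 q.2 :=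
  measurable_uncurry_of_continuous_of_measurable hW.continuous hW.meas

lemma IsRegularWiener.measurable_nonlinearPhase (hL : 0 < L) (hW : IsRegularWiener σ W P) :
    Measurable fun p : ℂ × Ω => nonlinearPhase γ L (fun t => W t p.2) p.1 := by
  have h := hW.measurable_uncurry
  have h2 : StronglyMeasurable (Function.uncurry fun (p : ℂ × Ω) (ℓ : ℝ) =>
      ‖p.1 + W ℓ.toNNReal p.2‖ ^ 2) := by
    refine Measurable.stronglyMeasurable ?_
    unfold Function.uncurry
    have : Measurable fun p : (ℂ × Ω) × ℝ => W p.2.toNNReal p.1.2 :=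
      h.comp (by fun_prop : Measurable fun p : (ℂ × Ω) × ℝ => (p.2.toNNReal, p.1.2))
    fun_prop
  unfold nonlinearPhase
  simp only [intervalIntegral.integral_of_le hL.le]
  exact (h2.integral_prod_right (ν := volume.restrict (Set.Ioc 0 L))).measurable.const_mul γ

lemma IsRegularWiener.measurable_output (hL : 0 < L) (hW : IsRegularWiener σ W P) :
    Measurable fun p : ℂ × Ω => output γ L (fun t => W t p.2) p.1 := by
  simp only [output_eq]
  have h1 := hW.measurable_nonlinearPhase (γ := γ) hL
  have h2 : Measurable fun p : ℂ × Ω => W L.toNNReal p.2 := (hW.meas _).comp measurable_snd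
  exact measurable_rot'.comp (h1.prodMk (measurable_fst.add h2))

lemma IsRegularWiener.measurable_output_right (hL : 0 < L) (hW : IsRegularWiener σ W P) (x : ℂ) :
    Measurable fun ω => output γ L (fun t => W t ω) x :=
  (hW.measurable_output hL).comp measurable_prodMk_left

/-- The energy integral involves uncountably many coordinates, so equality of the laws on the
product path space does not transfer to the output directly. Riemann sums use finitely many
coordinates and converge along every continuous path, which identifies the integrals of bounded
continuous test functions. -/
lemma IsRegularWiener.map_output_eq [IsProbabilityMeasure P] (hσ : 0 < σ) (hL : 0 < L)
    (hW : IsRegularWiener σ W P) (hW' : IsRegularWiener σ W' P) (x : ℂ) :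
    P.map (fun ω => output γ L (fun t => W t ω) x) =
      P.map (fun ω => output γ L (fun t => W' t ω) x) := by
  have hm {V : ℝ≥0 → Ω → ℂ} (hV : IsRegularWiener σ V P) :
      Measurable fun ω => output γ L (fun t => V t ω) x := hV.measurable_output_right hL x
  have := Measure.isProbabilityMeasure_map (hm hW).aemeasurable (μ := P)
  have := Measure.isProbabilityMeasure_map (hm hW').aemeasurable (μ := P)
  let F : ℕ → (ℝ≥0 → ℂ) → ℂ := fun n w => PZD.rot (riemannPhase γ L n w x) (x + w L.toNNReal)
  have hF n : Measurable (F n) := by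
    unfold F riemannPhase
    exact measurable_rot'.comp (Measurable.prodMk (by fun_prop) (by fun_prop))
  refine ext_of_forall_integral_eq_of_IsFiniteMeasure fun f => ?_
  have key {V : ℝ≥0 → Ω → ℂ} (hV : IsRegularWiener σ V P) :
      Tendsto (fun n => ∫ w, f (F n w) ∂(P.map fun ω t => V t ω)) atTop
        (𝓝 (∫ y, f y ∂(P.map fun ω => output γ L (fun t => V t ω) x))) := by
    have hV' : Measurable fun ω t => V t ω := measurable_pi_lambda _ hV.meas
    rw [integral_map (hm hV).aemeasurable f.continuous.aestronglyMeasurable]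
    have e n : ∫ w, f (F n w) ∂(P.map fun ω t => V t ω) = ∫ ω, f (F n fun t => V t ω) ∂P :=
      integral_map hV'.aemeasurable
        (f.continuous.measurable.comp (hF n)).aestronglyMeasurable
    simp only [e]
    refine tendsto_integral_of_dominated_convergence (fun _ => ‖f‖) (fun n => ?_)
      (integrable_const _) (fun n => ae_of_all _ fun ω => f.norm_coe_le_norm _)
      (ae_of_all _ fun ω => ?_)
    · exact (f.continuous.measurable.comp ((hF n).comp hV')).aestronglyMeasurable
    · refine (f.continuous.tendsto _).comp ?_
      rw [output_eq]
      exact (continuous_rot.tendsto _).comp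
        ((tendsto_riemannPhase hL (hV.continuous ω) x).prodMk_nhds tendsto_const_nhds)
  have h := key hW
  rw [hW.map_eq hσ hW'] at h
  exact tendsto_nhds_unique h (key hW')

/-- The per-sample zero-dispersion channel as a kernel from inputs to outputs. -/
noncomputable def channel (γ L : ℝ) (W : ℝ≥0 → Ω → ℂ) (P : Measure Ω) : Kernel ℂ ℂ :=
  (Kernel.id ×ₖ Kernel.const ℂ P).map fun p => output γ L (fun t => W t p.2) p.1

section Channel

variable [IsProbabilityMeasure P]

lemma IsRegularWiener.channel_apply (hL : 0 < L) (hW : IsRegularWiener σ W P) (x : ℂ) :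
    channel γ L W P x = P.map fun ω => output γ L (fun t => W t ω) x := by
  rw [channel, Kernel.map_apply _ (hW.measurable_output hL), Kernel.prod_apply, Kernel.id_apply,
    Kernel.const_apply, Measure.dirac_prod, Measure.map_map (hW.measurable_output hL)
      measurable_prodMk_left]
  rfl

lemma IsRegularWiener.isMarkovKernel_channel (hL : 0 < L) (hW : IsRegularWiener σ W P) :
    IsMarkovKernel (channel γ L W P) :=
  Kernel.IsMarkovKernel.map _ (hW.measurable_output hL)

lemma IsRegularWiener.jointLaw_eq (hL : 0 < L) (hW : IsRegularWiener σ W P) (μ : Measure ℂ)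
    [IsProbabilityMeasure μ] : jointLaw γ L W P μ = μ ⊗ₘ channel γ L W P := by
  have := hW.isMarkovKernel_channel (γ := γ) hL
  have hm := hW.measurable_output (γ := γ) hL
  refine Measure.ext_of_lintegral _ fun f hf => ?_
  rw [jointLaw, lintegral_map hf (measurable_fst.prodMk hm), Measure.lintegral_compProd hf,
    lintegral_prod (fun a => f (a.1, _)) (hf.comp (measurable_fst.prodMk hm)).aemeasurable]
  refine lintegral_congr fun x => ?_
  rw [hW.channel_apply hL, lintegral_map (by fun_prop : Measurable fun y => f (x, y))
    (hW.measurable_output_right hL x)]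

lemma IsRegularWiener.mutualInfo_eq (hL : 0 < L) (hW : IsRegularWiener σ W P) (μ : Measure ℂ)
    [IsProbabilityMeasure μ] :
    mutualInfo γ L W P μ =
      klDiv (μ ⊗ₘ channel γ L W P) (μ.prod (channel γ L W P ∘ₘ μ)) := by
  have := hW.isMarkovKernel_channel (γ := γ) hL
  rw [mutualInfo, hW.jointLaw_eq hL, Measure.fst_compProd, Measure.snd_compProd]

/-- Rotating input and noise together leaves the energy unchanged and rotates the end point; plane
rotations commute. -/
lemma output_rot (γ L : ℝ) (w : ℝ≥0 → ℂ) (θ : ℝ) (x : ℂ) :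
    output γ L (fun t => PZD.rot θ (w t)) (PZD.rot θ x) = PZD.rot θ (output γ L w x) := by
  have h (t : ℝ≥0) : PZD.rot θ x + PZD.rot θ (w t) = PZD.rot θ (x + w t) := by
    simp only [PZD.rot]; ring
  simp only [output_eq, nonlinearPhase, h, norm_rot, rot_rot]
  rw [add_comm]

/-- The rotated noise is again a Wiener process, so it may replace the original one in `output_rot`.
-/
lemma IsRegularWiener.isRotEquivariant_channel (hσ : 0 < σ) (hL : 0 < L)
    (hW : IsRegularWiener σ W P) : IsRotEquivariant (channel γ L W P) := by
  intro θ x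
  rw [hW.channel_apply hL, hW.channel_apply hL, hW.map_output_eq hσ hL (hW.rot hσ θ),
    Measure.map_map (measurable_rot θ) (hW.measurable_output_right hL x)]
  simp only [output_rot]
  rfl

end Channel

lemma output_congr_ae (h : ∀ᵐ ω ∂P, ∀ t, W t ω = W' t ω) (x : ℂ) :
    (fun ω => output γ L (fun t => W t ω) x) =ᵐ[P] fun ω => output γ L (fun t => W' t ω) x := by
  filter_upwards [h] with ω hω
  simp only [hω]

lemma jointLaw_congr [SFinite P] (h : ∀ᵐ ω ∂P, ∀ t, W t ω = W' t ω) (μ : Measure ℂ)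
    [SFinite μ] : jointLaw γ L W P μ = jointLaw γ L W' P μ := by
  refine Measure.map_congr ?_
  filter_upwards [Measure.quasiMeasurePreserving_snd.ae h] with p hp
  simp only [hp]

lemma mutualInfo_congr [SFinite P] (h : ∀ᵐ ω ∂P, ∀ t, W t ω = W' t ω) (μ : Measure ℂ)
    [SFinite μ] : mutualInfo γ L W P μ = mutualInfo γ L W' P μ := by
  rw [mutualInfo, mutualInfo, jointLaw_congr h]

lemma polar_eq_rot (r : ℝ≥0) (φ : ℝ) : polar r φ = rot φ (r : ℝ) := by
  rw [polar, rot, mul_comm]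

/-- The law of the output amplitude does not depend on the phase of the input. -/
lemma IsComplexWiener.outputAmplitudeLaw_polar [IsProbabilityMeasure P] (hσ : 0 < σ) (hL : 0 < L)
    (hW : IsComplexWiener σ W P) (r : ℝ≥0) (φ : ℝ) :
    outputAmplitudeLaw γ L W P (polar r φ) = outputAmplitudeLaw γ L W P (r : ℝ) := by
  obtain ⟨W', hW', h⟩ := hW.exists_isRegularWiener hσ
  have hout (x : ℂ) : outputAmplitudeLaw γ L W P x = (channel γ L W' P x).map norm := by
    rw [hW'.channel_apply hL, Measure.map_map measurable_norm
      (hW'.measurable_output_right hL x), outputAmplitudeLaw]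
    refine Measure.map_congr ?_
    filter_upwards [output_congr_ae h x] with ω hω
    rw [hω]; rfl
  rw [hout, hout, polar_eq_rot, hW'.isRotEquivariant_channel hσ hL,
    Measure.map_map measurable_norm (measurable_rot φ)]
  congr 1
  funext x
  exact norm_rot φ x

end PZD

/-! ### Discretised exponential quadratic functionals and the Riccati recursion -/

namespace PZD

open Complex in
/-- Gaussian smoothing of the exponential of a quadratic polynomial. -/
lemma exists_integral_cexp_quadratic_gaussianReal {v : ℝ≥0} (hv : v ≠ 0) {p : ℂ} (hp : 0 < p.re) :
    ∃ K : ℂ, K ^ 2 * (1 + 2 * v * p) = 1 ∧ ∀ (l : ℂ) (x : ℝ),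
      ∫ z : ℝ, cexp (l * (x + z : ℝ) - p * (x + z : ℝ) ^ 2) ∂gaussianReal 0 v =
        K * cexp (l / (1 + 2 * v * p) * x - p / (1 + 2 * v * p) * x ^ 2 +
          l ^ 2 * (v / (2 * (1 + 2 * v * p)))) := by
  have hv0 : (0 : ℝ) < v := by positivity
  set b : ℂ := -(p + 1 / (2 * v)) with hb
  have hvc : (v : ℂ) ≠ 0 := by exact_mod_cast hv
  have hvre : ((1 : ℂ) / (2 * ((v : ℝ) : ℂ))).re = 1 / (2 * v) := by
    rw [show (1 : ℂ) / (2 * ((v : ℝ) : ℂ)) = ((1 / (2 * v) : ℝ) : ℂ) by push_cast; ring]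
    exact ofReal_re _
  have hbre : b.re < 0 := by
    have : b.re = -(p.re + 1 / (2 * v)) := by rw [hb, neg_re, add_re]; rw [hvre]
    rw [this]
    have : 0 < 1 / (2 * (v : ℝ)) := by positivity
    linarith
  have hE : (1 : ℂ) + 2 * v * p ≠ 0 := by
    intro h
    have : ((1 : ℂ) + 2 * v * p).re = 1 + 2 * v * p.re := by
      have : (1 : ℂ) + 2 * v * p = 1 + ((2 * v : ℝ) : ℂ) * p := by push_cast; ring
      rw [this, add_re, re_ofReal_mul, one_re]
    rw [h, zero_re] at this
    nlinarith [mul_pos hv0 hp]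
  have hb4 : -b = (1 + 2 * v * p) / (2 * v) := by rw [hb]; field_simp; ring
  have hpi : (Real.pi : ℂ) ≠ 0 := by exact_mod_cast Real.pi_ne_zero
  -- The constant contains a branch of a complex square root. Only its square is recorded, since the
  -- real and imaginary parts of the noise later contribute one copy each.
  refine ⟨((√(2 * Real.pi * v))⁻¹ : ℝ) * (Real.pi / -b) ^ (1 / 2 : ℂ), ?_, fun l x => ?_⟩
  · have h1 : ((Real.pi / -b) ^ (1 / 2 : ℂ)) ^ 2 = Real.pi / -b := by
      rw [one_div, cpow_ofNat_inv_pow]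
    have h2 : ((((√(2 * Real.pi * v))⁻¹ : ℝ) : ℂ)) ^ 2 = (2 * (Real.pi : ℂ) * ((v : ℝ) : ℂ))⁻¹ := by
      rw [← ofReal_pow, inv_pow, Real.sq_sqrt (by positivity)]; push_cast; rfl
    rw [mul_pow, h1, h2, hb4]
    field_simp
  · rw [integral_gaussianReal_eq_integral_smul hv]
    have h1 : ∀ z : ℝ, gaussianPDFReal 0 v z • cexp (l * (x + z : ℝ) - p * (x + z : ℝ) ^ 2) =
        ((√(2 * Real.pi * v))⁻¹ : ℝ) * cexp (b * z ^ 2 + (l - 2 * p * x) * z +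
          (l * x - p * x ^ 2)) := by
      intro z
      rw [gaussianPDFReal, real_smul, ofReal_mul, mul_assoc, ofReal_exp, ← exp_add]
      congr 2
      rw [hb]; push_cast
      field_simp
      ring
    simp_rw [h1]
    rw [integral_const_mul, integral_cexp_quadratic hbre, ← mul_assoc]
    congr 2
    rw [show (4 : ℂ) * b = -(4 * -b) by ring, hb4]
    generalize hEe : (1 : ℂ) + 2 * v * p = E at hE ⊢
    field_simp
    rw [← hEe]
    ring

lemma norm_cexp_quadratic_le {p : ℂ} (hp : 0 < p.re) (l : ℂ) (y : ℝ) :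
    ‖Complex.exp (l * y - p * (y : ℂ) ^ 2)‖ ≤ Real.exp (‖l‖ ^ 2 / (4 * p.re)) := by
  rw [Complex.norm_exp]
  apply Real.exp_le_exp.2
  have h1 : (l * y - p * (y : ℂ) ^ 2).re = l.re * y - p.re * y ^ 2 := by
    rw [Complex.sub_re, Complex.re_mul_ofReal, ← Complex.ofReal_pow, Complex.re_mul_ofReal]
  rw [h1, le_div_iff₀ (by positivity)]
  have h2 : l.re ^ 2 ≤ ‖l‖ ^ 2 := by
    rw [← sq_abs l.re]; exact pow_le_pow_left₀ (abs_nonneg _) (Complex.abs_re_le_norm l) 2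
  nlinarith [sq_nonneg (l.re - 2 * p.re * y)]

lemma norm_cexp_of_re_eq_zero {c : ℂ} (hc : c.re = 0) (y : ℝ) : ‖Complex.exp (c * y)‖ = 1 := by
  rw [Complex.norm_exp, Complex.re_mul_ofReal, hc, zero_mul, Real.exp_zero]

section Riccati

/-- One step of the backward recursion for the coefficients of a Gaussian functional. -/
noncomputable def riccatiStep (c : ℂ) (h s : ℝ) : Matrix (Fin 2) (Fin 2) ℂ :=
  !![1 + c * h * s, c * h; s, 1]

/-- The numerator of the Möbius action of a matrix. -/
noncomputable def mobNum (M : Matrix (Fin 2) (Fin 2) ℂ) (p : ℂ) : ℂ := M 0 0 * p + M 0 1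

/-- The denominator of the Möbius action of a matrix. -/
noncomputable def mobDen (M : Matrix (Fin 2) (Fin 2) ℂ) (p : ℂ) : ℂ := M 1 0 * p + M 1 1

variable {c : ℂ} {h s : ℝ} {p : ℂ}

lemma one_add_mul_ne_zero (hs : 0 ≤ s) (hp : 0 < p.re) : (1 : ℂ) + s * p ≠ 0 := by
  intro H
  have := congrArg Complex.re H
  rw [Complex.add_re, Complex.re_ofReal_mul, Complex.one_re, Complex.zero_re] at this
  nlinarith [mul_nonneg hs hp.le]

/-- Cocycle rule for denominators. One step acts by p ↦ p/(1+sp) + ch: a Gaussian smoothing followed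
by one term of the energy. In the matrix power the rightmost factor acts first, which is the last
time step. -/
lemma mobDen_pow_succ (hs : 0 ≤ s) (hp : 0 < p.re) (n : ℕ) :
    mobDen (riccatiStep c h s ^ (n + 1)) p =
      (1 + s * p) * mobDen (riccatiStep c h s ^ n) (p / (1 + s * p) + c * h) := by
  have := one_add_mul_ne_zero hs hp
  rw [pow_succ]
  simp only [mobDen, Matrix.mul_apply, Fin.sum_univ_two, riccatiStep, Matrix.of_apply,
    Matrix.cons_val', Matrix.cons_val_zero, Matrix.cons_val_one, Matrix.cons_val_fin_one]
  field_simp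
  ring

lemma mobNum_pow_succ (hs : 0 ≤ s) (hp : 0 < p.re) (n : ℕ) :
    mobNum (riccatiStep c h s ^ (n + 1)) p =
      (1 + s * p) * mobNum (riccatiStep c h s ^ n) (p / (1 + s * p) + c * h) := by
  have := one_add_mul_ne_zero hs hp
  rw [pow_succ]
  simp only [mobNum, Matrix.mul_apply, Fin.sum_univ_two, riccatiStep, Matrix.of_apply,
    Matrix.cons_val', Matrix.cons_val_zero, Matrix.cons_val_one, Matrix.cons_val_fin_one]
  field_simp
  ring

/-- The right side equals Re p + s|p|². -/
lemma re_div_one_add_mul_le (hs : 0 ≤ s) (hp : 0 < p.re) :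
    p.re ≤ (p / (1 + s * p)).re * ‖(1 : ℂ) + s * p‖ ^ 2 := by
  have h0 := one_add_mul_ne_zero hs hp
  have h1 : (0 : ℝ) < Complex.normSq (1 + s * p) := Complex.normSq_pos.2 h0
  rw [← Complex.normSq_eq_norm_sq, Complex.div_re]
  have e : (p.re * (1 + s * p : ℂ).re / Complex.normSq (1 + s * p) +
      p.im * (1 + s * p : ℂ).im / Complex.normSq (1 + s * p)) * Complex.normSq (1 + s * p) =
      p.re * (1 + s * p : ℂ).re + p.im * (1 + s * p : ℂ).im := by
    field_simp
  rw [e, Complex.add_re, Complex.add_im, Complex.re_ofReal_mul, Complex.im_ofReal_mul]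
  simp only [Complex.one_re, Complex.one_im]
  nlinarith [mul_nonneg hs (sq_nonneg p.re), mul_nonneg hs (sq_nonneg p.im)]

lemma re_step_pos (hc : c.re = 0) (hs : 0 ≤ s) (hp : 0 < p.re) :
    0 < (p / (1 + s * p) + c * h).re := by
  rw [Complex.add_re, Complex.re_mul_ofReal, hc, zero_mul, add_zero]
  have h0 := one_add_mul_ne_zero hs hp
  by_contra! H
  have h1 := re_div_one_add_mul_le hs hp
  have h2 : 0 < ‖(1 : ℂ) + s * p‖ ^ 2 := by positivity
  nlinarith

/-- The denominator is a product of factors 1 + sp' with Re p' > 0, each of modulus at least one.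
Since c is imaginary, the energy term does not change the real part. -/
lemma one_le_norm_mobDen_pow (hc : c.re = 0) (hs : 0 ≤ s) (n : ℕ) :
    ∀ {p : ℂ}, 0 < p.re → 1 ≤ ‖mobDen (riccatiStep c h s ^ n) p‖ := by
  induction n with
  | zero => intro p _; simp [mobDen]
  | succ n ih =>
    intro p hp
    rw [mobDen_pow_succ hs hp, norm_mul]
    have h1 : 1 ≤ ‖(1 : ℂ) + s * p‖ := by
      refine le_trans ?_ (Complex.re_le_norm _)
      rw [Complex.add_re, Complex.re_ofReal_mul, Complex.one_re]
      nlinarith [mul_nonneg hs hp.le]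
    exact one_le_mul_of_one_le_of_one_le h1 (ih (re_step_pos hc hs hp))

/-- Positivity of the real part alone could be lost as the step size tends to zero; this inequality
is closed under limits and still forces it. -/
lemma re_le_re_mob_pow (hc : c.re = 0) (hs : 0 ≤ s) (n : ℕ) :
    ∀ {p : ℂ}, 0 < p.re → p.re ≤ (mobNum (riccatiStep c h s ^ n) p /
      mobDen (riccatiStep c h s ^ n) p).re * ‖mobDen (riccatiStep c h s ^ n) p‖ ^ 2 := by
  induction n with
  | zero => intro p _; simp [mobDen, mobNum]
  | succ n ih =>
    intro p hp
    have h0 := one_add_mul_ne_zero hs hp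
    rw [mobDen_pow_succ hs hp, mobNum_pow_succ hs hp, norm_mul, mul_div_mul_left _ _ h0, mul_pow]
    have h1 := ih (re_step_pos (h := h) hc hs hp)
    have h2 := re_div_one_add_mul_le hs hp
    have h3 : (p / (1 + s * p) + c * h).re = (p / (1 + s * p)).re := by
      rw [Complex.add_re, Complex.re_mul_ofReal, hc, zero_mul, add_zero]
    rw [h3] at h1
    nlinarith [mul_le_mul_of_nonneg_right h1 (sq_nonneg ‖(1 : ℂ) + s * p‖)]

/-- Passes to powers and limits, and so keeps the limiting Möbius map injective. -/
lemma det_riccatiStep : (riccatiStep c h s).det = 1 := by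
  simp [riccatiStep, Matrix.det_fin_two_of]

end Riccati

variable {Ω : Type*} [MeasurableSpace Ω] {P : Measure Ω}

/-- Integration of a bounded function of two independent random variables. -/
lemma integral_indepFun_eq [IsProbabilityMeasure P] {α β : Type*} [MeasurableSpace α]
    [MeasurableSpace β] {Y : Ω → α} {Z : Ω → β} (hY : Measurable Y) (hZ : Measurable Z)
    (hYZ : IndepFun Y Z P) {F : α × β → ℂ} (hF : Measurable F) {C : ℝ} (hC : ∀ q, ‖F q‖ ≤ C) :
    ∫ ω, F (Y ω, Z ω) ∂P = ∫ ω, ∫ z, F (Y ω, z) ∂(P.map Z) ∂P := by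
  have := Measure.isProbabilityMeasure_map hY.aemeasurable (μ := P)
  have := Measure.isProbabilityMeasure_map hZ.aemeasurable (μ := P)
  have h := (indepFun_iff_map_prod_eq_prod_map_map hY.aemeasurable hZ.aemeasurable).1 hYZ
  have hint : Integrable F ((P.map Y).prod (P.map Z)) :=
    Integrable.of_bound hF.aestronglyMeasurable C (ae_of_all _ hC)
  rw [← integral_map (f := F) (hY.prodMk hZ).aemeasurable hF.aestronglyMeasurable, h,
    integral_prod _ hint, integral_map hY.aemeasurable]
  exact (hF.stronglyMeasurable.integral_prod_right' (ν := P.map Z)).aestronglyMeasurable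

/-- A real process started at zero with independent centred Gaussian increments whose variance is
`v` per unit of time. -/
structure IsScaledBrownian (v : ℝ≥0) (X : ℝ≥0 → Ω → ℝ) (P : Measure Ω) : Prop where
  meas : ∀ t, Measurable (X t)
  zero : ∀ᵐ ω ∂P, X 0 ω = 0
  law : ∀ t h, P.map (fun ω => X (t + h) ω - X t ω) = gaussianReal 0 (v * h)
  indep : ∀ t h, IndepFun (fun ω (u : Set.Iic t) => X u ω) (fun ω => X (t + h) ω - X t ω) P

lemma IsScaledBrownian.of_isBrownianReal {X : ℝ≥0 → Ω → ℝ} {a : ℝ} (ha : a ≠ 0)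
    (hX : IsBrownianReal (fun t ω => a⁻¹ * X t ω) P) (hm : ∀ t, Measurable (X t)) :
    IsScaledBrownian ⟨a ^ 2, sq_nonneg a⟩ X P where
  meas := hm
  zero := by
    filter_upwards [hX.eval_zero_ae_eq_zero] with ω hω
    simpa [ha] using hω
  law t h := by
    have h1 := hX.hasLaw_sub (t + h) t
    have h2 : nndist ((t + h : ℝ≥0) : ℝ) (t : ℝ) = h := by
      ext; simp
    have h3 : (fun ω => X (t + h) ω - X t ω) =
        fun ω => a * ((fun ω => a⁻¹ * X (t + h) ω) - fun ω => a⁻¹ * X t ω) ω := by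
      funext ω; simp only [Pi.sub_apply]; field_simp
    have h4 := (gaussianReal_const_mul h1 a).map_eq
    rw [h3, h4]
    simp only [mul_zero]
    congr 2
  indep t h := by
    have h1 := (hX.indepFun_shift t).symm
    have h2 := h1.comp (φ := fun f u => a * f u) (ψ := fun f => a * f h) (by fun_prop)
      (by fun_prop)
    convert h2 using 1
    · funext ω u; simp only [Function.comp]; field_simp
    · funext ω; simp only [Function.comp]; field_simp

/-- The discretised Gaussian functional of a scaled Brownian motion, as a function of the starting
point. The constants do not depend on the process. -/
lemma exists_integral_discretised [IsProbabilityMeasure P] {v h : ℝ≥0} (hv : v ≠ 0) (hh : h ≠ 0)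
    {c : ℂ} (hc : c.re = 0) (n : ℕ) : ∀ {p : ℂ}, 0 < p.re → ∃ K E : ℂ,
      K ^ 2 * mobDen (riccatiStep c h (2 * v * h) ^ n) p = 1 ∧
      ∀ X : ℝ≥0 → Ω → ℝ, IsScaledBrownian v X P → ∀ (l : ℂ) (x : ℝ),
        ∫ ω, Complex.exp (l * (x + X (n * h) ω : ℝ) - p * (x + X (n * h) ω : ℝ) ^ 2) *
          Complex.exp (-c * (h * ∑ k ∈ Finset.range n, (x + X (k * h) ω) ^ 2 : ℝ)) ∂P =
        K * Complex.exp (l / mobDen (riccatiStep c h (2 * v * h) ^ n) p * x -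
          mobNum (riccatiStep c h (2 * v * h) ^ n) p /
            mobDen (riccatiStep c h (2 * v * h) ^ n) p * x ^ 2 + l ^ 2 * E) := by
  have hs : (0 : ℝ) ≤ 2 * v * h := by positivity
  induction n with
  | zero =>
    intro p _
    refine ⟨1, 0, by simp [mobDen], fun X hX l x => ?_⟩
    have : ∀ᵐ ω ∂P, Complex.exp (l * (x + X ((0 : ℕ) * h) ω : ℝ) -
        p * (x + X ((0 : ℕ) * h) ω : ℝ) ^ 2) *
        Complex.exp (-c * (h * ∑ k ∈ Finset.range 0, (x + X (k * h) ω) ^ 2 : ℝ)) =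
        Complex.exp (l * x - p * x ^ 2) := by
      filter_upwards [hX.zero] with ω hω
      simp [hω]
    rw [integral_congr_ae this]
    simp [mobDen, mobNum]
  | succ n ih =>
    intro p hp
    set D := 1 + ((2 * v * h : ℝ) : ℂ) * p with hD
    have hD0 : D ≠ 0 := one_add_mul_ne_zero hs hp
    -- Given the path up to time nh, integrating out the last increment, of variance vh, turns p
    -- into p/D, and the summand k = n adds ch. The left Riemann sum never sees the end point
    -- (n+1)h, so the remaining integral is the case n with parameter p'.
    set p' := p / D + c * (h : ℝ) with hp'
    have hp'0 : 0 < p'.re := re_step_pos hc hs hp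
    obtain ⟨K₁, E₁, hK₁, hX₁⟩ := ih hp'0
    obtain ⟨K₀, hK₀, hZ⟩ :=
      exists_integral_cexp_quadratic_gaussianReal (v := v * h) (mul_ne_zero hv hh) hp
    have hDe : 1 + 2 * ((v * h : ℝ≥0) : ℂ) * p = D := by rw [hD]; push_cast; ring
    simp only [hDe] at hK₀ hZ
    refine ⟨K₀ * K₁, E₁ / D ^ 2 + (v * h : ℝ≥0) / (2 * D), ?_, fun X hX l x => ?_⟩
    · rw [mobDen_pow_succ hs hp, ← hD, ← hp']
      linear_combination hK₁ + K₁ ^ 2 * mobDen (riccatiStep c h (2 * v * h) ^ n) p' * hK₀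
    rw [mobDen_pow_succ hs hp, mobNum_pow_succ hs hp, ← hD, ← hp', mul_div_mul_left _ _ hD0]
    let Y : Ω → ℝ × ℝ := fun ω =>
      (x + X (n * h) ω, ∑ k ∈ Finset.range (n + 1), (x + X (k * h) ω) ^ 2)
    let Z : Ω → ℝ := fun ω => X (n * h + h) ω - X (n * h) ω
    let F : (ℝ × ℝ) × ℝ → ℂ := fun q =>
      Complex.exp (l * (q.1.1 + q.2 : ℝ) - p * (q.1.1 + q.2 : ℝ) ^ 2) *
        Complex.exp (-c * (h * q.1.2 : ℝ))
    have hmX := hX.meas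
    have hY : Measurable Y := by
      refine Measurable.prodMk (by fun_prop) (Finset.measurable_sum _ fun k _ => by fun_prop)
    have hZm : Measurable Z := by fun_prop
    have hYZ : IndepFun Y Z P := by
      have hk (k : ℕ) (hk : k ≤ n) : (k * h : ℝ≥0) ≤ n * h :=
        mul_le_mul_of_nonneg_right (by exact_mod_cast hk) zero_le
      have := (hX.indep (n * h) h).comp
        (φ := fun f : Set.Iic ((n : ℝ≥0) * h) → ℝ =>
          (x + f ⟨n * h, Set.mem_Iic.2 le_rfl⟩, ∑ k : Finset.range (n + 1),
            (x + f ⟨k.1 * h, hk k.1 (by have := Finset.mem_range.1 k.2; omega)⟩) ^ 2))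
        (ψ := id) (by fun_prop) measurable_id
      convert this using 1
      · funext ω
        simp only [Y, Function.comp]
        rw [← Finset.sum_coe_sort]
      · rfl
    have hF : Measurable F := by unfold F; fun_prop
    have hFC : ∀ q, ‖F q‖ ≤ Real.exp (‖l‖ ^ 2 / (4 * p.re)) := by
      intro q
      rw [norm_mul, norm_cexp_of_re_eq_zero (by simp [hc]), mul_one]
      exact norm_cexp_quadratic_le hp l _
    have h1 := integral_indepFun_eq hY hZm hYZ hF hFC
    have hZlaw : P.map Z = gaussianReal 0 (v * h) := hX.law _ _
    have h2 : ∀ ω, ∫ z, F (Y ω, z) ∂(P.map Z) = K₀ * Complex.exp (l ^ 2 * ((v * h : ℝ≥0) / (2 * D)))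
        * (Complex.exp (l / D * (x + X (n * h) ω : ℝ) - p' * (x + X (n * h) ω : ℝ) ^ 2) *
          Complex.exp (-c * (h * ∑ k ∈ Finset.range n, (x + X (k * h) ω) ^ 2 : ℝ))) := by
      intro ω
      simp only [F, Y]
      rw [integral_mul_const, hZlaw, hZ, Finset.sum_range_succ]
      simp only [mul_assoc, ← Complex.exp_add]
      congr 2
      rw [hp']; push_cast
      ring
    have h3 : ∀ ω, Complex.exp (l * (x + X ((n + 1 : ℕ) * h) ω : ℝ) -
        p * (x + X ((n + 1 : ℕ) * h) ω : ℝ) ^ 2) *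
          Complex.exp (-c * (h * ∑ k ∈ Finset.range (n + 1), (x + X (k * h) ω) ^ 2 : ℝ)) =
        F (Y ω, Z ω) := by
      intro ω
      simp only [F, Y, Z]
      have : ((n + 1 : ℕ) : ℝ≥0) * h = n * h + h := by push_cast; ring
      have h4 : x + X (n * h) ω + (X (n * h + h) ω - X (n * h) ω) = x + X (n * h + h) ω := by ring
      rw [this, h4]
    simp only [h3]
    rw [h1]
    simp only [h2]
    rw [integral_const_mul, hX₁ X hX, mul_mul_mul_comm, mul_comm (Complex.exp _) (Complex.exp _),
      ← Complex.exp_add]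
    congr 2
    ring_nf

end PZD

/-! ### Passage to continuous time -/

namespace PZD

open Topology

lemma sum_norm_riccatiStep_pow_le {c : ℂ} {h s : ℝ} (hh : 0 ≤ h) (hs : 0 ≤ s) (i : Fin 2) (n : ℕ) :
    ‖(riccatiStep c h s ^ n) i 0‖ + ‖(riccatiStep c h s ^ n) i 1‖ ≤
      (1 + (‖c‖ * h * s + ‖c‖ * h + s)) ^ n := by
  induction n with
  | zero => fin_cases i <;> simp
  | succ n ih =>
    set m0 := (riccatiStep c h s ^ n) i 0 with hm0
    set m1 := (riccatiStep c h s ^ n) i 1 with hm1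
    have e0 : (riccatiStep c h s ^ (n + 1)) i 0 = m0 * (1 + c * h * s) + m1 * s := by
      rw [pow_succ]; simp [Matrix.mul_apply, Fin.sum_univ_two, riccatiStep, hm0, hm1]
    have e1 : (riccatiStep c h s ^ (n + 1)) i 1 = m0 * (c * h) + m1 := by
      rw [pow_succ]; simp [Matrix.mul_apply, Fin.sum_univ_two, riccatiStep, hm0, hm1]
    have b0 : ‖m0 * (1 + c * h * s) + m1 * s‖ ≤ ‖m0‖ * (1 + ‖c‖ * h * s) + ‖m1‖ * s := by
      refine (norm_add_le _ _).trans ?_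
      rw [norm_mul, norm_mul, Complex.norm_real, Real.norm_of_nonneg hs]
      have : ‖1 + c * h * s‖ ≤ 1 + ‖c‖ * h * s := by
        refine (norm_add_le _ _).trans ?_
        rw [norm_mul, norm_mul, Complex.norm_real, Complex.norm_real, Real.norm_of_nonneg hs,
          Real.norm_of_nonneg hh, norm_one]
      gcongr
    have b1 : ‖m0 * (c * h) + m1‖ ≤ ‖m0‖ * (‖c‖ * h) + ‖m1‖ := by
      refine (norm_add_le _ _).trans ?_
      rw [norm_mul, norm_mul, Complex.norm_real, Real.norm_of_nonneg hh]
    rw [e0, e1, pow_succ]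
    have hch : 0 ≤ ‖c‖ * h := by positivity
    have hchs : 0 ≤ ‖c‖ * h * s := by positivity
    calc _ ≤ (‖m0‖ * (1 + ‖c‖ * h * s) + ‖m1‖ * s) + (‖m0‖ * (‖c‖ * h) + ‖m1‖) := add_le_add b0 b1
      _ ≤ (‖m0‖ + ‖m1‖) * (1 + (‖c‖ * h * s + ‖c‖ * h + s)) := by
        nlinarith [norm_nonneg m0, norm_nonneg m1, mul_nonneg (norm_nonneg m0) hs,
          mul_nonneg (norm_nonneg m1) hch, mul_nonneg (norm_nonneg m1) hchs]
      _ ≤ _ := by gcongr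

/-- The `n`-step products with step size `L / n` have a convergent subsequence. -/
lemma exists_tendsto_riccatiStep_pow (c : ℂ) {L v : ℝ} (hL : 0 ≤ L) (hv : 0 ≤ v) :
    ∃ (A : Matrix (Fin 2) (Fin 2) ℂ) (φ : ℕ → ℕ), StrictMono φ ∧ ∀ i j, Tendsto
      (fun n => (riccatiStep c (L / φ n) (2 * v * (L / φ n)) ^ φ n) i j) atTop (𝓝 (A i j)) := by
  -- Each step adds at most t/n to the growth factor of the row sums, so the n-step product is
  -- bounded by (1 + t/n)^n ≤ e^t. Compactness then gives a limit point, whose explicit form is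
  -- never needed.
  set t := ‖c‖ * L * (2 * v * L) + ‖c‖ * L + 2 * v * L with ht
  have ht0 : 0 ≤ t := by positivity
  let M : ℕ → Fin 2 → Fin 2 → ℂ := fun n => riccatiStep c (L / n) (2 * v * (L / n)) ^ n
  have hM : ∀ n, M n ∈ Metric.closedBall (0 : Fin 2 → Fin 2 → ℂ) (Real.exp t) := by
    intro n
    rw [mem_closedBall_zero_iff, pi_norm_le_iff_of_nonneg (Real.exp_pos _).le]
    intro i
    have h1 := sum_norm_riccatiStep_pow_le (c := c) (h := L / n) (s := 2 * v * (L / n))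
      (by positivity) (by positivity) i n
    have h2 : (1 + (‖c‖ * (L / n) * (2 * v * (L / n)) + ‖c‖ * (L / n) + 2 * v * (L / n))) ^ n ≤
        Real.exp t := by
      rcases Nat.eq_zero_or_pos n with rfl | hn
      · simpa using Real.one_le_exp ht0
      have hn1 : (1 : ℝ) ≤ n := by exact_mod_cast hn
      have h3 : ‖c‖ * (L / n) * (2 * v * (L / n)) + ‖c‖ * (L / n) + 2 * v * (L / n) ≤ t / n := by
        have hLn : L / n ≤ L := div_le_self hL hn1
        have e : t / n = ‖c‖ * (L / n) * (2 * v * L) + ‖c‖ * (L / n) + 2 * v * (L / n) := by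
          rw [ht]; ring
        rw [e]; gcongr
      calc _ ≤ (1 + t / n) ^ n := by gcongr
        _ ≤ (Real.exp (t / n)) ^ n := by
          gcongr; rw [add_comm]; exact Real.add_one_le_exp _
        _ = Real.exp t := by
          rw [← Real.exp_nat_mul]; congr 1; field_simp
    rw [pi_norm_le_iff_of_nonneg (Real.exp_pos _).le]
    intro j
    fin_cases j
    · exact (le_add_of_nonneg_right (norm_nonneg _)).trans (h1.trans h2)
    · exact (le_add_of_nonneg_left (norm_nonneg _)).trans (h1.trans h2)
  obtain ⟨A, -, φ, hφ, hA⟩ := tendsto_subseq_of_bounded Metric.isBounded_closedBall hM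
  refine ⟨A, φ, hφ, fun i j => ?_⟩
  exact tendsto_pi_nhds.1 (tendsto_pi_nhds.1 hA i) j

variable {Ω : Type*} [MeasurableSpace Ω] {P : Measure Ω} {σ γ L : ℝ} {W : ℝ≥0 → Ω → ℂ}

/-- The variance of the real and imaginary parts of the noise per unit of time. -/
noncomputable def partVariance (σ : ℝ) : ℝ≥0 := ⟨(σ / √2) ^ 2, sq_nonneg _⟩

lemma partVariance_ne_zero (hσ : 0 < σ) : partVariance σ ≠ 0 := by
  intro h
  have : (σ / √2) ^ 2 = 0 := congrArg NNReal.toReal h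
  exact absurd this (by positivity)

lemma IsRegularWiener.re_isScaledBrownian (hσ : 0 < σ) (hW : IsRegularWiener σ W P) :
    IsScaledBrownian (partVariance σ) (fun t ω => (W t ω).re) P :=
  .of_isBrownianReal (by positivity) hW.re fun t => Complex.measurable_re.comp (hW.meas t)

lemma IsRegularWiener.im_isScaledBrownian (hσ : 0 < σ) (hW : IsRegularWiener σ W P) :
    IsScaledBrownian (partVariance σ) (fun t ω => (W t ω).im) P :=
  .of_isBrownianReal (by positivity) hW.im fun t => Complex.measurable_im.comp (hW.meas t)

lemma sq_norm_eq (z : ℂ) : ‖z‖ ^ 2 = z.re ^ 2 + z.im ^ 2 := by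
  rw [← Complex.normSq_eq_norm_sq, Complex.normSq_apply]; ring

/-- The discretised Gaussian functional of a complex Wiener process. -/
lemma IsRegularWiener.integral_discretised [IsProbabilityMeasure P] (hσ : 0 < σ)
    (hW : IsRegularWiener σ W P) {h : ℝ≥0} (hh : h ≠ 0) {c : ℂ} (hc : c.re = 0) (n : ℕ) {p : ℂ}
    (hp : 0 < p.re) (l x : ℂ) :
    ∫ ω, Complex.exp (l * (x + W (n * h) ω) - p * (‖x + W (n * h) ω‖ ^ 2 : ℝ)) *
        Complex.exp (-c * (h * ∑ k ∈ Finset.range n, ‖x + W (k * h) ω‖ ^ 2 : ℝ)) ∂P =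
      (mobDen (riccatiStep c h (2 * partVariance σ * h) ^ n) p)⁻¹ *
        Complex.exp (l / mobDen (riccatiStep c h (2 * partVariance σ * h) ^ n) p * x -
          mobNum (riccatiStep c h (2 * partVariance σ * h) ^ n) p /
            mobDen (riccatiStep c h (2 * partVariance σ * h) ^ n) p * (‖x‖ ^ 2 : ℝ)) := by
  obtain ⟨K, E, hK, hX⟩ := exists_integral_discretised (P := P) (partVariance_ne_zero hσ) hh hc n hp
  set D := mobDen (riccatiStep c h (2 * partVariance σ * h) ^ n) p
  set N := mobNum (riccatiStep c h (2 * partVariance σ * h) ^ n) p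
  -- The functional factors over real and imaginary parts, with linear coefficients l and il. The
  -- terms l²E and (il)²E cancel in the product, and the prefactors give K² = D⁻¹.
  let G : ℂ → ℝ → (ℝ≥0 → ℝ) → ℂ := fun l y f =>
    Complex.exp (l * (y + f (n * h) : ℝ) - p * (y + f (n * h) : ℝ) ^ 2) *
      Complex.exp (-c * (h * ∑ k ∈ Finset.range n, (y + f (k * h)) ^ 2 : ℝ))
  have hG l y : Measurable (G l y) := by unfold G; fun_prop
  have hfac : ∀ ω, Complex.exp (l * (x + W (n * h) ω) - p * (‖x + W (n * h) ω‖ ^ 2 : ℝ)) *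
        Complex.exp (-c * (h * ∑ k ∈ Finset.range n, ‖x + W (k * h) ω‖ ^ 2 : ℝ)) =
      G l x.re (fun t => (W t ω).re) * G (Complex.I * l) x.im (fun t => (W t ω).im) := by
    intro ω
    simp only [G, ← Complex.exp_add]
    congr 1
    simp only [sq_norm_eq, Complex.add_re, Complex.add_im, Finset.sum_add_distrib]
    have e : x + W (n * h) ω = ((x.re + (W (n * h) ω).re : ℝ) : ℂ) +
        ((x.im + (W (n * h) ω).im : ℝ) : ℂ) * Complex.I := by
      conv_lhs => rw [← Complex.re_add_im (x + W (n * h) ω)]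
      simp
    rw [e]
    push_cast
    ring
  have hind : IndepFun (fun ω => G l x.re (fun t => (W t ω).re))
      (fun ω => G (Complex.I * l) x.im (fun t => (W t ω).im)) P :=
    hW.indep.comp (hG _ _) (hG _ _)
  have hm1 : Measurable fun ω t => (W t ω).re :=
    measurable_pi_lambda _ fun t => Complex.measurable_re.comp (hW.meas t)
  have hm2 : Measurable fun ω t => (W t ω).im :=
    measurable_pi_lambda _ fun t => Complex.measurable_im.comp (hW.meas t)
  simp only [hfac]
  rw [hind.integral_fun_mul_eq_mul_integral ((hG _ _).comp hm1).aestronglyMeasurable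
    ((hG _ _).comp hm2).aestronglyMeasurable]
  have h1 := hX _ (hW.re_isScaledBrownian hσ) l x.re
  have h2 := hX _ (hW.im_isScaledBrownian hσ) (Complex.I * l) x.im
  simp only [G]
  rw [h1, h2, mul_mul_mul_comm, ← Complex.exp_add, ← pow_two, eq_inv_of_mul_eq_one_left hK]
  congr 2
  rw [sq_norm_eq, mul_pow, Complex.I_sq]
  conv_rhs => rw [← Complex.re_add_im x]
  simp only [Complex.add_re, Complex.add_im, Complex.ofReal_re, Complex.ofReal_im,
    Complex.mul_re, Complex.mul_im, Complex.I_re, Complex.I_im]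
  push_cast
  ring

lemma norm_cexp_quadratic_complex_le {p : ℂ} (hp : 0 < p.re) (l y : ℂ) :
    ‖Complex.exp (l * y - p * (‖y‖ ^ 2 : ℝ))‖ ≤ Real.exp (‖l‖ ^ 2 / (4 * p.re)) := by
  rw [Complex.norm_exp]
  apply Real.exp_le_exp.2
  rw [Complex.sub_re, Complex.re_mul_ofReal, le_div_iff₀ (by positivity)]
  have h1 : (l * y).re ≤ ‖l‖ * ‖y‖ := (Complex.re_le_norm _).trans (norm_mul _ _).le
  nlinarith [sq_nonneg (‖l‖ - 2 * p.re * ‖y‖)]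

/-- The joint Gaussian functional of the end point and the energy of a complex Wiener process. -/
theorem IsRegularWiener.exists_integral_functional [IsProbabilityMeasure P] (hσ : 0 < σ)
    (hL : 0 < L) (hW : IsRegularWiener σ W P) {c : ℂ} (hc : c.re = 0) :
    ∃ A : Matrix (Fin 2) (Fin 2) ℂ, A.det = 1 ∧ ∀ p : ℂ, 0 < p.re →
      1 ≤ ‖mobDen A p‖ ∧ 0 < (mobNum A p / mobDen A p).re ∧ ∀ l x : ℂ,
        ∫ ω, Complex.exp (l * (x + W L.toNNReal ω) - p * (‖x + W L.toNNReal ω‖ ^ 2 : ℝ)) *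
          Complex.exp (-c * (∫ ℓ in (0 : ℝ)..L, ‖x + W ℓ.toNNReal ω‖ ^ 2 : ℝ)) ∂P =
        (mobDen A p)⁻¹ * Complex.exp (l / mobDen A p * x -
          mobNum A p / mobDen A p * (‖x‖ ^ 2 : ℝ)) := by
  obtain ⟨A, φ, hφ, hA⟩ := exists_tendsto_riccatiStep_pow c hL.le (partVariance σ).2
  set M : ℕ → Matrix (Fin 2) (Fin 2) ℂ := fun n =>
    riccatiStep c (L / φ n) (2 * (partVariance σ : ℝ) * (L / φ n)) ^ φ n with hM
  have hMden (p : ℂ) : Tendsto (fun n => mobDen (M n) p) atTop (𝓝 (mobDen A p)) :=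
    ((hA 1 0).mul_const p).add (hA 1 1)
  have hMnum (p : ℂ) : Tendsto (fun n => mobNum (M n) p) atTop (𝓝 (mobNum A p)) :=
    ((hA 0 0).mul_const p).add (hA 0 1)
  have hs (n : ℕ) : 0 ≤ 2 * (partVariance σ : ℝ) * (L / φ n) := by positivity
  refine ⟨A, ?_, fun p hp => ?_⟩
  · have h1 : Tendsto (fun n => (M n).det) atTop (𝓝 A.det) := by
      simp only [Matrix.det_fin_two]
      exact ((hA 0 0).mul (hA 1 1)).sub ((hA 0 1).mul (hA 1 0))
    have h2 : ∀ n, (M n).det = 1 := by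
      intro n; rw [hM]; simp only [Matrix.det_pow, det_riccatiStep, one_pow]
    simp only [h2] at h1
    exact (tendsto_nhds_unique h1 tendsto_const_nhds)
  have hD1 : 1 ≤ ‖mobDen A p‖ :=
    ge_of_tendsto (hMden p).norm (Eventually.of_forall fun n => one_le_norm_mobDen_pow hc (hs n) _ hp)
  have hD0 : mobDen A p ≠ 0 := by
    intro h; rw [h, norm_zero] at hD1; linarith
  have hq : Tendsto (fun n => mobNum (M n) p / mobDen (M n) p) atTop
      (𝓝 (mobNum A p / mobDen A p)) := (hMnum p).div (hMden p) hD0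
  refine ⟨hD1, ?_, fun l x => ?_⟩
  · have h1 : p.re ≤ (mobNum A p / mobDen A p).re * ‖mobDen A p‖ ^ 2 :=
      ge_of_tendsto (((Complex.continuous_re.tendsto _).comp hq).mul ((hMden p).norm.pow 2))
        (Eventually.of_forall fun n => re_le_re_mob_pow hc (hs n) _ hp)
    by_contra! H
    nlinarith [sq_nonneg ‖mobDen A p‖]
  have hrhs : Tendsto (fun n => (mobDen (M n) p)⁻¹ * Complex.exp (l / mobDen (M n) p * x -
      mobNum (M n) p / mobDen (M n) p * (‖x‖ ^ 2 : ℝ))) atTop (𝓝 ((mobDen A p)⁻¹ *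
        Complex.exp (l / mobDen A p * x - mobNum A p / mobDen A p * (‖x‖ ^ 2 : ℝ)))) := by
    refine ((hMden p).inv₀ hD0).mul ((Complex.continuous_exp.tendsto _).comp ?_)
    exact ((tendsto_const_nhds.div (hMden p) hD0).mul_const x).sub (hq.mul_const _)
  refine tendsto_nhds_unique ?_ hrhs
  have hφ1 : ∀ᶠ n in atTop, φ n ≠ 0 := by
    filter_upwards [eventually_ge_atTop 1] with n hn
    have := hφ.le_apply (x := n)
    omega
  have hcongr : (fun n => (mobDen (M n) p)⁻¹ * Complex.exp (l / mobDen (M n) p * x -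
      mobNum (M n) p / mobDen (M n) p * (‖x‖ ^ 2 : ℝ))) =ᶠ[atTop] fun n =>
      ∫ ω, Complex.exp (l * (x + W L.toNNReal ω) - p * (‖x + W L.toNNReal ω‖ ^ 2 : ℝ)) *
          Complex.exp (-c * (riemannPhase 1 L (φ n) (fun t => W t ω) x : ℝ)) ∂P := by
    filter_upwards [hφ1] with n hn
    have hn0 : (0 : ℝ) < φ n := by exact_mod_cast Nat.pos_of_ne_zero hn
    set h : ℝ≥0 := (L / φ n).toNNReal with hh
    have hhr : (h : ℝ) = L / φ n := Real.coe_toNNReal _ (by positivity)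
    have hh0 : h ≠ 0 := by
      intro H
      rw [H] at hhr
      have : 0 < L / φ n := by positivity
      simp only [NNReal.coe_zero] at hhr
      linarith
    have hd := hW.integral_discretised hσ hh0 hc (φ n) hp l x
    have hLn : (φ n : ℝ≥0) * h = L.toNNReal := by
      ext
      rw [NNReal.coe_mul, hhr, Real.coe_toNNReal _ hL.le]
      simp only [NNReal.coe_natCast]
      field_simp
    have hkn (k : ℕ) : (k : ℝ≥0) * h = (k * (L / φ n)).toNNReal := by
      ext
      rw [NNReal.coe_mul, hhr, Real.coe_toNNReal _ (by positivity)]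
      simp
    simp only [hLn, hkn, hhr] at hd
    rw [← hd]
    simp only [riemannPhase, one_mul]
  refine Tendsto.congr' hcongr.symm ?_
  refine tendsto_integral_of_dominated_convergence (fun _ => Real.exp (‖l‖ ^ 2 / (4 * p.re)))
    (fun n => ?_) (integrable_const _) (fun n => ae_of_all _ fun ω => ?_) (ae_of_all _ fun ω => ?_)
  · refine Measurable.aestronglyMeasurable ?_
    have hm := hW.meas
    unfold riemannPhase
    fun_prop
  · rw [norm_mul, norm_cexp_of_re_eq_zero (by simp [hc]), mul_one]
    exact norm_cexp_quadratic_complex_le hp l _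
  · have h1 := (tendsto_riemannPhase (γ := 1) hL (hW.continuous ω) x).comp hφ.tendsto_atTop
    have h2 : nonlinearPhase 1 L (fun t => W t ω) x =
        ∫ ℓ in (0 : ℝ)..L, ‖x + W ℓ.toNNReal ω‖ ^ 2 := by rw [nonlinearPhase, one_mul]
    rw [h2] at h1
    refine Tendsto.const_mul _ ((Complex.continuous_exp.tendsto _).comp ?_)
    exact ((Complex.continuous_ofReal.tendsto _).comp h1).const_mul (-c)

end PZD

/-! ### Gaussian moments of fixed angular mode -/

namespace PZD

open Topology

/-- Two everywhere convergent power series with the same sum have the same coefficients. -/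
lemma coeff_eq_of_hasSum {a b : ℕ → ℂ} {f : ℂ → ℂ} (ha : ∀ l, HasSum (fun n => l ^ n * a n) (f l))
    (hb : ∀ l, HasSum (fun n => l ^ n * b n) (f l)) : a = b := by
  have key {a : ℕ → ℂ} (ha : ∀ l, HasSum (fun n => l ^ n * a n) (f l)) :
      HasFPowerSeriesAt f (FormalMultilinearSeries.ofScalars ℂ a) 0 := by
    rw [hasFPowerSeriesAt_iff]
    refine Eventually.of_forall fun z => ?_
    simpa [FormalMultilinearSeries.coeff_ofScalars] using ha z
  exact (FormalMultilinearSeries.ofScalars_series_eq_iff (E := ℂ) a b).1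
    ((key ha).eq_formalMultilinearSeries (key hb))

/-- The test function `y ^ m * exp (-p |y|²)`. -/
noncomputable def gaussMonomial (m : ℕ) (p y : ℂ) : ℂ := y ^ m * Complex.exp (-p * (‖y‖ ^ 2 : ℝ))

@[fun_prop]
lemma continuous_gaussMonomial (m : ℕ) (p : ℂ) : Continuous (gaussMonomial m p) := by
  unfold gaussMonomial; fun_prop

lemma exp_mul_sub_sq_le {r : ℝ} (hr : 0 < r) (l y : ℝ) :
    Real.exp (l * y - r * y ^ 2) ≤ Real.exp (l ^ 2 / (4 * r)) := by
  apply Real.exp_le_exp.2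
  rw [le_div_iff₀ (by positivity)]
  nlinarith [sq_nonneg (l - 2 * r * y)]

lemma norm_cexp_neg_mul_sq (p : ℂ) (y : ℝ) :
    ‖Complex.exp (-p * (y ^ 2 : ℝ))‖ = Real.exp (-(p.re * y ^ 2)) := by
  rw [Complex.norm_exp, Complex.re_mul_ofReal, Complex.neg_re, neg_mul]

lemma pow_mul_exp_neg_sq_le {r : ℝ} (hr : 0 < r) (m : ℕ) {y : ℝ} (hy : 0 ≤ y) :
    y ^ m * Real.exp (-(r * y ^ 2)) ≤ m.factorial * Real.exp (1 / (4 * r)) := by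
  have h1 : y ^ m ≤ m.factorial * Real.exp y := by
    have := Real.pow_div_factorial_le_exp y hy m
    rwa [div_le_iff₀' (by positivity)] at this
  calc y ^ m * Real.exp (-(r * y ^ 2)) ≤ m.factorial * Real.exp y * Real.exp (-(r * y ^ 2)) := by
        gcongr
    _ = m.factorial * Real.exp (1 * y - r * y ^ 2) := by
        rw [mul_assoc, ← Real.exp_add]; ring_nf
    _ ≤ m.factorial * Real.exp (1 / (4 * r)) := by
        have := exp_mul_sub_sq_le hr 1 y
        rw [one_pow] at this
        gcongr

lemma norm_gaussMonomial_le (m : ℕ) {p : ℂ} (hp : 0 < p.re) (y : ℂ) :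
    ‖gaussMonomial m p y‖ ≤ m.factorial * Real.exp (1 / (4 * p.re)) := by
  rw [gaussMonomial, norm_mul, norm_pow, norm_cexp_neg_mul_sq]
  exact pow_mul_exp_neg_sq_le hp m (norm_nonneg y)

variable {Ω : Type*} [MeasurableSpace Ω] {P : Measure Ω} {σ γ L : ℝ} {W : ℝ≥0 → Ω → ℂ}

/-- Expansion of an exponential Gaussian functional into Gaussian moments. -/
lemma hasSum_integral_gaussMonomial [IsFiniteMeasure P] {Z V : Ω → ℂ} (hZ : Measurable Z)
    (hV : Measurable V) (hV1 : ∀ ω, ‖V ω‖ ≤ 1) {p : ℂ} (hp : 0 < p.re) (l : ℂ) :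
    HasSum (fun n : ℕ => l ^ n * ((n.factorial : ℂ)⁻¹ * ∫ ω, gaussMonomial n p (Z ω) * V ω ∂P))
      (∫ ω, Complex.exp (l * Z ω - p * (‖Z ω‖ ^ 2 : ℝ)) * V ω ∂P) := by
  have hb (ω : Ω) : HasSum (fun n : ℕ => (‖l‖ * ‖Z ω‖) ^ n / n.factorial *
      Real.exp (-(p.re * ‖Z ω‖ ^ 2))) (Real.exp (‖l‖ * ‖Z ω‖ - p.re * ‖Z ω‖ ^ 2)) := by
    rw [sub_eq_add_neg, Real.exp_add]
    refine HasSum.mul_right _ ?_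
    rw [Real.exp_eq_exp_ℝ]
    exact NormedSpace.expSeries_div_hasSum_exp (‖l‖ * ‖Z ω‖)
  have h := hasSum_integral_of_dominated_convergence (μ := P)
    (F := fun (n : ℕ) ω => l ^ n * ((n.factorial : ℂ)⁻¹ * (gaussMonomial n p (Z ω) * V ω)))
    (f := fun ω => Complex.exp (l * Z ω - p * (‖Z ω‖ ^ 2 : ℝ)) * V ω)
    (fun n ω => (‖l‖ * ‖Z ω‖) ^ n / n.factorial * Real.exp (-(p.re * ‖Z ω‖ ^ 2)))
    (fun n => ?_) (fun n => ae_of_all _ fun ω => ?_) (ae_of_all _ fun ω => (hb ω).summable) ?_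
    (ae_of_all _ fun ω => ?_)
  · simpa only [integral_const_mul] using h
  · have := (continuous_gaussMonomial n p).measurable
    exact Measurable.aestronglyMeasurable (by fun_prop)
  · rw [norm_mul, norm_mul, norm_mul, norm_inv, gaussMonomial, norm_mul, norm_pow, norm_pow,
      norm_cexp_neg_mul_sq, Complex.norm_natCast, mul_pow]
    calc _ = ‖l‖ ^ n * ‖Z ω‖ ^ n / n.factorial * Real.exp (-(p.re * ‖Z ω‖ ^ 2)) * ‖V ω‖ := by
          field_simp
      _ ≤ _ := mul_le_of_le_one_right (by positivity) (hV1 ω)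
  · simp only [fun ω => (hb ω).tsum_eq]
    refine Integrable.of_bound (Measurable.aestronglyMeasurable (by fun_prop))
      (Real.exp (‖l‖ ^ 2 / (4 * p.re))) (ae_of_all _ fun ω => ?_)
    rw [Real.norm_of_nonneg (Real.exp_pos _).le]
    exact exp_mul_sub_sq_le hp _ _
  · have h1 : HasSum (fun n : ℕ => (l * Z ω) ^ n / n.factorial) (Complex.exp (l * Z ω)) := by
      rw [Complex.exp_eq_exp_ℂ]
      exact NormedSpace.expSeries_div_hasSum_exp (l * Z ω)
    have h2 := h1.mul_right (Complex.exp (-p * (‖Z ω‖ ^ 2 : ℝ)) * V ω)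
    rw [← mul_assoc, ← Complex.exp_add, neg_mul, ← sub_eq_add_neg] at h2
    refine h2.congr_fun ?_
    intro n
    rw [gaussMonomial, neg_mul, mul_pow]
    ring

/-- The Gaussian moments of mode `m` are mapped to Gaussian moments of mode `m`. -/
theorem IsRegularWiener.exists_integral_gaussMonomial [IsProbabilityMeasure P] (hσ : 0 < σ)
    (hL : 0 < L) (hW : IsRegularWiener σ W P) {c : ℂ} (hc : c.re = 0) :
    ∃ A : Matrix (Fin 2) (Fin 2) ℂ, A.det = 1 ∧ ∀ p : ℂ, 0 < p.re →
      mobDen A p ≠ 0 ∧ 0 < (mobNum A p / mobDen A p).re ∧ ∀ (m : ℕ) (x : ℂ),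
        ∫ ω, gaussMonomial m p (x + W L.toNNReal ω) *
          Complex.exp (-c * (∫ ℓ in (0 : ℝ)..L, ‖x + W ℓ.toNNReal ω‖ ^ 2 : ℝ)) ∂P =
        (mobDen A p)⁻¹ ^ (m + 1) * gaussMonomial m (mobNum A p / mobDen A p) x := by
  obtain ⟨A, hA, h⟩ := hW.exists_integral_functional hσ hL hc
  refine ⟨A, hA, fun p hp => ?_⟩
  obtain ⟨h1, h2, h3⟩ := h p hp
  refine ⟨fun H => ?_, h2, fun m x => ?_⟩
  · rw [H, norm_zero] at h1; linarith
  have hVm : Measurable fun ω =>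
      Complex.exp (-c * (∫ ℓ in (0 : ℝ)..L, ‖x + W ℓ.toNNReal ω‖ ^ 2 : ℝ)) := by
    have h4 := (hW.measurable_nonlinearPhase (γ := 1) hL).comp
      (measurable_prodMk_left (x := x) (β := Ω))
    have h5 : ((fun p : ℂ × Ω => nonlinearPhase 1 L (fun t => W t p.2) p.1) ∘ Prod.mk x) =
        fun ω => ∫ ℓ in (0 : ℝ)..L, ‖x + W ℓ.toNNReal ω‖ ^ 2 := by
      funext ω; simp [nonlinearPhase]
    rw [h5] at h4
    fun_prop
  have hZm : Measurable fun ω => x + W L.toNNReal ω := (hW.meas _).const_add x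
  have hs1 := hasSum_integral_gaussMonomial (P := P) hZm hVm
    (fun ω => (norm_cexp_of_re_eq_zero (by simp [hc]) _).le) hp
  have hs2 : ∀ l : ℂ, HasSum (fun n : ℕ => l ^ n * ((n.factorial : ℂ)⁻¹ *
      ((mobDen A p)⁻¹ ^ (n + 1) * gaussMonomial n (mobNum A p / mobDen A p) x)))
      ((mobDen A p)⁻¹ * Complex.exp (l / mobDen A p * x -
          mobNum A p / mobDen A p * (‖x‖ ^ 2 : ℝ))) := by
    intro l
    have h1 : HasSum (fun n : ℕ => (l / mobDen A p * x) ^ n / n.factorial)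
        (Complex.exp (l / mobDen A p * x)) := by
      rw [Complex.exp_eq_exp_ℂ]
      exact NormedSpace.expSeries_div_hasSum_exp _
    have h2 := (h1.mul_left (mobDen A p)⁻¹).mul_right
      (Complex.exp (-(mobNum A p / mobDen A p) * (‖x‖ ^ 2 : ℝ)))
    rw [mul_assoc, ← Complex.exp_add, neg_mul, ← sub_eq_add_neg] at h2
    refine h2.congr_fun ?_
    intro n
    rw [gaussMonomial, neg_mul, mul_pow, div_pow, div_eq_mul_inv (l ^ n), ← inv_pow]
    ring
  -- Both sides are entire in l; the coefficient of l^m isolates mode m.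
  have hcoef := congrFun (coeff_eq_of_hasSum hs1 (fun l => (h3 l x).symm ▸ hs2 l)) m
  exact mul_left_cancel₀ (inv_ne_zero (by exact_mod_cast m.factorial_ne_zero)) hcoef

lemma gaussMonomial_rot (m : ℕ) (p : ℂ) (θ : ℝ) (y : ℂ) :
    gaussMonomial m p (rot θ y) = Complex.exp (m * (Complex.I * θ)) * gaussMonomial m p y := by
  rw [gaussMonomial, norm_rot, rot, mul_pow, ← Complex.exp_nat_mul, gaussMonomial, mul_assoc]

/-- Rotation by π/m changes the sign of the integrand. -/
lemma integral_gaussMonomial_eq_zero {ν : Measure ℂ} (hν : ∀ θ, ν.map (rot θ) = ν) {m : ℕ}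
    (hm : m ≠ 0) (p : ℂ) : ∫ y, gaussMonomial m p y ∂ν = 0 := by
  have h1 : ∫ y, gaussMonomial m p y ∂ν = ∫ y, gaussMonomial m p (rot (Real.pi / m) y) ∂ν := by
    conv_lhs => rw [← hν (Real.pi / m)]
    rw [integral_map (by fun_prop) (by fun_prop)]
  have h2 : Complex.exp (m * (Complex.I * (Real.pi / m : ℝ))) = -1 := by
    rw [← Complex.exp_pi_mul_I]
    congr 1
    push_cast
    field_simp
  simp only [gaussMonomial_rot, h2] at h1
  rw [integral_const_mul] at h1
  have h3 : 2 * ∫ y, gaussMonomial m p y ∂ν = 0 := by linear_combination h1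
  simpa using h3

/-- If the output law is rotation invariant, the Gaussian moments of the input of nonzero mode
vanish along a curve of parameters. -/
lemma IsRegularWiener.exists_integral_gaussMonomial_input [IsProbabilityMeasure P] (hσ : 0 < σ)
    (hL : 0 < L) (hW : IsRegularWiener σ W P) {μ : Measure ℂ} [IsProbabilityMeasure μ]
    (hμ : ∀ θ, (channel γ L W P ∘ₘ μ).map (PZD.rot θ) = channel γ L W P ∘ₘ μ) {m : ℕ} (hm : m ≠ 0) :
    ∃ A : Matrix (Fin 2) (Fin 2) ℂ, A.det = 1 ∧ ∀ p : ℂ, 0 < p.re →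
      mobDen A p ≠ 0 ∧ 0 < (mobNum A p / mobDen A p).re ∧
        ∫ x, gaussMonomial m (mobNum A p / mobDen A p) x ∂μ = 0 := by
  have := hW.isMarkovKernel_channel (γ := γ) hL
  -- The output is the end point rotated by γ∫|x+W|², which multiplies the mode-m test function by
  -- exp(imγ∫|x+W|²); hence this imaginary value of c.
  obtain ⟨A, hA, h⟩ := hW.exists_integral_gaussMonomial hσ hL
    (c := -(m * (Complex.I * γ))) (by simp)
  refine ⟨A, hA, fun p hp => ?_⟩
  obtain ⟨h1, h2, h3⟩ := h p hp
  refine ⟨h1, h2, ?_⟩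
  have h4 := integral_gaussMonomial_eq_zero hμ hm p
  have hint : Integrable (fun q : ℂ × ℂ => gaussMonomial m p q.2) (μ ⊗ₘ channel γ L W P) :=
    Integrable.of_bound (Continuous.aestronglyMeasurable (by fun_prop)) _
      (ae_of_all _ fun q => norm_gaussMonomial_le m hp q.2)
  rw [← Measure.snd_compProd, Measure.snd, integral_map (by fun_prop) (by fun_prop),
    Measure.integral_compProd hint] at h4
  have h5 : ∀ x, ∫ y, gaussMonomial m p y ∂(channel γ L W P x) =
      (mobDen A p)⁻¹ ^ (m + 1) * gaussMonomial m (mobNum A p / mobDen A p) x := by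
    intro x
    rw [← h3, hW.channel_apply hL, integral_map (hW.measurable_output_right hL x).aemeasurable
      (by fun_prop)]
    refine integral_congr_ae (ae_of_all _ fun ω => ?_)
    dsimp only
    rw [output_eq, gaussMonomial_rot, nonlinearPhase, mul_comm]
    congr 2
    push_cast
    ring
  simp only [h5] at h4
  rw [integral_const_mul] at h4
  exact (mul_eq_zero.1 h4).resolve_left (pow_ne_zero _ (inv_ne_zero h1))

/-- The Gaussian moment `x ^ m |x| ^ (2 b)` with parameter `q`, as a function of `q`. -/
noncomputable def radialMoment (μ : Measure ℂ) (m b : ℕ) (q : ℂ) : ℂ :=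
  ∫ x, x ^ m * (‖x‖ ^ (2 * b) : ℝ) * Complex.exp (-q * (‖x‖ ^ 2 : ℝ)) ∂μ

lemma norm_radialMoment_integrand (m b : ℕ) (q x : ℂ) :
    ‖x ^ m * (‖x‖ ^ (2 * b) : ℝ) * Complex.exp (-q * (‖x‖ ^ 2 : ℝ))‖ =
      ‖x‖ ^ (m + 2 * b) * Real.exp (-(q.re * ‖x‖ ^ 2)) := by
  rw [norm_mul, norm_mul, norm_cexp_neg_mul_sq, norm_pow, Complex.norm_real,
    Real.norm_of_nonneg (by positivity), pow_add]

lemma hasDerivAt_radialMoment (μ : Measure ℂ) [IsFiniteMeasure μ] (m b : ℕ) {q : ℂ}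
    (hq : 0 < q.re) : HasDerivAt (radialMoment μ m b) (-radialMoment μ m (b + 1) q) q := by
  have hmeas (b : ℕ) (z : ℂ) : AEStronglyMeasurable
      (fun x : ℂ => x ^ m * (‖x‖ ^ (2 * b) : ℝ) * Complex.exp (-z * (‖x‖ ^ 2 : ℝ))) μ :=
    Continuous.aestronglyMeasurable (by fun_prop)
  -- On the half-plane Re z > Re q / 2 one Gaussian bound dominates all derivatives.
  have hhalf : 0 < q.re / 2 := by positivity
  have h := (hasDerivAt_integral_of_dominated_loc_of_deriv_le (μ := μ) (𝕜 := ℂ) (x₀ := q)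
    (s := {z : ℂ | q.re / 2 < z.re})
    (F := fun z x => x ^ m * (‖x‖ ^ (2 * b) : ℝ) * Complex.exp (-z * (‖x‖ ^ 2 : ℝ)))
    (F' := fun z x => -(x ^ m * (‖x‖ ^ (2 * (b + 1)) : ℝ) * Complex.exp (-z * (‖x‖ ^ 2 : ℝ))))
    (bound := fun _ => (m + 2 * (b + 1)).factorial * Real.exp (1 / (4 * (q.re / 2))))
    ?_ (Eventually.of_forall fun z => hmeas b z) ?_ (hmeas (b + 1) q).neg ?_
    (integrable_const _) ?_).2
  · rw [integral_neg] at h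
    exact h
  · exact (isOpen_lt continuous_const Complex.continuous_re).mem_nhds
      (show q.re / 2 < q.re by linarith)
  · refine Integrable.of_bound (hmeas b q)
      ((m + 2 * b).factorial * Real.exp (1 / (4 * q.re))) (ae_of_all _ fun x => ?_)
    rw [norm_radialMoment_integrand]
    exact pow_mul_exp_neg_sq_le hq _ (norm_nonneg x)
  · refine ae_of_all _ fun x z hz => ?_
    rw [norm_neg, norm_radialMoment_integrand]
    refine le_trans ?_ (pow_mul_exp_neg_sq_le hhalf _ (norm_nonneg x))
    have : q.re / 2 < z.re := hz
    gcongr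
  · refine ae_of_all _ fun x z _ => ?_
    have h1 : HasDerivAt (fun z : ℂ => -z * (‖x‖ ^ 2 : ℝ)) (-1 * (‖x‖ ^ 2 : ℝ)) z :=
      (hasDerivAt_id z).neg.mul_const _
    refine (h1.cexp.const_mul (x ^ m * (‖x‖ ^ (2 * b) : ℝ))).congr_deriv ?_
    push_cast
    ring

/-- If the Gaussian moments of mode `m` vanish along a Möbius curve, then all of them vanish. -/
lemma radialMoment_eq_zero {μ : Measure ℂ} [IsFiniteMeasure μ] {m : ℕ}
    {A : Matrix (Fin 2) (Fin 2) ℂ} (hA : A.det = 1) (h : ∀ p : ℂ, 0 < p.re →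
      mobDen A p ≠ 0 ∧ 0 < (mobNum A p / mobDen A p).re ∧
        ∫ x, gaussMonomial m (mobNum A p / mobDen A p) x ∂μ = 0) (b : ℕ) :
    ∀ q : ℂ, 0 < q.re → radialMoment μ m b q = 0 := by
  have hopen : IsOpen {z : ℂ | 0 < z.re} := isOpen_lt continuous_const Complex.continuous_re
  induction b with
  | zero =>
    have hdiff : DifferentiableOn ℂ (radialMoment μ m 0) {z : ℂ | 0 < z.re} := fun z hz =>
      (hasDerivAt_radialMoment μ m 0 hz).differentiableAt.differentiableWithinAt
    have han := hdiff.analyticOnNhd hopen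
    have hconn : IsPreconnected {z : ℂ | 0 < z.re} := (convex_halfSpace_re_gt 0).isPreconnected
    -- The zeros g(t) accumulate at g(1) without equalling it, because determinant one makes the
    -- Möbius map injective; the identity theorem applies. Higher b follow by differentiating in q,
    -- each derivative bringing down -|x|².
    let g : ℝ → ℂ := fun t => mobNum A t / mobDen A t
    have hg1 : 0 < (g 1).re := (h ((1 : ℝ) : ℂ) (by simp)).2.1
    have hgc : ContinuousAt g 1 := by
      refine ContinuousAt.div ?_ ?_ (h ((1 : ℝ) : ℂ) (by simp)).1
      · unfold mobNum; fun_prop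
      · unfold mobDen; fun_prop
    have hginj : ∀ t : ℝ, 0 < t → t ≠ 1 → g t ≠ g 1 := by
      intro t ht ht1 H
      have h1 := (h (t : ℂ) (by simpa using ht)).1
      have h2 := (h ((1 : ℝ) : ℂ) (by simp)).1
      simp only [g] at H
      rw [div_eq_div_iff h1 h2] at H
      rw [Matrix.det_fin_two] at hA
      simp only [mobNum, mobDen] at H
      apply ht1
      have : (t : ℂ) - 1 = 0 := by
        push_cast at H
        linear_combination H - ((t : ℂ) - 1) * hA
      have : (t : ℂ) = 1 := by linear_combination this
      exact_mod_cast this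
    have hgt : Tendsto g (𝓝[≠] 1) (𝓝[≠] g 1) := by
      refine tendsto_nhdsWithin_iff.2 ⟨hgc.tendsto.mono_left nhdsWithin_le_nhds, ?_⟩
      filter_upwards [self_mem_nhdsWithin,
        nhdsWithin_le_nhds (lt_mem_nhds (zero_lt_one (α := ℝ)))] with t ht1 ht
      exact hginj t ht ht1
    have hz : ∀ᶠ t in 𝓝[≠] (1 : ℝ), radialMoment μ m 0 (g t) = 0 := by
      filter_upwards [nhdsWithin_le_nhds (lt_mem_nhds (zero_lt_one (α := ℝ)))] with t ht
      have := (h (t : ℂ) (by simpa using ht)).2.2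
      simpa [radialMoment, gaussMonomial, g] using this
    have hfreq := Tendsto.frequently (p := fun z => radialMoment μ m 0 z = 0) hgt hz.frequently
    intro q hq
    exact han.eqOn_zero_of_preconnected_of_frequently_eq_zero hconn hg1 hfreq hq
  | succ b ih =>
    intro q hq
    have h1 := hasDerivAt_radialMoment μ m b hq
    have h2 : radialMoment μ m b =ᶠ[𝓝 q] fun _ => 0 := by
      filter_upwards [hopen.mem_nhds hq] with z hz using ih z hz
    have h3 := h1.congr_of_eventuallyEq h2.symm
    have h4 := h3.unique (hasDerivAt_const q (0 : ℂ))
    simpa using h4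

end PZD

/-! ### Gaussian-damped moments determine a measure; injectivity on symmetry -/

namespace PZD

open ComplexConjugate

lemma norm_gaussMoment_integrand_le (k l : ℕ) (x : ℂ) :
    ‖x ^ k * conj x ^ l * (Real.exp (-‖x‖ ^ 2) : ℂ)‖ ≤
      (k + l).factorial * Real.exp (1 / (4 * 1)) := by
  rw [norm_mul, norm_mul, norm_pow, norm_pow, RCLike.norm_conj, ← pow_add, Complex.norm_real,
    Real.norm_of_nonneg (Real.exp_pos _).le]
  simpa using pow_mul_exp_neg_sq_le one_pos (k + l) (norm_nonneg x)

lemma integrable_gaussMoment (μ : Measure ℂ) [IsFiniteMeasure μ] (k l : ℕ) :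
    Integrable (fun x : ℂ => x ^ k * conj x ^ l * (Real.exp (-‖x‖ ^ 2) : ℂ)) μ :=
  Integrable.of_bound (Continuous.aestronglyMeasurable (by fun_prop)) _
    (ae_of_all _ (norm_gaussMoment_integrand_le k l))

lemma inner_pow_mul_eq (x t : ℂ) (n : ℕ) :
    ((inner ℝ x t : ℝ) : ℂ) ^ n * (Real.exp (-‖x‖ ^ 2) : ℂ) =
      ∑ k ∈ Finset.range (n + 1), ((2 : ℂ)⁻¹ ^ n * conj t ^ k * t ^ (n - k) * n.choose k) *
        (x ^ k * conj x ^ (n - k) * (Real.exp (-‖x‖ ^ 2) : ℂ)) := by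
  have h : ((inner ℝ x t : ℝ) : ℂ) = 2⁻¹ * (x * conj t + conj x * t) := by
    apply Complex.ext <;> simp [Complex.inner]
    all_goals ring
  rw [h, mul_pow, add_pow, Finset.mul_sum, Finset.sum_mul]
  refine Finset.sum_congr rfl fun k _ => ?_
  rw [mul_pow, mul_pow]
  ring

/-- The characteristic function of a Gaussian-damped measure is the sum of its Taylor series. -/
lemma hasSum_integral_inner_pow (μ : Measure ℂ) [IsFiniteMeasure μ] (t : ℂ) :
    HasSum (fun n : ℕ => ∫ x, (Complex.I ^ n / n.factorial) *
        (((inner ℝ x t : ℝ) : ℂ) ^ n * (Real.exp (-‖x‖ ^ 2) : ℂ)) ∂μ)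
      (∫ x, Complex.exp ((inner ℝ x t : ℝ) * Complex.I) * (Real.exp (-‖x‖ ^ 2) : ℂ) ∂μ) := by
  have hb (x : ℂ) : HasSum (fun n : ℕ => (‖t‖ * ‖x‖) ^ n / n.factorial *
      Real.exp (-‖x‖ ^ 2)) (Real.exp (‖t‖ * ‖x‖ - 1 * ‖x‖ ^ 2)) := by
    rw [sub_eq_add_neg, Real.exp_add, one_mul]
    refine HasSum.mul_right _ ?_
    rw [Real.exp_eq_exp_ℝ]
    exact NormedSpace.expSeries_div_hasSum_exp (‖t‖ * ‖x‖)
  refine hasSum_integral_of_dominated_convergence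
    (fun n x => (‖t‖ * ‖x‖) ^ n / n.factorial * Real.exp (-‖x‖ ^ 2))
    (fun n => Continuous.aestronglyMeasurable (by fun_prop)) (fun n => ae_of_all _ fun x => ?_)
    (ae_of_all _ fun x => (hb x).summable) ?_ (ae_of_all _ fun x => ?_)
  · rw [norm_mul, norm_mul, norm_div, norm_pow, norm_pow, Complex.norm_I, one_pow,
      Complex.norm_natCast, Complex.norm_real, Complex.norm_real,
      Real.norm_of_nonneg (Real.exp_pos _).le, one_div, ← mul_assoc, mul_comm _ (_ ^ n),
      ← div_eq_mul_inv]
    have := norm_inner_le_norm (𝕜 := ℝ) x t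
    rw [mul_comm] at this
    gcongr
  · simp only [fun x => (hb x).tsum_eq]
    refine Integrable.of_bound (Continuous.aestronglyMeasurable (by fun_prop))
      (Real.exp (‖t‖ ^ 2 / (4 * 1))) (ae_of_all _ fun x => ?_)
    rw [Real.norm_of_nonneg (Real.exp_pos _).le]
    exact exp_mul_sub_sq_le one_pos _ _
  · have h1 : HasSum (fun n : ℕ => ((inner ℝ x t : ℝ) * Complex.I) ^ n / n.factorial)
        (Complex.exp ((inner ℝ x t : ℝ) * Complex.I)) := by
      rw [Complex.exp_eq_exp_ℂ]
      exact NormedSpace.expSeries_div_hasSum_exp _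
    refine (h1.mul_right (Real.exp (-‖x‖ ^ 2) : ℂ)).congr_fun fun n => ?_
    rw [mul_pow]
    ring

/-- Two finite measures on `ℂ` with the same Gaussian-damped mixed moments are equal. -/
theorem ext_of_integral_gaussMoment {μ ν : Measure ℂ} [IsFiniteMeasure μ] [IsFiniteMeasure ν]
    (h : ∀ k l : ℕ, ∫ x, x ^ k * conj x ^ l * (Real.exp (-‖x‖ ^ 2) : ℂ) ∂μ =
      ∫ x, x ^ k * conj x ^ l * (Real.exp (-‖x‖ ^ 2) : ℂ) ∂ν) : μ = ν := by
  -- Damping by exp(-|x|²) makes the characteristic function an everywhere convergent power series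
  -- in the mixed moments, with no moment assumption on the measures. The density is positive, so it
  -- can be divided out again.
  let f : ℂ → ℝ≥0 := fun x => (Real.exp (-‖x‖ ^ 2)).toNNReal
  have hf : Measurable f := by fun_prop
  have hfin (μ : Measure ℂ) [IsFiniteMeasure μ] :
      IsFiniteMeasure (μ.withDensity fun x => (f x : ℝ≥0∞)) := by
    refine isFiniteMeasure_withDensity_ofReal (f := fun x : ℂ => Real.exp (-‖x‖ ^ 2)) ?_
    refine (Integrable.of_bound (Continuous.aestronglyMeasurable (by fun_prop)) 1
      (ae_of_all _ fun x => ?_)).2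
    rw [Real.norm_of_nonneg (Real.exp_pos _).le, Real.exp_le_one_iff]
    simp
  have hexp (μ : Measure ℂ) [IsFiniteMeasure μ] (n : ℕ) (t : ℂ) :
      ∫ x, (Complex.I ^ n / n.factorial) *
        (((inner ℝ x t : ℝ) : ℂ) ^ n * (Real.exp (-‖x‖ ^ 2) : ℂ)) ∂μ =
      (Complex.I ^ n / n.factorial) * ∑ k ∈ Finset.range (n + 1),
        ((2 : ℂ)⁻¹ ^ n * conj t ^ k * t ^ (n - k) * n.choose k) *
        ∫ x, x ^ k * conj x ^ (n - k) * (Real.exp (-‖x‖ ^ 2) : ℂ) ∂μ := by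
    rw [integral_const_mul]
    simp only [inner_pow_mul_eq]
    rw [integral_finsetSum _ fun k _ => (integrable_gaussMoment μ k (n - k)).const_mul _]
    simp only [integral_const_mul]
  have hchar (μ : Measure ℂ) [IsFiniteMeasure μ] (t : ℂ) :
      charFun (μ.withDensity fun x => (f x : ℝ≥0∞)) t =
      ∫ x, Complex.exp ((inner ℝ x t : ℝ) * Complex.I) * (Real.exp (-‖x‖ ^ 2) : ℂ) ∂μ := by
    rw [charFun_apply, integral_withDensity_eq_integral_smul hf]
    refine integral_congr_ae (ae_of_all _ fun x => ?_)
    simp only [f, NNReal.smul_def, Real.coe_toNNReal _ (Real.exp_pos _).le, Complex.real_smul]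
    rw [mul_comm]
  have h1 : (μ.withDensity fun x => (f x : ℝ≥0∞)) = ν.withDensity fun x => (f x : ℝ≥0∞) := by
    have := hfin μ
    have := hfin ν
    refine Measure.ext_of_charFun (funext fun t => ?_)
    rw [hchar, hchar]
    refine (hasSum_integral_inner_pow μ t).unique ?_
    convert hasSum_integral_inner_pow ν t using 2 with n
    rw [hexp, hexp]
    simp only [h]
  have hinv (μ : Measure ℂ) : (μ.withDensity fun x => (f x : ℝ≥0∞)).withDensity
      (fun x => (f x : ℝ≥0∞))⁻¹ = μ := by
    refine withDensity_inv_same (by fun_prop) (ae_of_all _ fun x => ?_) (by simp)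
    simpa [f] using Real.exp_pos _
  rw [← hinv μ, h1, hinv ν]

/-- If all Gaussian-damped moments of nonzero mode vanish, the measure is rotation invariant. -/
theorem map_rot_eq_of_radialMoment_eq_zero {μ : Measure ℂ} [IsFiniteMeasure μ]
    (h : ∀ m b : ℕ, m ≠ 0 → radialMoment μ m b 1 = 0) (θ : ℝ) : μ.map (rot θ) = μ := by
  have hlt (m b : ℕ) (hm : m ≠ 0) :
      ∫ x, x ^ (m + b) * conj x ^ b * (Real.exp (-‖x‖ ^ 2) : ℂ) ∂μ = 0 := by
    rw [← h m b hm, radialMoment]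
    refine integral_congr_ae (ae_of_all _ fun x => ?_)
    have : x ^ b * conj x ^ b = ((‖x‖ ^ (2 * b) : ℝ) : ℂ) := by
      rw [← mul_pow, Complex.mul_conj, Complex.normSq_eq_norm_sq, pow_mul]
      push_cast; rfl
    dsimp only
    rw [pow_add, mul_assoc (x ^ m), this]
    push_cast
    ring_nf
  refine ext_of_integral_gaussMoment fun k l => ?_
  rw [integral_map (by fun_prop) (Continuous.aestronglyMeasurable (by fun_prop))]
  have hrot (x : ℂ) : rot θ x ^ k * conj (rot θ x) ^ l * (Real.exp (-‖rot θ x‖ ^ 2) : ℂ) =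
      Complex.exp (Complex.I * θ) ^ k * conj (Complex.exp (Complex.I * θ)) ^ l *
        (x ^ k * conj x ^ l * (Real.exp (-‖x‖ ^ 2) : ℂ)) := by
    rw [norm_rot, rot, map_mul, mul_pow, mul_pow]
    ring
  simp only [hrot]
  rw [integral_const_mul]
  -- Off the diagonal the moment has nonzero mode k - l and vanishes, negative modes by conjugation.
  -- On the diagonal the rotation factor has modulus one and is real.
  rcases lt_trichotomy k l with hkl | rfl | hkl
  · suffices H : ∫ x, x ^ k * conj x ^ l * (Real.exp (-‖x‖ ^ 2) : ℂ) ∂μ = 0 by rw [H, mul_zero]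
    obtain ⟨m, rfl⟩ := Nat.exists_eq_add_of_lt hkl
    have h1 := hlt (m + 1) k (by omega)
    rw [← map_eq_zero_iff (starRingEnd ℂ) (RingHom.injective _), ← integral_conj]
    rw [← h1]
    refine integral_congr_ae (ae_of_all _ fun x => ?_)
    simp only [map_mul, map_pow, Complex.conj_conj, Complex.conj_ofReal]
    ring
  · rw [← mul_pow, Complex.mul_conj, Complex.normSq_eq_norm_sq, mul_comm Complex.I,
      Complex.norm_exp_ofReal_mul_I]
    simp
  · suffices H : ∫ x, x ^ k * conj x ^ l * (Real.exp (-‖x‖ ^ 2) : ℂ) ∂μ = 0 by rw [H, mul_zero]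
    obtain ⟨m, rfl⟩ := Nat.exists_eq_add_of_lt hkl
    rw [← hlt (m + 1) l (by omega)]
    refine integral_congr_ae (ae_of_all _ fun x => ?_)
    ring

/-- An input law whose output law is rotation invariant is itself rotation invariant. -/
theorem map_rot_eq_of_map_rot_comp_eq {Ω : Type*} [MeasurableSpace Ω] {P : Measure Ω}
    [IsProbabilityMeasure P] {σ γ L : ℝ} {W : ℝ≥0 → Ω → ℂ} (hσ : 0 < σ) (hL : 0 < L)
    (hW : IsRegularWiener σ W P) {μ : Measure ℂ} [IsProbabilityMeasure μ]
    (hμ : ∀ θ, (channel γ L W P ∘ₘ μ).map (rot θ) = channel γ L W P ∘ₘ μ) (θ : ℝ) :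
    μ.map (rot θ) = μ := by
  refine map_rot_eq_of_radialMoment_eq_zero (fun m b hm => ?_) θ
  obtain ⟨A, hA, h⟩ := hW.exists_integral_gaussMonomial_input hσ hL hμ hm
  exact radialMoment_eq_zero hA h b 1 (by simp)

end PZD

/-! ### Splitting Brownian motion along a tent -/

namespace ProbabilityTheory

variable {Ω : Type*} [MeasurableSpace Ω] {P : Measure Ω}

/-- The covariance profile of the deviation of a Brownian motion at time `τ` from its linear
interpolation on `[0, 2 τ]`. -/
noncomputable def tent (τ t : ℝ≥0) : ℝ := (2 * min (t : ℝ) τ - min (t : ℝ) (2 * τ)) / τ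

/-- The deviation at time `τ` of a process from its linear interpolation on `[0, 2 τ]`. -/
noncomputable def midDev {E : Type*} [AddCommGroup E] [Module ℝ E] (τ : ℝ≥0) (X : ℝ≥0 → Ω → E)
    (ω : Ω) : E := X τ ω - (2⁻¹ : ℝ) • X (2 * τ) ω

/-- A process with the tent spanned by its deviation at time `τ` removed. -/
noncomputable def untented {E : Type*} [AddCommGroup E] [Module ℝ E] (τ : ℝ≥0) (X : ℝ≥0 → Ω → E)
    (t : ℝ≥0) (ω : Ω) : E := X t ω - tent τ t • midDev τ X ω

section Real

variable {A B : ℝ≥0 → Ω → ℝ} {τ : ℝ≥0}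

lemma IsPreBrownianReal.memLp_two (hA : IsPreBrownianReal A P) (t : ℝ≥0) : MemLp (A t) 2 P :=
  (hA.isGaussianProcess.hasGaussianLaw_eval t).memLp_two

lemma IsPreBrownianReal.memLp_midDev (hA : IsPreBrownianReal A P) : MemLp (midDev τ A) 2 P :=
  (hA.memLp_two τ).sub ((hA.memLp_two (2 * τ)).const_mul _)

/-- With `covariance_midDev_self`, this makes `tent τ t` the regression coefficient of `A t` on the
deviation, so that `untented` is the uncorrelated residual. The tent rises from 0 to 1 at τ, falls
to 0 at 2τ and stays there. -/
lemma IsPreBrownianReal.covariance_midDev_eval (hA : IsPreBrownianReal A P) (hτ : τ ≠ 0)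
    (t : ℝ≥0) : cov[midDev τ A, A t; P] = tent τ t * (τ / 2) := by
  have := hA.isGaussianProcess.isProbabilityMeasure
  have e : midDev τ A = fun ω => A τ ω - 2⁻¹ * A (2 * τ) ω := rfl
  rw [e, covariance_fun_sub_left (hA.memLp_two _) ((hA.memLp_two _).const_mul _)
    (hA.memLp_two _), covariance_const_mul_left]
  have h (s : ℝ≥0) : cov[fun ω => A s ω, A t; P] = min (s : ℝ) t := by
    simpa using hA.covariance_eval s t
  rw [h, h, tent]
  have : (τ : ℝ) ≠ 0 := by exact_mod_cast hτ
  push_cast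
  rw [min_comm (t : ℝ), min_comm (t : ℝ)]
  field_simp

lemma IsPreBrownianReal.covariance_midDev_self (hA : IsPreBrownianReal A P) (hτ : τ ≠ 0) :
    cov[midDev τ A, midDev τ A; P] = τ / 2 := by
  have := hA.isGaussianProcess.isProbabilityMeasure
  have e : cov[midDev τ A, midDev τ A; P] =
    cov[midDev τ A, fun ω => A τ ω - 2⁻¹ * A (2 * τ) ω; P] := rfl
  rw [e, covariance_fun_sub_right hA.memLp_midDev (hA.memLp_two _)
    ((hA.memLp_two _).const_mul _), covariance_const_mul_right]
  have h := hA.covariance_midDev_eval hτ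
  have e1 : tent τ τ = 1 := by
    have : (τ : ℝ) ≠ 0 := by exact_mod_cast hτ
    have h0 : (0 : ℝ) ≤ τ := τ.2
    rw [tent, min_self, min_eq_left (by linarith)]
    field_simp; norm_num
  have e2 : tent τ (2 * τ) = 0 := by
    have h0 : (0 : ℝ) ≤ τ := τ.2
    rw [tent]; push_cast
    rw [min_self, min_eq_right (by linarith)]
    simp
  have h1 := h τ
  have h2 := h (2 * τ)
  rw [e1] at h1
  rw [e2] at h2
  change cov[midDev τ A, fun ω => A τ ω; P] = _ at h1
  change cov[midDev τ A, fun ω => A (2 * τ) ω; P] = _ at h2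
  rw [h1, h2]
  ring

/-- The deviation at time `τ` is independent of the remaining process, for a pair of independent
Brownian motions. -/
theorem IsPreBrownianReal.indepFun_midDev_untented (hA : IsPreBrownianReal A P)
    (hB : IsPreBrownianReal B P) (h : IndepFun (fun ω s => A s ω) (fun ω t => B t ω) P)
    (hτ : τ ≠ 0) :
    IndepFun (fun ω => (midDev τ A ω, midDev τ B ω))
      (fun ω => (fun t => untented τ A t ω, fun t => untented τ B t ω)) P := by
  have hG := hA.isGaussianProcess.sumElim hB.isGaussianProcess h
  have hP := hA.isGaussianProcess.isProbabilityMeasure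
  let X : Unit ⊕ Unit → Ω → ℝ := Sum.elim (fun _ => midDev τ A) (fun _ => midDev τ B)
  let Y : ℝ≥0 ⊕ ℝ≥0 → Ω → ℝ := Sum.elim (untented τ A) (untented τ B)
  have hG' : IsGaussianProcess (Sum.elim X Y) P := by
    classical
    refine hG.of_isGaussianProcess ?_
    rintro ((t | t) | (t | t))
    · exact ⟨{.inl τ, .inl (2 * τ)},
        { toFun x := x ⟨.inl τ, by simp⟩ - 2⁻¹ * x ⟨.inl (2 * τ), by simp⟩
          map_add' x y := by simp; ring
          map_smul' c x := by simp; ring }, by simp [X, midDev]⟩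
    · exact ⟨{.inr τ, .inr (2 * τ)},
        { toFun x := x ⟨.inr τ, by simp⟩ - 2⁻¹ * x ⟨.inr (2 * τ), by simp⟩
          map_add' x y := by simp; ring
          map_smul' c x := by simp; ring }, by simp [X, midDev]⟩
    · exact ⟨{.inl t, .inl τ, .inl (2 * τ)},
        { toFun x := x ⟨.inl t, by simp⟩ -
            tent τ t * (x ⟨.inl τ, by simp⟩ - 2⁻¹ * x ⟨.inl (2 * τ), by simp⟩)
          map_add' x y := by simp; ring
          map_smul' c x := by simp; ring }, by simp [Y, untented, midDev]⟩
    · exact ⟨{.inr t, .inr τ, .inr (2 * τ)},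
        { toFun x := x ⟨.inr t, by simp⟩ -
            tent τ t * (x ⟨.inr τ, by simp⟩ - 2⁻¹ * x ⟨.inr (2 * τ), by simp⟩)
          map_add' x y := by simp; ring
          map_smul' c x := by simp; ring }, by simp [Y, untented, midDev]⟩
  have hself {A : ℝ≥0 → Ω → ℝ} (hA : IsPreBrownianReal A P) (t : ℝ≥0) :
      cov[midDev τ A, untented τ A t; P] = 0 := by
    have e : untented τ A t = fun ω => A t ω - tent τ t * midDev τ A ω := rfl
    rw [e, covariance_fun_sub_right hA.memLp_midDev (hA.memLp_two _)
      (hA.memLp_midDev.const_mul _), covariance_const_mul_right]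
    have h1 := hA.covariance_midDev_eval hτ t
    have h2 := hA.covariance_midDev_self hτ
    change cov[midDev τ A, fun ω => A t ω; P] = _ at h1
    change cov[midDev τ A, fun ω => midDev τ A ω; P] = _ at h2
    rw [h1, h2, sub_self]
  have hcross {A B : ℝ≥0 → Ω → ℝ} (hA : IsPreBrownianReal A P) (hB : IsPreBrownianReal B P)
      (h : IndepFun (fun ω s => A s ω) (fun ω t => B t ω) P) (t : ℝ≥0) :
      cov[midDev τ A, untented τ B t; P] = 0 := by
    refine IndepFun.covariance_eq_zero ?_ hA.memLp_midDev
      ((hB.memLp_two t).sub (hB.memLp_midDev.const_mul _))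
    exact h.comp (φ := fun f => f τ - 2⁻¹ * f (2 * τ))
      (ψ := fun f => f t - tent τ t * (f τ - 2⁻¹ * f (2 * τ))) (by fun_prop) (by fun_prop)
  -- Deviations and residuals are jointly Gaussian, so the vanishing covariances suffice.
  have hind : IndepFun (fun ω s => X s ω) (fun ω t => Y t ω) P := by
    refine hG'.indepFun_of_covariance_eq_zero (fun s => ?_) (fun t => ?_) ?_
    · exact (hG'.comp_right Sum.inl).aemeasurable s
    · exact (hG'.comp_right Sum.inr).aemeasurable t
    · rintro (s | s) (t | t)
      · exact hself hA t
      · exact hcross hA hB h t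
      · exact hcross hB hA h.symm t
      · exact hself hB t
  exact hind.comp (φ := fun f => (f (.inl ()), f (.inr ())))
    (ψ := fun f => (fun t => f (.inl t), fun t => f (.inr t))) (by fun_prop) (by fun_prop)

lemma IsPreBrownianReal.map_midDev (hA : IsPreBrownianReal A P) (hτ : τ ≠ 0) :
    P.map (midDev τ A) = gaussianReal 0 (τ / 2) := by
  classical
  have h : HasGaussianLaw (midDev τ A) P := by
    have : IsGaussianProcess (fun _ : Unit => midDev τ A) P := by
      refine hA.isGaussianProcess.of_isGaussianProcess fun _ => ?_
      exact ⟨{τ, 2 * τ},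
        { toFun x := x ⟨τ, by simp⟩ - 2⁻¹ * x ⟨2 * τ, by simp⟩
          map_add' x y := by simp; ring
          map_smul' c x := by simp; ring }, by simp [midDev]⟩
    exact this.hasGaussianLaw_eval ()
  have hP := hA.isGaussianProcess.isProbabilityMeasure
  rw [h.map_eq_gaussianReal]
  congr 1
  · have e : midDev τ A = fun ω => A τ ω - 2⁻¹ * A (2 * τ) ω := rfl
    rw [e, integral_sub (hA.integrable_eval _) ((hA.integrable_eval _).const_mul _),
      integral_const_mul, hA.integral_eval, hA.integral_eval]
    simp
  · rw [← covariance_self h.aemeasurable, hA.covariance_midDev_self hτ]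
    ext
    simp only [NNReal.coe_div, NNReal.coe_ofNat, Real.coe_toNNReal']
    exact max_eq_left (by positivity)

end Real

lemma gaussianReal_le_smul_volume {v : ℝ≥0} (hv : v ≠ 0) (m : ℝ) :
    ∃ C : ℝ≥0, gaussianReal m v ≤ (C : ℝ≥0∞) • volume := by
  refine ⟨(√(2 * Real.pi * v))⁻¹.toNNReal, ?_⟩
  rw [gaussianReal_of_var_ne_zero _ hv, ← withDensity_const]
  refine withDensity_mono (ae_of_all _ fun x => ?_)
  refine ENNReal.ofReal_le_ofReal ?_
  rw [gaussianPDFReal]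
  refine mul_le_of_le_one_right (by positivity) (Real.exp_le_one_iff.2 ?_)
  rw [neg_div]
  exact neg_nonpos.2 (by positivity)

/-- A complex random variable whose real and imaginary parts are independent nondegenerate
Gaussians has bounded density. -/
lemma exists_map_complex_le_smul_volume [IsProbabilityMeasure P] {X Y : Ω → ℝ} (hX : AEMeasurable X P)
    (hY : AEMeasurable Y P) (h : IndepFun X Y P) {v w : ℝ≥0} (hv : v ≠ 0) (hw : w ≠ 0)
    (hXv : P.map X = gaussianReal 0 v) (hYw : P.map Y = gaussianReal 0 w) :
    ∃ C : ℝ≥0, P.map (fun ω => (⟨X ω, Y ω⟩ : ℂ)) ≤ (C : ℝ≥0∞) • volume := by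
  obtain ⟨C, hC⟩ := gaussianReal_le_smul_volume hv 0
  obtain ⟨D, hD⟩ := gaussianReal_le_smul_volume hw 0
  have hle : P.map (fun ω => (X ω, Y ω)) ≤ ((C * D : ℝ≥0) : ℝ≥0∞) • volume := by
    rw [(indepFun_iff_map_prod_eq_prod_map_map hX hY).1 h, hXv, hYw]
    calc _ ≤ ((C : ℝ≥0∞) • (volume : Measure ℝ)).prod ((D : ℝ≥0∞) • (volume : Measure ℝ)) :=
          Measure.prod_mono hC hD
      _ = _ := by
          rw [Measure.prod_smul_left, Measure.prod_smul_right, smul_smul, ENNReal.coe_mul]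
          rfl
  refine ⟨C * D, ?_⟩
  have e : (fun ω => (⟨X ω, Y ω⟩ : ℂ)) =
      Complex.measurableEquivRealProd.symm ∘ fun ω => (X ω, Y ω) := rfl
  rw [e, ← AEMeasurable.map_map_of_aemeasurable (by fun_prop) (hX.prodMk hY)]
  refine (Measure.map_mono hle (by fun_prop)).trans_eq ?_
  rw [Measure.map_smul, (Complex.volume_preserving_equiv_real_prod.symm _).map_eq]

end ProbabilityTheory

/-! ### A joint density bound for end point and nonlinear phase -/

namespace PZD

open Topology

/-- The image of the Lebesgue measure on the plane under `z ↦ a |z|² + c` has bounded density. -/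
lemma lintegral_norm_sq_le {f : ℝ → ℝ≥0∞} (hf : Measurable f) {a : ℝ} (ha : 0 < a) (c : ℝ) :
    ∫⁻ z : ℂ, f (a * ‖z‖ ^ 2 + c) ≤ ENNReal.ofReal (Real.pi / a) * ∫⁻ s, f s := by
  -- In polar coordinates s = ar² + c has ds = 2ar dr, so the planar measure 2πr dr becomes (π/a)
  -- ds.
  have hsub : ∫⁻ r in Set.Ioi (0 : ℝ), ENNReal.ofReal |2 * a * r| * f (a * r ^ 2 + c) ≤
      ∫⁻ s, f s := by
    rw [← lintegral_image_eq_lintegral_abs_deriv_mul (f := fun r : ℝ => a * r ^ 2 + c)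
      measurableSet_Ioi]
    · exact setLIntegral_le_lintegral _ _
    · intro r _
      have := ((hasDerivAt_pow 2 r).const_mul a).add_const c
      refine (this.congr_deriv ?_).hasDerivWithinAt
      simp; ring
    · intro r hr s hs h
      have h1 : r ^ 2 = s ^ 2 := by
        have : a * r ^ 2 = a * s ^ 2 := by simpa using h
        exact mul_left_cancel₀ ha.ne' this
      exact (pow_left_inj₀ (le_of_lt hr) (le_of_lt hs) two_ne_zero).1 h1
  rw [← Complex.lintegral_comp_polarCoord_symm]
  simp only [Complex.norm_polarCoord_symm, sq_abs, smul_eq_mul]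
  rw [polarCoord_target, Measure.volume_eq_prod,
    setLIntegral_prod _ (Measurable.aemeasurable (by fun_prop))]
  calc _ = ∫⁻ r in Set.Ioi (0 : ℝ), ENNReal.ofReal (Real.pi / a) *
        (ENNReal.ofReal |2 * a * r| * f (a * r ^ 2 + c)) := by
        refine setLIntegral_congr_fun measurableSet_Ioi fun r hr => ?_
        have hr' : (0 : ℝ) < r := hr
        simp only [lintegral_const,
          Measure.restrict_apply_univ, Real.volume_Ioo]
        rw [mul_comm, ← mul_assoc, ← mul_assoc, ← ENNReal.ofReal_mul (by linarith [Real.pi_pos]),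
          ← ENNReal.ofReal_mul (by positivity), abs_of_pos (by positivity)]
        congr 2
        field_simp
        ring
    _ = ENNReal.ofReal (Real.pi / a) *
        ∫⁻ r in Set.Ioi (0 : ℝ), (ENNReal.ofReal |2 * a * r| * f (a * r ^ 2 + c)) :=
        lintegral_const_mul _ (by fun_prop)
    _ ≤ _ := by gcongr

lemma measurable_intervalIntegral {Ω E : Type*} [MeasurableSpace Ω] [NormedAddCommGroup E]
    [NormedSpace ℝ E] [MeasurableSpace E] [BorelSpace E] [SecondCountableTopology E]
    {F : ℝ → Ω → E} (hF : ∀ t, Measurable (F t)) (hc : ∀ ω, Continuous fun t => F t ω) {a b : ℝ}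
    (hab : a ≤ b) : Measurable fun ω => ∫ t in a..b, F t ω := by
  simp only [intervalIntegral.integral_of_le hab]
  have h : Measurable (Function.uncurry F) :=
    measurable_uncurry_of_continuous_of_measurable hc hF
  have h2 : StronglyMeasurable (Function.uncurry fun (ω : Ω) (t : ℝ) => F t ω) :=
    Measurable.stronglyMeasurable (h.comp measurable_swap)
  exact (h2.integral_prod_right (ν := volume.restrict (Set.Ioc a b))).measurable

variable {Ω : Type*} [MeasurableSpace Ω] {P : Measure Ω} {σ γ L : ℝ} {W : ℝ≥0 → Ω → ℂ}

lemma IsRegularWiener.indepFun_midDev_untented (hσ : 0 < σ) (hW : IsRegularWiener σ W P) {τ : ℝ≥0}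
    (hτ : τ ≠ 0) : IndepFun (midDev τ W) (fun ω t => untented τ W t ω) P := by
  have hs : σ / √2 ≠ 0 := by positivity
  have h := hW.re.indepFun_midDev_untented hW.im.toIsPreBrownianReal hW.indep_scaled hτ
  convert h.comp (φ := fun p => Complex.measurableEquivRealProd.symm
      (σ / √2 * p.1, σ / √2 * p.2))
    (ψ := fun p t => Complex.measurableEquivRealProd.symm (σ / √2 * p.1 t, σ / √2 * p.2 t))
    (by fun_prop) (by fun_prop) using 1
  · funext ω
    apply Complex.ext <;> simp [midDev, Complex.measurableEquivRealProd_symm_apply] <;> field_simp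
  · funext ω t
    apply Complex.ext <;>
      simp [untented, midDev, Complex.measurableEquivRealProd_symm_apply] <;> field_simp

lemma exists_map_le_of_scaled [IsProbabilityMeasure P] {s : ℝ} (hs : 0 < s) {X Y : Ω → ℝ}
    {Z : Ω → ℂ} (hX : AEMeasurable X P) (hY : AEMeasurable Y P) (h : IndepFun X Y P) {v : ℝ≥0}
    (hv : v ≠ 0) (hXv : P.map X = gaussianReal 0 v) (hYv : P.map Y = gaussianReal 0 v)
    (hre : ∀ ω, X ω = s⁻¹ * (Z ω).re) (him : ∀ ω, Y ω = s⁻¹ * (Z ω).im) :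
    ∃ C : ℝ≥0, P.map Z ≤ (C : ℝ≥0∞) • volume := by
  have hm (X : Ω → ℝ) (hX : AEMeasurable X P) (hXv : P.map X = gaussianReal 0 v) :
      P.map (fun ω => s * X ω) = gaussianReal 0 (.mk (s ^ 2) (sq_nonneg s) * v) := by
    have := AEMeasurable.map_map_of_aemeasurable (g := fun x => s * x) (by fun_prop) hX
    rw [hXv, gaussianReal_map_const_mul, mul_zero] at this
    exact this.symm
  have hv' : NNReal.mk (s ^ 2) (sq_nonneg s) * v ≠ 0 :=
    mul_ne_zero (fun H => (pow_pos hs 2).ne' (by simpa using congrArg NNReal.toReal H)) hv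
  have hZ : Z = fun ω => (⟨s * X ω, s * Y ω⟩ : ℂ) := by
    funext ω
    apply Complex.ext
    · simp [hre, hs.ne']
    · simp [him, hs.ne']
  rw [hZ]
  exact exists_map_complex_le_smul_volume (hX.const_mul s) (hY.const_mul s)
    (h.comp (measurable_const_mul s) (measurable_const_mul s)) hv' hv' (hm X hX hXv) (hm Y hY hYv)

lemma IsRegularWiener.exists_map_midDev_le [IsProbabilityMeasure P] (hσ : 0 < σ)
    (hW : IsRegularWiener σ W P) {τ : ℝ≥0} (hτ : τ ≠ 0) :
    ∃ C : ℝ≥0, P.map (midDev τ W) ≤ (C : ℝ≥0∞) • volume := by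
  refine exists_map_le_of_scaled (by positivity : 0 < σ / √2) hW.re.memLp_midDev.aemeasurable
    hW.im.memLp_midDev.aemeasurable ?_ (div_ne_zero hτ two_ne_zero) (hW.re.map_midDev hτ)
    (hW.im.map_midDev hτ) (fun ω => ?_) (fun ω => ?_)
  · exact hW.indep_scaled.comp (φ := fun f => f τ - 2⁻¹ * f (2 * τ))
      (ψ := fun f => f τ - 2⁻¹ * f (2 * τ)) (by fun_prop) (by fun_prop)
  all_goals simp [midDev]; ring

lemma IsRegularWiener.exists_map_eval_le [IsProbabilityMeasure P] (hσ : 0 < σ)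
    (hW : IsRegularWiener σ W P) {τ : ℝ≥0} (hτ : τ ≠ 0) :
    ∃ C : ℝ≥0, P.map (W τ) ≤ (C : ℝ≥0∞) • volume := by
  refine exists_map_le_of_scaled (by positivity : 0 < σ / √2) (hW.re.aemeasurable τ)
    (hW.im.aemeasurable τ) ?_ hτ (hW.re.hasLaw_eval τ).map_eq (hW.im.hasLaw_eval τ).map_eq
    (fun ω => rfl) (fun ω => rfl)
  exact hW.indep_scaled.comp (measurable_pi_apply τ) (measurable_pi_apply τ)

@[fun_prop]
lemma continuous_tent (τ : ℝ≥0) : Continuous (tent τ) := by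
  unfold tent; fun_prop

lemma integral_tent_sq_pos {τ : ℝ≥0} (hτ : τ ≠ 0) :
    0 < ∫ t in (0 : ℝ)..(2 * τ), tent τ t.toNNReal ^ 2 := by
  have h0 : (0 : ℝ) < τ := by positivity
  refine intervalIntegral.intervalIntegral_pos_of_pos_on
    (Continuous.intervalIntegrable (by fun_prop) _ _) (fun t ht => ?_) (by linarith)
  have h : 0 < tent τ t.toNNReal := by
    rw [tent, Real.coe_toNNReal _ ht.1.le, min_eq_left ht.2.le]
    refine div_pos ?_ h0
    rcases le_total t τ with h | h
    · rw [min_eq_left h]; linarith [ht.1]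
    · rw [min_eq_right h]; linarith [ht.2]
  positivity

/-- Completing the square in the energy of a path shifted along a tent. -/
lemma integral_norm_sq_add_smul {u : ℝ → ℂ} (hu : Continuous u) {e : ℝ → ℝ} (he : Continuous e)
    {a b : ℝ} (hκ : 0 < ∫ t in a..b, e t ^ 2) (z : ℂ) :
    ∫ t in a..b, ‖u t + e t • z‖ ^ 2 =
      (∫ t in a..b, e t ^ 2) * ‖z + (∫ t in a..b, e t ^ 2)⁻¹ • ∫ t in a..b, e t • u t‖ ^ 2 +
        ((∫ t in a..b, ‖u t‖ ^ 2) - (∫ t in a..b, e t ^ 2)⁻¹ * ‖∫ t in a..b, e t • u t‖ ^ 2) := by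
  set κ := ∫ t in a..b, e t ^ 2
  have h1 : ∫ t in a..b, inner ℝ z (e t • u t) = inner ℝ z (∫ t in a..b, e t • u t) :=
    (innerSL ℝ z).intervalIntegral_comp_comm (Continuous.intervalIntegrable (by fun_prop) _ _)
  have h2 : ∀ t, ‖u t + e t • z‖ ^ 2 = ‖u t‖ ^ 2 + (2 * inner ℝ z (e t • u t) + e t ^ 2 * ‖z‖ ^ 2) := by
    intro t
    rw [norm_add_sq_real, real_inner_smul_right, real_inner_smul_right, norm_smul, mul_pow,
      Real.norm_eq_abs, sq_abs, real_inner_comm]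
    ring
  simp only [h2]
  rw [intervalIntegral.integral_add (Continuous.intervalIntegrable (by fun_prop) _ _)
    (Continuous.intervalIntegrable (by fun_prop) _ _),
    intervalIntegral.integral_add (Continuous.intervalIntegrable (by fun_prop) _ _)
    (Continuous.intervalIntegrable (by fun_prop) _ _), intervalIntegral.integral_const_mul,
    intervalIntegral.integral_mul_const, h1, norm_add_sq_real, real_inner_smul_right, norm_smul,
    mul_pow, Real.norm_eq_abs, sq_abs]
  field_simp
  ring

/-- The unrotated output and the nonlinear phase have a joint density which is bounded uniformly in
the input. -/
theorem IsRegularWiener.exists_lintegral_phase_le [IsProbabilityMeasure P] (hσ : 0 < σ)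
    (hL : 0 < L) (hγ : 0 < γ) (hW : IsRegularWiener σ W P) :
    ∃ C : ℝ≥0, ∀ (x : ℂ) (f : ℂ × ℝ → ℝ≥0∞), Measurable f →
      ∫⁻ ω, f (x + W L.toNNReal ω, nonlinearPhase γ L (fun t => W t ω) x) ∂P ≤
        C * ∫⁻ e, f e := by
  -- With this τ the tent lives on [0, L] and vanishes at L, so removing it leaves the end point
  -- unchanged.
  set τ : ℝ≥0 := L.toNNReal / 2 with hτdef
  have hLτ : L.toNNReal = 2 * τ := by rw [hτdef]; field_simp
  have hLτ' : L = 2 * (τ : ℝ) := by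
    rw [← Real.coe_toNNReal L hL.le, hLτ]; simp
  have hτ : τ ≠ 0 := by
    rintro h
    rw [h] at hLτ'
    simp at hLτ'
    exact hL.ne' hLτ'
  obtain ⟨C₁, hC₁⟩ := hW.exists_map_midDev_le hσ hτ
  obtain ⟨C₂, hC₂⟩ := hW.exists_map_eval_le hσ (τ := L.toNNReal) (by simpa using hL)
  have hind := hW.indepFun_midDev_untented hσ hτ
  let e : ℝ → ℝ := fun t => tent τ t.toNNReal
  have he : Continuous e := by unfold e; fun_prop
  set κ := ∫ t in (0 : ℝ)..L, e t ^ 2 with hκdef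
  have hκ : 0 < κ := by rw [hκdef, hLτ']; exact integral_tent_sq_pos hτ
  refine ⟨C₁ * (Real.pi / (γ * κ)).toNNReal * C₂, fun x f hf => ?_⟩
  -- Given the untented path, the end point is fixed and the phase is γκ|ξ+α|² + β, with ξ the
  -- midpoint deviation: independent, with a bounded planar density. This bounds the density of the
  -- phase by a multiple of π/(γκ) whatever α and β are; the end point has a bounded Gaussian
  -- density of its own.
  let V : ℝ → Ω → ℂ := fun t ω => x + untented τ W t.toNNReal ω
  let α : Ω → ℂ := fun ω => κ⁻¹ • ∫ t in (0 : ℝ)..L, e t • V t ω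
  let β : Ω → ℝ := fun ω => γ * ((∫ t in (0 : ℝ)..L, ‖V t ω‖ ^ 2) -
    κ⁻¹ * ‖∫ t in (0 : ℝ)..L, e t • V t ω‖ ^ 2)
  let T : Ω → ℂ × ℂ × ℝ := fun ω => (V L ω, α ω, β ω)
  have hVc (ω : Ω) : Continuous fun t => V t ω := by
    have := hW.continuous ω
    have := continuous_tent τ
    unfold V untented
    fun_prop
  have hξm : Measurable (midDev τ W) := by
    have h1 := hW.meas τ
    have h2 := hW.meas (2 * τ)
    unfold midDev
    fun_prop
  have hVm : Measurable fun ω t => untented τ W t ω := by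
    refine measurable_pi_lambda _ fun t => ?_
    have h1 := hW.meas t
    unfold untented
    fun_prop
  -- The integrals in `T` are measurable only thanks to path continuity, so independence is
  -- transferred through the σ-algebra generated by the untented path rather than by composing with
  -- a map on path space.
  have hTm : Measurable[MeasurableSpace.comap (fun ω t => untented τ W t ω) inferInstance] T := by
    let m : MeasurableSpace Ω := MeasurableSpace.comap (fun ω t => untented τ W t ω) inferInstance
    have hV (t : ℝ) : Measurable[m] (V t) := by
      have h0 : Measurable[m] fun ω t => untented τ W t ω := comap_measurable _
      have h1 : Measurable[m] fun ω => untented τ W t.toNNReal ω :=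
        (measurable_pi_apply t.toNNReal).comp h0
      exact h1.const_add x
    have h1 : Measurable[m] fun ω => ∫ t in (0 : ℝ)..L, e t • V t ω :=
      measurable_intervalIntegral (fun t => (hV t).const_smul (e t))
        (fun ω => by have := hVc ω; fun_prop) hL.le
    have h2 : Measurable[m] fun ω => ∫ t in (0 : ℝ)..L, ‖V t ω‖ ^ 2 :=
      measurable_intervalIntegral (fun t => (hV t).norm.pow_const 2)
        (fun ω => by have := hVc ω; fun_prop) hL.le
    exact (hV L).prodMk ((h1.const_smul κ⁻¹).prodMk
      ((h2.sub ((h1.norm.pow_const 2).const_mul κ⁻¹)).const_mul γ))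
  have hTm' : Measurable T := hTm.mono hVm.comap_le le_rfl
  have hindT : IndepFun T (midDev τ W) P := by
    rw [IndepFun_iff_Indep]
    exact indep_of_indep_of_le_left ((IndepFun_iff_Indep _ _ _).1 hind.symm) hTm.comap_le
  have hWL (ω : Ω) : x + W L.toNNReal ω = V L ω := by
    have : tent τ L.toNNReal = 0 := by
      have h0 : (0 : ℝ) < τ := by positivity
      rw [tent, hLτ]; push_cast
      rw [min_self, min_eq_right (by linarith)]
      simp
    simp [V, untented, this]
  have hphase (ω : Ω) : nonlinearPhase γ L (fun t => W t ω) x =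
      γ * κ * ‖midDev τ W ω + α ω‖ ^ 2 + β ω := by
    have := integral_norm_sq_add_smul (hVc ω) he hκ (midDev τ W ω)
    have h2 (t : ℝ) : V t ω + e t • midDev τ W ω = x + W t.toNNReal ω := by
      simp [V, e, untented]
      ring
    simp only [h2] at this
    rw [nonlinearPhase, this]
    simp only [α, β]
    ring
  let F : (ℂ × ℂ × ℝ) × ℂ → ℝ≥0∞ := fun q =>
    f (q.1.1, γ * κ * ‖q.2 + q.1.2.1‖ ^ 2 + q.1.2.2)
  have hFm : Measurable F := by unfold F; fun_prop
  have hf1 : Measurable fun y => ∫⁻ s, f (y, s) := hf.lintegral_prod_right'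
  calc ∫⁻ ω, f (x + W L.toNNReal ω, nonlinearPhase γ L (fun t => W t ω) x) ∂P
      = ∫⁻ q, F q ∂(P.map T).prod (P.map (midDev τ W)) := by
        rw [← (indepFun_iff_map_prod_eq_prod_map_map hTm'.aemeasurable hξm.aemeasurable).1 hindT,
          lintegral_map hFm (hTm'.prodMk hξm)]
        simp only [hWL, hphase, F, T]
    _ = ∫⁻ p, ∫⁻ z, F (p, z) ∂P.map (midDev τ W) ∂P.map T := lintegral_prod _ hFm.aemeasurable
    _ ≤ ∫⁻ p, C₁ * (ENNReal.ofReal (Real.pi / (γ * κ)) * ∫⁻ s, f (p.1, s)) ∂P.map T := by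
        refine lintegral_mono fun p => ?_
        refine (lintegral_mono' hC₁ le_rfl).trans ?_
        rw [lintegral_smul_measure, smul_eq_mul]
        gcongr
        have := lintegral_add_right_eq_self (μ := (volume : Measure ℂ))
          (fun z => f (p.1, γ * κ * ‖z‖ ^ 2 + p.2.2)) p.2.1
        simp only [F]
        rw [this]
        exact lintegral_norm_sq_le (f := fun s => f (p.1, s)) (by fun_prop) (by positivity) _
    _ = C₁ * (ENNReal.ofReal (Real.pi / (γ * κ)) *
          ∫⁻ ω, (∫⁻ s, f (x + W L.toNNReal ω, s)) ∂P) := by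
        rw [lintegral_const_mul _ (by fun_prop), lintegral_const_mul _ (by fun_prop),
          lintegral_map (by fun_prop) hTm']
        simp only [hWL, T]
    _ ≤ C₁ * (ENNReal.ofReal (Real.pi / (γ * κ)) * (C₂ * ∫⁻ e, f e)) := by
        gcongr
        have h1 : ∫⁻ ω, (∫⁻ s, f (x + W L.toNNReal ω, s)) ∂P =
            ∫⁻ y, (∫⁻ s, f (x + y, s)) ∂P.map (W L.toNNReal) := by
          rw [lintegral_map (by fun_prop) (hW.meas _)]
        rw [h1]
        refine (lintegral_mono' hC₂ le_rfl).trans ?_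
        rw [lintegral_smul_measure, smul_eq_mul,
          lintegral_add_left_eq_self (fun y => ∫⁻ s, f (y, s)) x, Measure.volume_eq_prod,
          lintegral_prod _ hf.aemeasurable]
    _ = _ := by
        rw [ENNReal.coe_mul, ENNReal.coe_mul, ENNReal.ofReal]
        ring

end PZD

/-! ### Finiteness of the mutual information -/

namespace PZD

open InformationTheory

variable {Ω : Type*} [MeasurableSpace Ω] {P : Measure Ω} {σ γ L : ℝ} {W : ℝ≥0 → Ω → ℂ}

lemma IsRegularWiener.integrable_and_integral_sq_norm [IsProbabilityMeasure P] (hσ : 0 < σ)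
    (hW : IsRegularWiener σ W P) (t : ℝ≥0) :
    Integrable (fun ω => ‖W t ω‖ ^ 2) P ∧ ∫ ω, ‖W t ω‖ ^ 2 ∂P = σ ^ 2 * t := by
  have hs : σ / √2 ≠ 0 := by positivity
  have h2 {A : ℝ≥0 → Ω → ℝ} (hA : IsBrownianReal A P) : ∫ ω, A t ω ^ 2 ∂P = t := by
    have := hA.covariance_eval t t
    rw [covariance_self (hA.aemeasurable t), variance_of_integral_eq_zero (hA.aemeasurable t)
      (hA.integral_eval t)] at this
    simpa using this
  have e : (fun ω => ‖W t ω‖ ^ 2) = fun ω => (σ / √2) ^ 2 * ((σ / √2)⁻¹ * (W t ω).re) ^ 2 +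
      (σ / √2) ^ 2 * ((σ / √2)⁻¹ * (W t ω).im) ^ 2 := by
    funext ω
    rw [sq_norm_eq]
    field_simp
  have i1 := (hW.re.memLp_two t).integrable_sq.const_mul ((σ / √2) ^ 2)
  have i2 := (hW.im.memLp_two t).integrable_sq.const_mul ((σ / √2) ^ 2)
  rw [e]
  refine ⟨i1.add i2, ?_⟩
  rw [integral_add i1 i2, integral_const_mul, integral_const_mul, h2 hW.re, h2 hW.im, div_pow,
    Real.sq_sqrt zero_le_two]
  ring

lemma IsRegularWiener.integrable_integral_sq_norm [IsProbabilityMeasure P] (hσ : 0 < σ)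
    (hL : 0 < L) (hW : IsRegularWiener σ W P) :
    Integrable (fun ω => ∫ t in (0 : ℝ)..L, ‖W t.toNNReal ω‖ ^ 2) P := by
  have hm : Measurable fun q : ℝ × Ω => ‖W q.1.toNNReal q.2‖ ^ 2 := by
    have := hW.measurable_uncurry.comp
      (by fun_prop : Measurable fun q : ℝ × Ω => (q.1.toNNReal, q.2))
    exact this.norm.pow_const 2
  have h : Integrable (fun q : ℝ × Ω => ‖W q.1.toNNReal q.2‖ ^ 2)
      ((volume.restrict (Set.Ioc 0 L)).prod P) := by
    rw [integrable_prod_iff hm.aestronglyMeasurable]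
    refine ⟨ae_of_all _ fun t => (hW.integrable_and_integral_sq_norm hσ t.toNNReal).1, ?_⟩
    have e (t : ℝ) : ∫ ω, ‖‖W t.toNNReal ω‖ ^ 2‖ ∂P = σ ^ 2 * t.toNNReal := by
      simpa using (hW.integrable_and_integral_sq_norm hσ t.toNNReal).2
    simp only [e]
    exact ((by fun_prop : Continuous fun t : ℝ => σ ^ 2 * (t.toNNReal : ℝ)).integrableOn_Icc).mono_set
      Set.Ioc_subset_Icc_self
  simpa only [intervalIntegral.integral_of_le hL.le] using h.integral_prod_right

lemma nonlinearPhase_nonneg (hγ : 0 < γ) (hL : 0 < L) (w : ℝ≥0 → ℂ) (x : ℂ) :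
    0 ≤ nonlinearPhase γ L w x :=
  mul_nonneg hγ.le (intervalIntegral.integral_nonneg hL.le fun _ _ => by positivity)

lemma norm_add_sq_le_two_mul (x y : ℂ) : ‖x + y‖ ^ 2 ≤ 2 * ‖x‖ ^ 2 + 2 * ‖y‖ ^ 2 := by
  have h := norm_add_le x y
  nlinarith [sq_nonneg (‖x‖ - ‖y‖), norm_nonneg (x + y), norm_nonneg x, norm_nonneg y]

lemma nonlinearPhase_le (hγ : 0 < γ) (hL : 0 < L) {w : ℝ≥0 → ℂ} (hw : Continuous w) (x : ℂ) :
    nonlinearPhase γ L w x ≤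
      γ * (2 * L * ‖x‖ ^ 2 + 2 * ∫ t in (0 : ℝ)..L, ‖w t.toNNReal‖ ^ 2) := by
  have h : ∫ t in (0 : ℝ)..L, ‖x + w t.toNNReal‖ ^ 2 ≤
      ∫ t in (0 : ℝ)..L, (2 * ‖x‖ ^ 2 + 2 * ‖w t.toNNReal‖ ^ 2) :=
    intervalIntegral.integral_mono_on hL.le (Continuous.intervalIntegrable (by fun_prop) _ _)
      (Continuous.intervalIntegrable (by fun_prop) _ _) fun t _ => norm_add_sq_le_two_mul _ _
  rw [intervalIntegral.integral_add (Continuous.intervalIntegrable (by fun_prop) _ _)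
    (Continuous.intervalIntegrable (by fun_prop) _ _), intervalIntegral.integral_const,
    intervalIntegral.integral_const_mul, sub_zero, smul_eq_mul] at h
  rw [nonlinearPhase]
  refine mul_le_mul_of_nonneg_left (h.trans_eq ?_) hγ.le
  ring

/-- The input together with the unrotated output and the nonlinear phase. -/
noncomputable def phaseTriple (γ L : ℝ) (W : ℝ≥0 → Ω → ℂ) (p : ℂ × Ω) : ℂ × (ℂ × ℝ) :=
  (p.1, p.1 + W L.toNNReal p.2, nonlinearPhase γ L (fun t => W t p.2) p.1)

lemma IsRegularWiener.measurable_phaseTriple (hL : 0 < L) (hW : IsRegularWiener σ W P) :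
    Measurable (phaseTriple γ L W) := by
  have h1 := hW.measurable_nonlinearPhase (γ := γ) hL
  have h2 := hW.meas L.toNNReal
  unfold phaseTriple
  fun_prop

lemma IsRegularWiener.integrable_norm_phaseTriple [IsProbabilityMeasure P] (hσ : 0 < σ)
    (hL : 0 < L) (hγ : 0 < γ) (hW : IsRegularWiener σ W P) {μ : Measure ℂ}
    [IsProbabilityMeasure μ] (hμ : Integrable (fun x => ‖x‖ ^ 2) μ) :
    Integrable (fun p => ‖(phaseTriple γ L W p).2‖) (μ.prod P) := by
  have hbound : Integrable (fun p : ℂ × Ω => 1 + 2 * ‖p.1‖ ^ 2 + 2 * ‖W L.toNNReal p.2‖ ^ 2 +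
      γ * (2 * L * ‖p.1‖ ^ 2 + 2 * ∫ t in (0 : ℝ)..L, ‖W t.toNNReal p.2‖ ^ 2)) (μ.prod P) := by
    have i1 := hμ.comp_fst P
    have i2 := (hW.integrable_and_integral_sq_norm hσ L.toNNReal).1.comp_snd μ
    have i3 := (hW.integrable_integral_sq_norm hσ hL).comp_snd μ
    exact (((integrable_const 1).add (i1.const_mul 2)).add (i2.const_mul 2)).add
      (((i1.const_mul (2 * L)).add (i3.const_mul 2)).const_mul γ)
  refine hbound.mono' ?_ (ae_of_all _ fun p => ?_)
  · exact ((hW.measurable_phaseTriple hL).snd.norm).aestronglyMeasurable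
  · have h1 := nonlinearPhase_le hγ hL (hW.continuous p.2) p.1
    have h2 := norm_add_sq_le_two_mul p.1 (W L.toNNReal p.2)
    have h3 := nonlinearPhase_nonneg hγ hL (fun t => W t p.2) p.1
    have h4 : 0 ≤ 1 + 2 * ‖p.1‖ ^ 2 + 2 * ‖W L.toNNReal p.2‖ ^ 2 := by positivity
    rw [norm_norm, Prod.norm_def, phaseTriple]
    refine max_le ?_ ?_
    · dsimp only
      nlinarith [sq_nonneg (‖p.1 + W L.toNNReal p.2‖ - 1)]
    · dsimp only
      rw [Real.norm_of_nonneg h3]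
      linarith

/-- The mutual information of an input of finite power is finite. -/
theorem IsRegularWiener.mutualInfo_ne_top [IsProbabilityMeasure P] (hσ : 0 < σ)
    (hL : 0 < L) (hγ : 0 < γ) (hW : IsRegularWiener σ W P) {μ : Measure ℂ}
    [IsProbabilityMeasure μ] (hμ : Integrable (fun x => ‖x‖ ^ 2) μ) :
    mutualInfo γ L W P μ ≠ ∞ := by
  obtain ⟨C, hC⟩ := hW.exists_lintegral_phase_le hσ hL hγ
  have hTm := hW.measurable_phaseTriple (γ := γ) hL
  let D : ℝ := max C 1
  have hD : 1 ≤ D := le_max_right _ _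
  -- The exponent 4 exceeds the real dimension 3, so the reference measure `ν` is finite. Relative
  -- to it the density bound becomes D(1+‖e‖)⁴ = e^h; taking D ≥ 1 makes h nonnegative.
  let w : ℂ × ℝ → ℝ := fun e => (1 + ‖e‖) ^ (-4 : ℝ)
  let ν : Measure (ℂ × ℝ) := volume.withDensity fun e => ENNReal.ofReal (w e)
  have : (volume : Measure (ℂ × ℝ)).IsAddHaarMeasure :=
    inferInstanceAs ((volume : Measure ℂ).prod (volume : Measure ℝ)).IsAddHaarMeasure
  have hν : IsFiniteMeasure ν :=
    isFiniteMeasure_withDensity (finite_integral_one_add_norm (by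
      simp only [Module.finrank_prod, Complex.finrank_real_complex, Module.finrank_self]
      norm_num)).ne
  let Γ := (μ.prod P).map (phaseTriple γ L W)
  have hΓ : IsProbabilityMeasure Γ := Measure.isProbabilityMeasure_map hTm.aemeasurable
  let h : ℂ × (ℂ × ℝ) → ℝ := fun q => Real.log D + 4 * Real.log (1 + ‖q.2‖)
  have hm : Measurable h := by unfold h; fun_prop
  have hlog (r : ℝ) (hr : 0 ≤ r) : 0 ≤ Real.log (1 + r) := Real.log_nonneg (by linarith)
  have h0 : ∀ q, 0 ≤ h q := fun q => by
    have h1 := Real.log_nonneg hD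
    have h2 := hlog ‖q.2‖ (norm_nonneg _)
    simp only [h]; positivity
  have hexp (q : ℂ × (ℂ × ℝ)) :
      ENNReal.ofReal (w q.2) * ENNReal.ofReal (Real.exp (h q)) = ENNReal.ofReal D := by
    have h1 : 0 < 1 + ‖q.2‖ := by positivity
    rw [← ENNReal.ofReal_mul (by positivity)]
    congr 1
    simp only [w, h]
    rw [Real.exp_add, Real.exp_log (by linarith), mul_comm 4, ← Real.rpow_def_of_pos h1,
      mul_left_comm, ← Real.rpow_add h1]
    simp
  have hle : Γ ≤ (μ.prod ν).withDensity fun q => ENNReal.ofReal (Real.exp (h q)) := by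
    refine Measure.le_intro fun s hs _ => ?_
    have hind : Measurable (s.indicator (1 : ℂ × (ℂ × ℝ) → ℝ≥0∞)) := measurable_one.indicator hs
    rw [withDensity_apply _ hs, ← lintegral_indicator hs, lintegral_prod _
      (Measurable.aemeasurable (by fun_prop)), ← lintegral_indicator_one hs,
      lintegral_map hind hTm, lintegral_prod (fun p => s.indicator 1 (phaseTriple γ L W p))
      (hind.comp hTm).aemeasurable]
    refine lintegral_mono fun x => (hC x (fun e => s.indicator 1 (x, e))
      (hind.comp measurable_prodMk_left)).trans ?_
    rw [lintegral_withDensity_eq_lintegral_mul _ (by fun_prop) (by fun_prop), ←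
      lintegral_const_mul (f := fun e => s.indicator 1 (x, e)) _
      (hind.comp measurable_prodMk_left)]
    refine lintegral_mono fun e => ?_
    rw [Pi.mul_apply]
    by_cases hq : (x, e) ∈ s
    · rw [Set.indicator_of_mem hq, Set.indicator_of_mem hq, hexp (x, e), Pi.one_apply, mul_one,
        ← ENNReal.ofReal_coe_nnreal]
      exact ENNReal.ofReal_le_ofReal (le_max_left _ _)
    · simp [Set.indicator_of_notMem hq]
  -- Since log(1+r) ≤ r, a first moment of the pair suffices. The phase grows quadratically in the
  -- input, which is where the second moment enters.
  have hint : ∫⁻ q, ENNReal.ofReal (h q) ∂Γ ≠ ∞ := by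
    rw [lintegral_map (by fun_prop) hTm]
    refine ne_top_of_le_ne_top ((((integrable_const (Real.log D)).add
      ((hW.integrable_norm_phaseTriple hσ hL hγ hμ).const_mul 4))).lintegral_lt_top).ne
      (lintegral_mono fun p => ENNReal.ofReal_le_ofReal ?_)
    have := Real.log_le_sub_one_of_pos
      (by positivity : 0 < 1 + ‖(phaseTriple γ L W p).2‖)
    simp only [h, Pi.add_apply]
    linarith
  have hfin := klDiv_ne_top_of_le_withDensity hm h0 hle hint
  -- The output is a function of end point and phase, so data processing bounds the divergence from
  -- a product with an auxiliary output law; the compensation identity shows that the true output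
  -- marginal only lowers it.
  let g : ℂ × (ℂ × ℝ) → ℂ × ℂ := Prod.map id fun e => PZD.rot e.2 e.1
  have hrm : Measurable fun e : ℂ × ℝ => PZD.rot e.2 e.1 :=
    measurable_rot'.comp measurable_swap
  have hgm : Measurable g := measurable_id.prodMap hrm
  have hmap1 : Γ.map g = jointLaw γ L W P μ := by
    rw [Measure.map_map hgm hTm, jointLaw]
    congr 1
    funext p
    simp [g, phaseTriple, output_eq]
  have hmap2 : (μ.prod ν).map g = μ.prod (ν.map fun e => PZD.rot e.2 e.1) := by
    rw [← Measure.map_prod_map _ _ measurable_id hrm, Measure.map_id]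
  have hJ : IsProbabilityMeasure (jointLaw γ L W P μ) := by
    rw [← hmap1]; exact Measure.isProbabilityMeasure_map hgm.aemeasurable
  have hfst : (jointLaw γ L W P μ).fst = μ := by
    have := hW.isMarkovKernel_channel (γ := γ) hL
    rw [hW.jointLaw_eq hL, Measure.fst_compProd]
  have hle2 := klDiv_map_le Γ (μ.prod ν) hgm
  rw [hmap1, hmap2] at hle2
  have hadd := klDiv_fst_prod_eq_add (jointLaw γ L W P μ) (ν.map fun e => PZD.rot e.2 e.1)
  rw [hfst] at hadd
  rw [mutualInfo, hfst]
  exact ne_top_of_le_ne_top hfin ((le_add_self.trans_eq hadd.symm).trans hle2)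

end PZD

/-! ### Uniform phase and the input constraints -/

namespace PZD

instance : IsProbabilityMeasure uniformPhase :=
  cond_isProbabilityMeasure_of_finite (by simp [Real.pi_pos])
    (by rw [Real.volume_Ico]; exact ENNReal.ofReal_ne_top)

/-- A periodic function lifts to the circle, where the measure is translation invariant. -/
lemma lintegral_uniformPhase_add {g : ℝ → ℝ≥0∞}
    (hper : Function.Periodic g (2 * Real.pi)) (c : ℝ) :
    ∫⁻ φ, g (φ + c) ∂uniformPhase = ∫⁻ φ, g φ ∂uniformPhase := by
  have : Fact (0 < 2 * Real.pi) := ⟨by positivity⟩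
  have key (h : AddCircle (2 * Real.pi) → ℝ≥0∞) :
      ∫⁻ φ : ℝ in Set.Ico 0 (2 * Real.pi), h φ = ∫⁻ b, h b := by
    rw [setLIntegral_congr (Ico_ae_eq_Ioc (μ := volume))]
    simpa using AddCircle.lintegral_preimage (2 * Real.pi) 0 h
  have h1 := key hper.lift
  have h2 := key fun b => hper.lift (b + c)
  rw [lintegral_add_right_eq_self, ← h1] at h2
  rw [uniformPhase, ProbabilityTheory.cond, lintegral_smul_measure, lintegral_smul_measure]
  congr 1

lemma periodic_rot (x : ℂ) : Function.Periodic (fun φ => rot φ x) (2 * Real.pi) := by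
  intro φ
  simp only [rot]
  congr 1
  push_cast
  rw [mul_add, mul_comm Complex.I (2 * _), Complex.exp_add, Complex.exp_two_pi_mul_I,
    mul_one]

lemma lintegral_rotAverage (U : Measure ℝ) [SFinite U] (μ : Measure ℂ) [SFinite μ]
    {f : ℂ → ℝ≥0∞} (hf : Measurable f) :
    ∫⁻ x, f x ∂(rotAverage U μ) = ∫⁻ x, ∫⁻ φ, f (rot φ x) ∂U ∂μ := by
  rw [rotAverage, lintegral_map hf (by fun_prop), lintegral_prod_symm _
    (Measurable.aemeasurable (by fun_prop))]

lemma map_rot_rotAverage (μ : Measure ℂ) [SFinite μ] (θ : ℝ) :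
    (rotAverage uniformPhase μ).map (rot θ) = rotAverage uniformPhase μ := by
  refine Measure.ext_of_lintegral _ fun f hf => ?_
  rw [lintegral_map hf (by fun_prop), lintegral_rotAverage _ _ (by fun_prop),
    lintegral_rotAverage _ _ hf]
  refine lintegral_congr fun x => ?_
  simp only [rot_rot, add_comm θ]
  exact lintegral_uniformPhase_add (g := fun φ => f (rot φ x))
    ((periodic_rot x).comp f) θ

lemma rotAverage_eq_of_map_rot_eq (U : Measure ℝ) [IsProbabilityMeasure U] {μ : Measure ℂ}
    [SFinite μ] (h : ∀ θ, μ.map (rot θ) = μ) : rotAverage U μ = μ := by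
  refine Measure.ext_of_lintegral _ fun f hf => ?_
  rw [rotAverage, lintegral_map hf (by fun_prop), lintegral_prod _
    (Measurable.aemeasurable (by fun_prop))]
  have (θ : ℝ) : ∫⁻ x, f (rot θ x) ∂μ = ∫⁻ x, f x ∂μ := by
    conv_rhs => rw [← h θ, lintegral_map hf (by fun_prop)]
  simp [this]

/-- For each x the shift by its argument is absorbed by the uniform phase. At x = 0 every phase
gives the same point, so no exception is needed. -/
lemma rotAverage_uniformPhase (μ : Measure ℂ) [IsProbabilityMeasure μ] :
    rotAverage uniformPhase μ =
      ((amplitudeLaw μ).prod uniformPhase).map fun p => polar p.1 p.2 := by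
  have hp : Measurable fun p : ℝ≥0 × ℝ => polar p.1 p.2 := by
    unfold polar; fun_prop
  have : IsProbabilityMeasure (amplitudeLaw μ) :=
    Measure.isProbabilityMeasure_map measurable_nnnorm.aemeasurable
  refine Measure.ext_of_lintegral _ fun f hf => ?_
  have hfp : Measurable fun p : ℝ≥0 × ℝ => f (polar p.1 p.2) := hf.comp hp
  rw [lintegral_rotAverage _ _ hf, lintegral_map hf hp, lintegral_prod _ hfp.aemeasurable,
    amplitudeLaw, lintegral_map (hfp.lintegral_prod_right') measurable_nnnorm]
  refine lintegral_congr fun x => ?_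
  have hx : x = rot x.arg (‖x‖ : ℝ) := by
    rw [rot, mul_comm, mul_comm Complex.I, Complex.norm_mul_exp_arg_mul_I]
  have h := lintegral_uniformPhase_add (g := fun φ => f (rot φ (‖x‖ : ℝ)))
    ((periodic_rot _).comp f) x.arg
  simp only [← rot_rot, ← hx] at h
  simpa only [polar_eq_rot, coe_nnnorm] using h

lemma amplitudeLaw_rotAverage (U : Measure ℝ) [IsProbabilityMeasure U] (μ : Measure ℂ)
    [IsProbabilityMeasure μ] : amplitudeLaw (rotAverage U μ) = amplitudeLaw μ := by
  have h : (fun x : ℂ => ‖x‖₊) ∘ (fun q : ℝ × ℂ => rot q.1 q.2) = (fun x : ℂ => ‖x‖₊) ∘ Prod.snd := by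
    funext q
    exact NNReal.eq (norm_rot q.1 q.2)
  rw [amplitudeLaw, rotAverage, Measure.map_map measurable_nnnorm (by fun_prop), h,
    ← Measure.map_map measurable_nnnorm measurable_snd, Measure.map_snd_prod, measure_univ,
    one_smul, amplitudeLaw]

lemma integrable_sq_norm_of_mem_peakSet {μ : Measure ℂ} [IsProbabilityMeasure μ] {ρ : ℝ≥0}
    (h : amplitudeLaw μ ∈ peakSet ρ) : Integrable (fun x => ‖x‖ ^ 2) μ := by
  have : IsProbabilityMeasure (amplitudeLaw μ) :=
    Measure.isProbabilityMeasure_map measurable_nnnorm.aemeasurable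
  have h1 : ∀ᵐ r ∂(amplitudeLaw μ), r ∈ Set.Icc 0 ρ :=
    (mem_ae_iff_prob_eq_one measurableSet_Icc).2 h
  have h2 := ae_of_ae_map measurable_nnnorm.aemeasurable h1
  refine Integrable.of_bound (Continuous.aestronglyMeasurable (by fun_prop)) ((ρ : ℝ) ^ 2) ?_
  filter_upwards [h2] with x hx
  have h3 : ‖x‖ ≤ ρ := hx.2
  rw [norm_pow, norm_norm]
  gcongr

lemma integrable_sq_norm_of_mem_costSet {μ : Measure ℂ} [IsProbabilityMeasure μ]
    {C : ℝ≥0 → ℝ≥0} {A : ℝ≥0} (hC : IsCost (fun r => (r : ℝ) ^ 2) C)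
    (h : amplitudeLaw μ ∈ costSet C A) : Integrable (fun x => ‖x‖ ^ 2) μ := by
  -- Beyond `R` the growth condition gives r² ≤ C(r); below it r² ≤ R².
  obtain ⟨R, hR⟩ := eventually_atTop.1 (hC.growth.bound one_pos)
  have hle (x : ℂ) : ‖‖x‖ ^ 2‖ₑ ≤ (R ^ 2 : ℝ≥0) + (C ‖x‖₊ : ℝ≥0∞) := by
    have e : ‖‖x‖ ^ 2‖ₑ = ((‖x‖₊ ^ 2 : ℝ≥0) : ℝ≥0∞) := by
      rw [enorm_eq_nnnorm, nnnorm_pow, nnnorm_norm]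
    rw [e, ← ENNReal.coe_add, ENNReal.coe_le_coe]
    rcases le_total ‖x‖₊ R with hx | hx
    · exact (pow_le_pow_left₀ zero_le hx 2).trans le_self_add
    · have := hR _ hx
      rw [one_mul, Real.norm_of_nonneg (by positivity), Real.norm_of_nonneg (by positivity)] at this
      exact (by exact_mod_cast this : ‖x‖₊ ^ 2 ≤ C ‖x‖₊).trans le_add_self
  have h1 : ∫⁻ x, (C ‖x‖₊ : ℝ≥0∞) ∂μ ≤ A := by
    have : ∫⁻ r, (C r : ℝ≥0∞) ∂(amplitudeLaw μ) ≤ A := h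
    rwa [amplitudeLaw, lintegral_map hC.mono.measurable.coe_nnreal_ennreal measurable_nnnorm] at this
  refine ⟨Continuous.aestronglyMeasurable (by fun_prop), (lintegral_mono hle).trans_lt ?_⟩
  rw [lintegral_add_left measurable_const, lintegral_const, measure_univ, mul_one]
  exact ENNReal.add_lt_top.2 ⟨ENNReal.coe_lt_top, h1.trans_lt ENNReal.coe_lt_top⟩

lemma IsInputConstraint.integrable_sq_norm {F : Set (Measure ℝ≥0)} (hF : IsInputConstraint F)
    {μ : Measure ℂ} [IsProbabilityMeasure μ] (h : amplitudeLaw μ ∈ F) :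
    Integrable (fun x => ‖x‖ ^ 2) μ := by
  cases hF with
  | peak ρ hρ => exact integrable_sq_norm_of_mem_peakSet h
  | cost C A hA hC => exact integrable_sq_norm_of_mem_costSet hC h
  | joint ρ C A hρ hA hC => exact integrable_sq_norm_of_mem_peakSet h.1

end PZD

/-! ### The theorem -/

theorem lemma2 {Ω : Type*} [MeasurableSpace Ω] (P : Measure Ω) [IsProbabilityMeasure P]
    (γ σ L : ℝ) (hγ : 0 < γ) (hσ : 0 < σ) (hL : 0 < L)
    (W : ℝ≥0 → Ω → ℂ) (hW : PZD.IsComplexWiener σ W P) :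
    -- the law of the output amplitude given the input `(r₀, φ₀)` does not depend on `φ₀`
    (∀ (r₀ : ℝ≥0) (φ₀ φ₁ : ℝ),
      PZD.outputAmplitudeLaw γ L W P (PZD.polar r₀ φ₀) =
        PZD.outputAmplitudeLaw γ L W P (PZD.polar r₀ φ₁)) ∧
    -- a capacity-achieving input is the law of `R₀ exp (j Φ₀)` with `Φ₀` uniform on `[0, 2π)`
    -- and independent of `R₀`
    (∀ F : Set (Measure ℝ≥0), PZD.IsInputConstraint F →
      ∀ μ : Measure ℂ, PZD.IsCapacityAchieving γ L W P F μ →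
        μ = ((PZD.amplitudeLaw μ).prod PZD.uniformPhase).map fun p => PZD.polar p.1 p.2) := by
  refine ⟨fun r φ₀ φ₁ => ?_, fun F hF μ hμ => ?_⟩
  · rw [hW.outputAmplitudeLaw_polar hσ hL, hW.outputAmplitudeLaw_polar hσ hL]
  have := hμ.prob
  obtain ⟨W', hW', hWW'⟩ := hW.exists_isRegularWiener hσ
  have := hW'.isMarkovKernel_channel (γ := γ) hL
  have hI (ν : Measure ℂ) [IsProbabilityMeasure ν] :
      PZD.mutualInfo γ L W P ν = InformationTheory.klDiv (ν ⊗ₘ PZD.channel γ L W' P)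
        (ν.prod (PZD.channel γ L W' P ∘ₘ ν)) := by
    rw [PZD.mutualInfo_congr hWW', hW'.mutualInfo_eq hL]
  have hfin : PZD.mutualInfo γ L W P μ ≠ ∞ := by
    rw [PZD.mutualInfo_congr hWW']
    exact hW'.mutualInfo_ne_top hσ hL hγ (hF.integrable_sq_norm hμ.mem)
  -- Averaging over rotations preserves the amplitude law, so the averaged input competes in the
  -- supremum.
  have hle : PZD.mutualInfo γ L W P (PZD.rotAverage PZD.uniformPhase μ) ≤
      PZD.mutualInfo γ L W P μ := by
    rw [hμ.eq]
    refine le_iSup₂_of_le _ inferInstance (le_iSup_of_le ?_ le_rfl)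
    rw [PZD.amplitudeLaw_rotAverage]
    exact hμ.mem
  rw [hI] at hfin
  rw [hI, hI] at hle
  have hout := PZD.map_rot_comp_of_klDiv_rotAverage_le PZD.uniformPhase μ
    (hW'.isRotEquivariant_channel hσ hL) (PZD.map_rot_rotAverage μ) hfin hle
  have hinv := PZD.map_rot_eq_of_map_rot_comp_eq hσ hL hW' hout
  rw [← PZD.rotAverage_uniformPhase, PZD.rotAverage_eq_of_map_rot_eq _ hinv]
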